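/- **Setting.** Let $n\ge 1$, let $\epsilon_1=\epsilon_2=-\epsilon_3=1$, and let $(i,j,k)$ always denote a cyclic permutation of $(1,2,3)$. Let $M$ be a smooth Hausdorff manifold of dimension $4n+3$ with a paraquaternionic contact (pqc) structure: pointwise linearly independent smooth 1-forms $\eta_1,\eta_2,\eta_3$ and, on the distribution $H=\bigcap_s\ker\eta_s$, smooth endomorphisms $I_1,I_2,I_3$ with $I_s^2=\epsilon_s$, $I_iI_j=-I_jI_i=-\epsilon_kI_k$, and a smooth metric $g$ of neutral signature with $$g(I_sX,I_sY)=-\epsilon_s\,g(X,Y),\qquad -2\epsilon_s\,g(I_sX,Y)=d\eta_s(X,Y)\qquad (X,Y\in H).$$ Let $\nabla$ be its canonical pqc connection. This is the smooth affine connection which, together with a complement $V=\mathrm{span}\{\xi_1,\xi_2,\xi_3\}$ of $H$, $\eta_s(\xi_t)=\delta_{st}$, is characterized as follows. It preserves $H$, $V$ and $g$. Its torsion $T$ satisfies $T(X,Y)=-[X,Y]_V$ for $X,Y\in H$, and for $\xi\in V$ the endomorphism $X\mapsto T(\xi,X)_H$ of $H$ is orthogonal to $sp(n,\mathbb R)\oplus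 sp(1,\mathbb R)$. It preserves the bundle $\mathrm{span}\{I_1,I_2,I_3\}$, and the identification $\xi_s\mapsto I_s$ is parallel. For $n=1$ one requires in addition that $(\xi_s\lrcorner d\eta_s)|_H=0$ and $(\xi_j\lrcorner d\eta_i)|_H=\epsilon_k(\xi_i\lrcorner d\eta_j)|_H$ for all $s$ and all $(i,j,k)$ (existence of such $\xi_s$ is part of the definition of a pqc structure in dimension seven). Here $[\cdot,\cdot]_V$ and $(\cdot)_H$ are the components along $TM=H\oplus V$. **Notation.** The $sp(1,\mathbb R)$-connection 1-forms $\alpha_s$ are given by $$\nabla I_i=\alpha_j\otimes I_k+\epsilon_k\alpha_k\otimes I_j,\qquad \nabla\xi_i=\alpha_j\otimes\xi_k+\epsilon_k\alpha_k\otimes\xi_j .$$ The fundamental 2-forms $\omega_s$ satisfy $\omega_s(X,Y)=g(I_sX,Y)$ on $H$ and $\xi_t\lrcorner\omega_s=0$, and $\Omega=-\omega_1\wedge\omega_1-\omega_2\wedge\omega_2+\omega_3\wedge\omega_3$. Let $R(A,B)=[\nabla_A,\nabla_B]-\nabla_{[A,B]}$ and $R(A,B,C,D)=g(R(A,B)C,D)$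 for $C,D\in H$, and write $F(e_a,e_a)=\sum_{a=1}^{4n}g(e_a,e_a)F(e_a,e_a)$ for the contraction of a bilinear $F$ over a $g$-orthonormal basis of $H$. Put $$\mathrm{Ric}(B,C)=R(e_a,B,C,e_a),\quad \mathrm{Scal}=\mathrm{Ric}(e_a,e_a),\quad \lambda=\frac{\mathrm{Scal}}{8n(n+2)},\quad \rho_s(B,C)=\frac1{4n}R(B,C,e_a,I_se_a).$$ Here $B,C$ are horizontal in $\mathrm{Ric}$, while the Ricci forms $\rho_s$ are 2-forms on $M$. Let $\rho^0_s$ be the trace-free part of the 2-form $\rho_s$, that is, $$\rho^0_s=\rho_s+\frac{\epsilon_s}{4n}\,\rho_s(e_a,I_se_a)\,\omega_s .$$ (Note $\omega_s(e_a,I_se_a)=-4n\epsilon_s$.) Let $T^0_{\xi_s}$ and $T^a_{\xi_s}$ be the $g$-symmetric and $g$-skew parts of $X\mapsto T(\xi_s,X)_H$, and for $X,Y\in H$ put $$\tau(X,Y)=-\sum_{s=1}^3\epsilon_s\,g(T^0_{\xi_s}I_sX,Y),\qquad \mu(X,Y)=\epsilon_t\,g(T^a_{\xi_t}I_tX,Y),$$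 where any $t\in\{1,2,3\}$ may be used in the second formula. The wedge product of 1-forms is $(a\wedge b)(u,v)=a(u)b(v)-a(v)b(u)$. **Statement.** The following equations hold: $$d\eta_i=-2\epsilon_i\,\omega_i+\eta_j\wedge\alpha_k+\epsilon_j\,\eta_k\wedge\alpha_j+\epsilon_i\lambda\,\eta_j\wedge\eta_k,$$ $$\epsilon_i\,d\omega_i=\omega_j\wedge(-\epsilon_j\alpha_k+\epsilon_k\lambda\eta_k)+\omega_k\wedge(\epsilon_i\alpha_j-\epsilon_j\lambda\eta_j)-\epsilon_j\,\rho_k\wedge\eta_j+\epsilon_k\,\rho_j\wedge\eta_k+\tfrac12\epsilon_i\,d\lambda\wedge\eta_j\wedge\eta_k,$$ $$d\Omega=\sum_{(ijk)}-\epsilon_i\Big[2\,\eta_i\wedge(\rho^0_k\wedge\omega_j-\rho^0_j\wedge\omega_k)+d\lambda\wedge\omega_i\wedge\eta_j\wedge\eta_k\Big],$$ where $\sum_{(ijk)}$ is the sum over the cyclic permutations of $(1,2,3)$; and for all horizontal $X,Y$ and all $s$, $$\rho^0_s(X,Y)=\tfrac12\big[\tau(X,I_sY)-\tau(I_sX,Y)\big]+2\mu(X,I_sY).$$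 -/

import Mathlib

open scoped Manifold ContDiff Topology Bundle

set_option linter.unusedSectionVars false

noncomputable section

/-! ### Differential forms -/

section Forms

variable {W : Type*} [AddCommGroup W] [Module ℝ W] [TopologicalSpace W]

/-- The `(p+q)`-linear form `v ↦ a (v₁,…,v_p) * b (v_{p+1},…,v_{p+q})`. -/
def formTensor {p q : ℕ} (a : W [⋀^Fin p]→L[ℝ] ℝ) (b : W [⋀^Fin q]→L[ℝ] ℝ) :
    ContinuousMultilinearMap ℝ (fun _ : Fin (p + q) => W) ℝ where
  toMultilinearMap := (LinearMap.mul' ℝ ℝ).compMultilinearMap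
    ((MultilinearMap.domCoprod a.toMultilinearMap b.toMultilinearMap).domDomCongr finSumFinEquiv)
  cont := by
    have h : Continuous fun v : Fin (p + q) → W =>
        a (fun i => v (Fin.castAdd q i)) * b (fun i => v (Fin.natAdd p i)) := by
      refine Continuous.mul (a.cont.comp ?_) (b.cont.comp ?_) <;>
      exact continuous_pi fun i => continuous_apply _
    exact h

theorem formTensor_apply {p q : ℕ} (a : W [⋀^Fin p]→L[ℝ] ℝ) (b : W [⋀^Fin q]→L[ℝ] ℝ)
    (v : Fin (p + q) → W) : formTensor a b v =
      a (fun i => v (Fin.castAdd q i)) * b (fun i => v (Fin.natAdd p i)) := rfl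

/-- The wedge product
`(a ⋏ b)(v) = (1 / (p! q!)) ∑ σ, sign σ * a (v_{σ 1},…,v_{σ p}) * b (v_{σ (p+1)},…,v_{σ (p+q)})`;
on 1-forms it is `a(u) b(v) - a(v) b(u)`. -/
def wedge {p q : ℕ} (a : W [⋀^Fin p]→L[ℝ] ℝ) (b : W [⋀^Fin q]→L[ℝ] ℝ) :
    W [⋀^Fin (p + q)]→L[ℝ] ℝ :=
  ((p.factorial * q.factorial : ℝ)⁻¹) • (formTensor a b).alternatization

/-- A linear functional, as a 1-form. -/
def oneForm (a : W →L[ℝ] ℝ) : W [⋀^Fin 1]→L[ℝ] ℝ :=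
  ContinuousAlternatingMap.ofSubsingleton ℝ W ℝ 0 a

/-- A bilinear form vanishing on the diagonal, as a 2-form. -/
def twoForm [T2Space W] [IsTopologicalAddGroup W] [ContinuousSMul ℝ W] [FiniteDimensional ℝ W]
    (B : W →ₗ[ℝ] W →ₗ[ℝ] ℝ) (hB : ∀ v, B v v = 0) : W [⋀^Fin 2]→L[ℝ] ℝ where
  toFun v := B (v 0) (v 1)
  map_update_add' := by
    intro _ v i x y
    have e : ‹DecidableEq (Fin 2)› = instDecidableEqFin 2 := Subsingleton.elim _ _
    subst e
    fin_cases i <;> simp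
  map_update_smul' := by
    intro _ v i c x
    have e : ‹DecidableEq (Fin 2)› = instDecidableEqFin 2 := Subsingleton.elim _ _
    subst e
    fin_cases i <;> simp
  cont := by
    let b := Module.finBasis ℝ W
    have h : (fun v : Fin 2 → W => B (v 0) (v 1)) =
        fun v => ∑ i, b.coord i (v 0) * B (b i) (v 1) := by
      funext v
      conv_lhs => rw [← b.sum_repr (v 0)]
      simp only [map_sum, map_smul, LinearMap.sum_apply, LinearMap.smul_apply, smul_eq_mul,
        Module.Basis.coord_apply]
    change Continuous fun v : Fin 2 → W => B (v 0) (v 1)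
    rw [h]
    refine continuous_finsetSum _ fun i _ => Continuous.mul ?_ ?_
    · exact (LinearMap.continuous_of_finiteDimensional (b.coord i)).comp (continuous_apply 0)
    · exact (LinearMap.continuous_of_finiteDimensional (B (b i))).comp (continuous_apply 1)
  map_eq_zero_of_eq' := by
    intro v i j h hij
    fin_cases i <;> fin_cases j <;> simp_all

end Forms

infixr:67 " ⋏ " => wedge

section Manifold

variable {E : Type*} [NormedAddCommGroup E] [NormedSpace ℝ E]
  {M : Type*} [TopologicalSpace M] [ChartedSpace E M]

/-- The exterior derivative of a differential form on a manifold without boundary: at `x` it is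
computed in the preferred chart around `x`. -/
def formDeriv {p : ℕ} (ψ : Π x : M, TangentSpace 𝓘(ℝ, E) x [⋀^Fin p]→L[ℝ] ℝ) (x : M) :
    TangentSpace 𝓘(ℝ, E) x [⋀^Fin (p + 1)]→L[ℝ] ℝ :=
  ContinuousAlternatingMap.compContinuousLinearMap
    (extDeriv (fun y : E =>
      ((ψ ((extChartAt 𝓘(ℝ, E) x).symm y)).compContinuousLinearMap
        (mfderiv 𝓘(ℝ, E) 𝓘(ℝ, E) (extChartAt 𝓘(ℝ, E) x).symm y) : E [⋀^Fin p]→L[ℝ] ℝ))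
      (extChartAt 𝓘(ℝ, E) x x))
    (mfderiv 𝓘(ℝ, E) 𝓘(ℝ, E) (extChartAt 𝓘(ℝ, E) x) x)

variable [FiniteDimensional ℝ E] [CompleteSpace E] [T2Space M] [IsManifold 𝓘(ℝ, E) ∞ M]

/-- `R(X,Y)Z = ∇_X ∇_Y Z - ∇_Y ∇_X Z - ∇_{[X,Y]} Z` on vector fields, at the point `x`. -/
def curvatureOnFields
    (cov : CovariantDerivative 𝓘(ℝ, E) E (TangentSpace 𝓘(ℝ, E) : M → Type _))
    (Z X Y : Π x : M, TangentSpace 𝓘(ℝ, E) x) (x : M) : TangentSpace 𝓘(ℝ, E) x :=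
  cov (fun y => cov Z y (Y y)) x (X x) - cov (fun y => cov Z y (X y)) x (Y x)
    - cov Z x (VectorField.mlieBracket 𝓘(ℝ, E) X Y x)

variable (E M) in
/-- A smooth (`C^∞`) affine connection. -/
structure SmoothConnection where
  cov : CovariantDerivative 𝓘(ℝ, E) E (TangentSpace 𝓘(ℝ, E) : M → Type _)
  smooth : CovariantDerivative.ContMDiffCovariantDerivative cov ∞

open FiberBundle

theorem SmoothConnection.mdifferentiableAt_extend (D : SmoothConnection E M) {x : M}
    (w : TangentSpace 𝓘(ℝ, E) x) {X : Π x : M, TangentSpace 𝓘(ℝ, E) x} (hX : MDiffAt (T% X) x) :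
    MDiffAt (T% (fun y => D.cov (extend E w) y (X y))) x := by
  obtain ⟨s, hs, hws⟩ := exists_contMDiffOn_extend (k := ∞) 𝓘(ℝ, E) E w
  obtain ⟨u, hus, huo, hxu⟩ := mem_nhds_iff.1 hs
  obtain ⟨f, -, hf⟩ := ((SmoothBumpFunction.nhds_basis_tsupport (I := 𝓘(ℝ, E)) x).mem_iff).1
    (huo.mem_nhds hxu)
  have hW : CMDiff ∞ (T% ((f : M → ℝ) • extend E w)) :=
    ContMDiffOn.smul_section_of_tsupport (u := u) f.contMDiff.contMDiffOn huo hf (hws.mono hus)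
  have hWc := D.smooth.contMDiff.contMDiff (σ := (f : M → ℝ) • extend E w)
    (by simpa using hW.contMDiffOn)
  have h1 : MDiffAt (T% (fun y => D.cov ((f : M → ℝ) • extend E w) y (X y))) x :=
    MDifferentiableAt.clm_bundle_apply (F₁ := E) (F₂ := E) (b := fun y : M => y)
      (((contMDiffOn_univ.1 hWc) x).mdifferentiableAt (by simp)) hX
  refine h1.congr_of_eventuallyEq ?_
  filter_upwards [f.eventuallyEq_one.eventually_nhds, huo.mem_nhds hxu] with y hy hyu
  have h2 : D.cov (extend E w) y = D.cov ((f : M → ℝ) • extend E w) y := by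
    refine D.cov.isCovariantDerivativeOnUniv.congr_of_eventuallyEq (s := Set.univ)
      ((hws.contMDiffAt (Filter.mem_of_superset (huo.mem_nhds hyu) hus)).mdifferentiableAt
        (by simp)) (hW.contMDiffAt.mdifferentiableAt (by simp)) Filter.univ_mem ?_
    filter_upwards [hy] with z hz
    simp [hz]
  simp [h2]

theorem SmoothConnection.curvatureOnFields_tensorial_left (D : SmoothConnection E M) {x : M}
    (w : TangentSpace 𝓘(ℝ, E) x) (Y : Π x : M, TangentSpace 𝓘(ℝ, E) x) (_hY : MDiffAt (T% Y) x) :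
    TensorialAt 𝓘(ℝ, E) E (fun X => curvatureOnFields D.cov (extend E w) X Y x) x where
  smul {f X} hf hX := by
    have h := D.mdifferentiableAt_extend w hX
    have e : (fun y => D.cov (extend E w) y ((f • X) y)) =
        f • (fun y => D.cov (extend E w) y (X y)) := by
      funext y; simp
    simp only [curvatureOnFields, e, D.cov.isCovariantDerivativeOnUniv.leibniz h hf,
      VectorField.mlieBracket_smul_left hf hX]
    simp
    module
  add {X X'} hX hX' := by
    have h := D.mdifferentiableAt_extend w hX
    have h' := D.mdifferentiableAt_extend w hX'
    have e : (fun y => D.cov (extend E w) y ((X + X') y)) =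
        (fun y => D.cov (extend E w) y (X y)) + (fun y => D.cov (extend E w) y (X' y)) := by
      funext y; simp
    simp only [curvatureOnFields, e, D.cov.isCovariantDerivativeOnUniv.add h h',
      VectorField.mlieBracket_add_left hX hX']
    simp
    module

theorem curvatureOnFields_swap
    (cov : CovariantDerivative 𝓘(ℝ, E) E (TangentSpace 𝓘(ℝ, E) : M → Type _))
    (Z X Y : Π x : M, TangentSpace 𝓘(ℝ, E) x) (x : M) :
    curvatureOnFields cov Z X Y x = (-1 : ℝ) • curvatureOnFields cov Z Y X x := by
  simp only [curvatureOnFields]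
  rw [VectorField.mlieBracket_swap]
  simp
  abel

theorem SmoothConnection.curvatureOnFields_tensorial_right (D : SmoothConnection E M) {x : M}
    (w : TangentSpace 𝓘(ℝ, E) x) (X : Π x : M, TangentSpace 𝓘(ℝ, E) x) (hX : MDiffAt (T% X) x) :
    TensorialAt 𝓘(ℝ, E) E (fun Y => curvatureOnFields D.cov (extend E w) X Y x) x where
  smul {f Y} hf hY := by
    simp only [curvatureOnFields_swap D.cov (extend E w) X]
    rw [(D.curvatureOnFields_tensorial_left w X hX).smul hf hY, smul_comm]
  add {Y Y'} hY hY' := by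
    simp only [curvatureOnFields_swap D.cov (extend E w) X]
    rw [(D.curvatureOnFields_tensorial_left w X hX).add hY hY', smul_add]

/-- The curvature of a connection: `D.curvature x w u v = R(u, v) w`. -/
def SmoothConnection.curvature (D : SmoothConnection E M) (x : M) (w : TangentSpace 𝓘(ℝ, E) x) :
    TangentSpace 𝓘(ℝ, E) x →L[ℝ] TangentSpace 𝓘(ℝ, E) x →L[ℝ] TangentSpace 𝓘(ℝ, E) x :=
  TensorialAt.mkHom₂ (fun X Y => curvatureOnFields D.cov (extend E w) X Y x) x
    (fun Y hY => D.curvatureOnFields_tensorial_left w Y hY)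
    (fun X hX => D.curvatureOnFields_tensorial_right w X hX)

theorem SmoothConnection.curvature_self (D : SmoothConnection E M) (x : M)
    (w u : TangentSpace 𝓘(ℝ, E) x) : D.curvature x w u u = 0 := by
  rw [SmoothConnection.curvature, TensorialAt.mkHom₂_apply_eq_extend]
  simp [curvatureOnFields]

end Manifold

/-! ### Contractions -/

/-- The contraction `∑ g^{ab} F(b_a, b_b)` of a bilinear expression `F` with a nondegenerate
symmetric bilinear form `g`. It does not depend on the basis; in a `g`-orthonormal basis
`(e_a)` it is `∑ g(e_a, e_a) F(e_a, e_a)`. -/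
def gContract {W A : Type*} [AddCommGroup W] [Module ℝ W] [FiniteDimensional ℝ W]
    [AddCommGroup A] [Module ℝ A] (g : LinearMap.BilinForm ℝ W) (F : W → W → A) : A :=
  let b := Module.finBasis ℝ W
  let G : Matrix _ _ ℝ := Matrix.of fun i j => g (b i) (b j)
  ∑ i, ∑ j, G⁻¹ i j • F (b i) (b j)

theorem gContract_self {W : Type*} [AddCommGroup W] [Module ℝ W] [FiniteDimensional ℝ W]
    {U : Type*} [AddCommGroup U] [Module ℝ U] (g : LinearMap.BilinForm ℝ W)
    (F : W → W → U →ₗ[ℝ] U →ₗ[ℝ] ℝ) (hF : ∀ X Y u, F X Y u u = 0) (u : U) :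
    gContract g F u u = 0 := by
  simp [gContract, LinearMap.sum_apply, hF]

/-! ### Paraquaternionic contact structures

The indices `1, 2, 3` are `0, 1, 2 : Fin 3`, and `(i, i + 1, i + 2)` runs over the cyclic
permutations. -/

/-- The signs `ε₁ = ε₂ = -ε₃ = 1`. -/
def pqSign : Fin 3 → ℝ := ![1, 1, -1]

/-- The model space of `(4n+3)`-dimensional manifolds. -/
abbrev PqcModel (n : ℕ) : Type := EuclideanSpace ℝ (Fin (4 * n + 3))

instance (n : ℕ) (M : Type*) [TopologicalSpace M] [ChartedSpace (PqcModel n) M] (x : M) :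
    FiniteDimensional ℝ (TangentSpace 𝓘(ℝ, PqcModel n) x) :=
  inferInstanceAs (FiniteDimensional ℝ (PqcModel n))

instance (n : ℕ) (M : Type*) [TopologicalSpace M] [ChartedSpace (PqcModel n) M] (x : M) :
    T2Space (TangentSpace 𝓘(ℝ, PqcModel n) x) :=
  inferInstanceAs (T2Space (PqcModel n))

section Pqc

variable {n : ℕ} {M : Type*} [TopologicalSpace M] [ChartedSpace (PqcModel n) M]

variable [IsManifold 𝓘(ℝ, PqcModel n) ∞ M]

/-- The vector field `X` is of class `C^∞`. -/
def IsSmoothField (X : Π x : M, TangentSpace 𝓘(ℝ, PqcModel n) x) : Prop :=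
  ContMDiff 𝓘(ℝ, PqcModel n) (𝓘(ℝ, PqcModel n).prod 𝓘(ℝ, PqcModel n)) ∞
    (fun x => (⟨x, X x⟩ : TangentBundle 𝓘(ℝ, PqcModel n) M))

/-- The distribution `H = ⋂ ker η_s`. -/
def horizontalSpace (η : Fin 3 → Π x : M, TangentSpace 𝓘(ℝ, PqcModel n) x →L[ℝ] ℝ) (x : M) :
    Submodule ℝ (TangentSpace 𝓘(ℝ, PqcModel n) x) :=
  ⨅ s, LinearMap.ker (η s x).toLinearMap

variable (n M) in
/-- A paraquaternionic contact structure on a `(4n+3)`-manifold `M` with a global contact form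
`η = (η₁, η₂, η₃)`: the codimension three distribution `H = ⋂ ker η_s` carries endomorphisms
`J₁, J₂, J₃` satisfying the identities of the imaginary unit paraquaternions
(`J_s² = ε_s`, `J_i J_j = -J_j J_i = -ε_k J_k`) and a compatible metric `g` with
`-2 ε_s g(J_s X, Y) = dη_s(X, Y)`. The metric has neutral signature `(2n, 2n)`, because `J₁` is an
anti-isometry of the nondegenerate form `g`. -/
structure PqcStructure where
  η : Fin 3 → Π x : M, TangentSpace 𝓘(ℝ, PqcModel n) x →L[ℝ] ℝ
  η_smooth : ∀ s, ContMDiff 𝓘(ℝ, PqcModel n)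
    (𝓘(ℝ, PqcModel n).prod 𝓘(ℝ, PqcModel n →L[ℝ] ℝ)) ∞
    (fun x => Bundle.TotalSpace.mk' (PqcModel n →L[ℝ] ℝ)
      (E := fun x : M => TangentSpace 𝓘(ℝ, PqcModel n) x →L[ℝ] ℝ) x (η s x))
  η_independent : ∀ x, LinearIndependent ℝ (fun s => η s x)
  J : Fin 3 → Π x : M, horizontalSpace η x →ₗ[ℝ] horizontalSpace η x
  g : Π x : M, LinearMap.BilinForm ℝ (horizontalSpace η x)
  J_smooth : ∀ s (X : Π x : M, TangentSpace 𝓘(ℝ, PqcModel n) x)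
    (hX : ∀ x, X x ∈ horizontalSpace η x), IsSmoothField X →
    IsSmoothField (fun x => (J s x ⟨X x, hX x⟩ : TangentSpace 𝓘(ℝ, PqcModel n) x))
  g_smooth : ∀ (X Y : Π x : M, TangentSpace 𝓘(ℝ, PqcModel n) x)
    (hX : ∀ x, X x ∈ horizontalSpace η x) (hY : ∀ x, Y x ∈ horizontalSpace η x),
    IsSmoothField X → IsSmoothField Y →
    ContMDiff 𝓘(ℝ, PqcModel n) 𝓘(ℝ, ℝ) ∞ (fun x => g x ⟨X x, hX x⟩ ⟨Y x, hY x⟩)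
  g_symm : ∀ x X Y, g x X Y = g x Y X
  g_nondegenerate : ∀ x X, (∀ Y, g x X Y = 0) → X = 0
  J_sq : ∀ s x X, J s x (J s x X) = pqSign s • X
  J_mul : ∀ i x X, J i x (J (i + 1) x X) = -(pqSign (i + 2) • J (i + 2) x X)
  J_mul_swap : ∀ i x X, J (i + 1) x (J i x X) = pqSign (i + 2) • J (i + 2) x X
  g_compatible : ∀ s x X Y, g x (J s x X) (J s x Y) = -(pqSign s * g x X Y)
  contact : ∀ s x (X Y : horizontalSpace η x),
    formDeriv (fun y => oneForm (η s y)) x ![X, Y] = -2 * pqSign s * g x (J s x X) Y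

/-- The horizontal space `H_x`. -/
abbrev PqcStructure.H (P : PqcStructure n M) (x : M) :
    Submodule ℝ (TangentSpace 𝓘(ℝ, PqcModel n) x) :=
  horizontalSpace P.η x

/-- The exterior derivative `dη_s`. -/
def PqcStructure.dη (P : PqcStructure n M) (s : Fin 3) (x : M) :
    TangentSpace 𝓘(ℝ, PqcModel n) x [⋀^Fin 2]→L[ℝ] ℝ :=
  formDeriv (fun y => oneForm (P.η s y)) x

/-- The contact form `η_s` as a differential 1-form. -/
def PqcStructure.η₁ (P : PqcStructure n M) (s : Fin 3) (x : M) :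
    TangentSpace 𝓘(ℝ, PqcModel n) x [⋀^Fin 1]→L[ℝ] ℝ :=
  oneForm (P.η s x)

/-- A horizontal vector field of class `C^∞`. -/
structure PqcStructure.IsHorizontalField (P : PqcStructure n M)
    (X : Π x : M, TangentSpace 𝓘(ℝ, PqcModel n) x) : Prop where
  smooth : IsSmoothField X
  horizontal : ∀ x, X x ∈ P.H x

/-- A smooth distribution `V` complementary to `H`, given by its frame dual to `η`. -/
structure PqcStructure.Complement (P : PqcStructure n M) where
  ξ : Fin 3 → Π x : M, TangentSpace 𝓘(ℝ, PqcModel n) x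
  ξ_smooth : ∀ s, IsSmoothField (ξ s)
  dual : ∀ s t x, P.η s x (ξ t x) = if s = t then 1 else 0

namespace PqcStructure.Complement

variable {P : PqcStructure n M} (V : P.Complement)

/-- The projection of `TM = H ⊕ V` to `H`. -/
def proj (x : M) : TangentSpace 𝓘(ℝ, PqcModel n) x →L[ℝ] P.H x :=
  (ContinuousLinearMap.id ℝ _ - ∑ s, (P.η s x).smulRight (V.ξ s x)).codRestrict (P.H x) (by
    intro v
    simp [PqcStructure.H, horizontalSpace, V.dual])

/-- The horizontal metric `g`, extended by zero on `V`. -/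
def gH (x : M) (u v : TangentSpace 𝓘(ℝ, PqcModel n) x) : ℝ :=
  P.g x (V.proj x u) (V.proj x v)

/-- The endomorphism `J_s` of `H`, extended by zero on `V`. -/
def JH (s : Fin 3) (x : M) (v : TangentSpace 𝓘(ℝ, PqcModel n) x) :
    TangentSpace 𝓘(ℝ, PqcModel n) x :=
  P.J s x (V.proj x v)

/-- The fundamental 2-form `ω_s`: it vanishes on `V`, and `-2 ε_s ω_s = dη_s` on `H`, that is,
`ω_s(X, Y) = g(J_s X, Y)`. -/
def ω_ (s : Fin 3) (x : M) : TangentSpace 𝓘(ℝ, PqcModel n) x [⋀^Fin 2]→L[ℝ] ℝ :=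
  (-(pqSign s / 2)) • (P.dη s x).compContinuousLinearMap ((P.H x).subtypeL ∘L V.proj x)

/-- The fundamental 4-form `Ω = -ω₁ ∧ ω₁ - ω₂ ∧ ω₂ + ω₃ ∧ ω₃`. -/
def Ω (x : M) : TangentSpace 𝓘(ℝ, PqcModel n) x [⋀^Fin 4]→L[ℝ] ℝ :=
  -(V.ω_ 0 x ⋏ V.ω_ 0 x) - (V.ω_ 1 x ⋏ V.ω_ 1 x) + (V.ω_ 2 x ⋏ V.ω_ 2 x)

/-- The inner product `⟨A, B⟩ = g(e_a, e_a) g(A e_a, B e_a)` of endomorphisms of `H`. -/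
def endInner (P : PqcStructure n M) (x : M) (A B : P.H x → P.H x) : ℝ :=
  gContract (P.g x) (fun X Y => P.g x (A X) (B Y))

variable [T2Space M] (D : SmoothConnection (PqcModel n) M)

/-- The horizontal endomorphism `T(ξ_s, ·)` of `H`, with `T` the torsion of the connection. -/
def torsionEnd (s : Fin 3) (x : M) (X : P.H x) : P.H x :=
  V.proj x (D.cov.torsion x (V.ξ s x) X)

/-- The connection `∇` together with the complement `V` of `H` form the canonical pqc connection
of the structure `(η, J, g)`. -/
structure IsCanonical : Prop where
  /-- In dimension seven `V` is spanned by vector fields satisfying the Reeb conditions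
  `(ξ_s ⌟ dη_s)|_H = 0` and `(ξ_j ⌟ dη_i)|_H = ε_k (ξ_i ⌟ dη_j)|_H`. -/
  reeb_dim_seven : n = 1 → ∀ x, ∀ X ∈ P.H x,
    (∀ s, P.dη s x ![V.ξ s x, X] = 0) ∧
    ∀ i, P.dη i x ![V.ξ (i + 1) x, X] = pqSign (i + 2) * P.dη (i + 1) x ![V.ξ i x, X]
  /-- `∇` preserves `H`. -/
  preserves_H : ∀ Y, P.IsHorizontalField Y → ∀ x v, D.cov Y x v ∈ P.H x
  /-- `∇` preserves `V`. -/
  preserves_V : ∀ s x v, D.cov (V.ξ s) x v ∈ Submodule.span ℝ (Set.range fun t => V.ξ t x)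
  /-- `∇g = 0`. -/
  metric : ∀ Y Z, P.IsHorizontalField Y → P.IsHorizontalField Z → ∀ x v,
    mvfderiv 𝓘(ℝ, PqcModel n) (fun y => V.gH y (Y y) (Z y)) x v =
      V.gH x (D.cov Y x v) (Z x) + V.gH x (Y x) (D.cov Z x v)
  /-- `∇` preserves the bundle spanned by `J₁, J₂, J₃`, and the identification `φ : ξ_s ↦ J_s`
  of `V` with this bundle is parallel: if `∇_v ξ_s = ∑ c_t ξ_t` then `∇_v J_s = ∑ c_t J_t`. -/
  parallel : ∀ s Y, P.IsHorizontalField Y → ∀ x v,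
    D.cov (fun y => V.JH s y (Y y)) x v - V.JH s x (D.cov Y x v) =
      ∑ t, P.η t x (D.cov (V.ξ s) x v) • V.JH t x (Y x)
  /-- `T(X, Y) = -[X, Y]_V` for horizontal `X, Y`. -/
  torsion_horizontal : ∀ X Y, P.IsHorizontalField X → P.IsHorizontalField Y → ∀ x,
    D.cov.torsion x (X x) (Y x) =
      -∑ s, P.η s x (VectorField.mlieBracket 𝓘(ℝ, PqcModel n) X Y x) • V.ξ s x
  /-- For `ξ ∈ V` the endomorphism `T(ξ, ·)` of `H` is orthogonal to `sp(n, ℝ)`, the skew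
  endomorphisms commuting with all `J_t`. -/
  torsion_perp_sp : ∀ s x (B : P.H x →ₗ[ℝ] P.H x),
    (∀ X Y, P.g x (B X) Y = -P.g x X (B Y)) → (∀ t X, B (P.J t x X) = P.J t x (B X)) →
    endInner P x (V.torsionEnd D s x) B = 0
  /-- For `ξ ∈ V` the endomorphism `T(ξ, ·)` of `H` is orthogonal to
  `sp(1, ℝ) = span {J₁, J₂, J₃}`. -/
  torsion_perp_sp1 : ∀ s t x, endInner P x (V.torsionEnd D s x) (P.J t x) = 0

/-- The `sp(1, ℝ)`-connection 1-forms `α_s`, given by `∇ξ_i = α_j ξ_k + ε_k α_k ξ_j`, so that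
`α_j = η_k(∇ξ_i)`. -/
def α (s : Fin 3) (x : M) : TangentSpace 𝓘(ℝ, PqcModel n) x [⋀^Fin 1]→L[ℝ] ℝ :=
  oneForm ((P.η (s + 1) x).comp (D.cov (V.ξ (s + 2)) x))

/-- The pqc-Ricci tensor `Ric(B, C) = R(e_a, B, C, e_a)`, where `R(A, B, C, D) = g(R(A, B) C, D)`. -/
def ric (x : M) (B C : TangentSpace 𝓘(ℝ, PqcModel n) x) : ℝ :=
  gContract (P.g x) (fun X Y : P.H x => V.gH x (D.curvature x C X B) Y)

/-- The pqc-scalar curvature `Scal = Ric(e_a, e_a)`. -/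
def scal (x : M) : ℝ :=
  gContract (P.g x) (fun X Y : P.H x => V.ric D x X Y)

/-- The normalized pqc-scalar curvature `λ = Scal / (8n(n+2))`. -/
def lam (x : M) : ℝ := V.scal D x / (8 * n * (n + 2))

/-- The 1-form `dλ`. -/
def dlam (x : M) : TangentSpace 𝓘(ℝ, PqcModel n) x [⋀^Fin 1]→L[ℝ] ℝ :=
  oneForm (mvfderiv 𝓘(ℝ, PqcModel n) (V.lam D) x)

/-- The bilinear form `(B, C) ↦ R(B, C, X, J_s Y)`. -/
def curvatureForm (s : Fin 3) (x : M) (X Y : P.H x) :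
    TangentSpace 𝓘(ℝ, PqcModel n) x →ₗ[ℝ] TangentSpace 𝓘(ℝ, PqcModel n) x →ₗ[ℝ] ℝ :=
  (D.curvature x X).toLinearMap₁₂.compr₂
    (((P.g x).flip (P.J s x Y)).comp (V.proj x).toLinearMap)

theorem curvatureForm_apply (s : Fin 3) (x : M) (X Y : P.H x)
    (B C : TangentSpace 𝓘(ℝ, PqcModel n) x) :
    V.curvatureForm D s x X Y B C =
      P.g x (V.proj x (D.curvature x X B C)) (P.J s x Y) := rfl

theorem curvatureForm_self (s : Fin 3) (x : M) (X Y : P.H x)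
    (B : TangentSpace 𝓘(ℝ, PqcModel n) x) : V.curvatureForm D s x X Y B B = 0 := by
  simp [curvatureForm, SmoothConnection.curvature_self]

/-- The Ricci 2-forms `ρ_s(B, C) = (1/4n) R(B, C, e_a, J_s e_a)`. -/
def ρ (s : Fin 3) (x : M) : TangentSpace 𝓘(ℝ, PqcModel n) x [⋀^Fin 2]→L[ℝ] ℝ :=
  (1 / (4 * n) : ℝ) • twoForm (gContract (P.g x) (V.curvatureForm D s x))
    (gContract_self (P.g x) _ (V.curvatureForm_self D s x))

/-- The trace-free part `ρ⁰_s` of the Ricci 2-form `ρ_s`, a 2-form on `M`: the multiple of `ω_s`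
having the same trace `ρ_s(e_a, J_s e_a)` is subtracted (note `ω_s(e_a, J_s e_a) = -4n ε_s`). -/
def ρ₀ (s : Fin 3) (x : M) : TangentSpace 𝓘(ℝ, PqcModel n) x [⋀^Fin 2]→L[ℝ] ℝ :=
  V.ρ D s x - (-(pqSign s / (4 * n)) *
    gContract (P.g x) (fun X Y : P.H x => V.ρ D s x ![X, P.J s x Y])) • V.ω_ s x

/-- `T(ξ_s, X, Y) = g(T(ξ_s, X), Y)`. -/
def torsionForm (s : Fin 3) (x : M) (X Y : P.H x) : ℝ := P.g x (V.torsionEnd D s x X) Y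

/-- `τ(X, Y) = -∑ ε_s T⁰(ξ_s, J_s X, Y)`, with `T⁰` the symmetric part of the torsion
endomorphism. -/
def τ (x : M) (X Y : P.H x) : ℝ :=
  -∑ s, pqSign s *
    ((V.torsionForm D s x (P.J s x X) Y + V.torsionForm D s x Y (P.J s x X)) / 2)

/-- `μ_s(X, Y) = ε_s Tᵃ(ξ_s, J_s X, Y)`, with `Tᵃ` the skew-symmetric part of the torsion
endomorphism. -/
def μ (s : Fin 3) (x : M) (X Y : P.H x) : ℝ :=
  pqSign s *
    ((V.torsionForm D s x (P.J s x X) Y - V.torsionForm D s x Y (P.J s x X)) / 2)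

end PqcStructure.Complement

end Pqc
end

noncomputable section

/-! ### Coordinate vector fields -/

section Coordinates

open VectorField Set

variable {E : Type*} [NormedAddCommGroup E] [NormedSpace ℝ E] [FiniteDimensional ℝ E]
  {M : Type*} [TopologicalSpace M] [ChartedSpace E M] [T2Space M] [IsManifold 𝓘(ℝ, E) ∞ M]

/-! Everything is read off from the torsion `T` of the canonical connection and its first Bianchi
identity. Write `∇ξ_s = ∑ c_st ξ_t`. Since `ξ_s ↦ J_s` is parallel, differentiating `J_s J_t + J_t
J_s = 2 ε_s δ_st` makes the matrix `c` skew relative to `diag(ε)`, so the `α_s` are its only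
entries. Then `dη_t(u, v) = η_t(T(u, v)) + ∑ (η_s(u) c_st(v) - η_s(v) c_st(u))`, and the equation
for `dη_i` amounts to computing the vertical part of `T`.

On `H × H` the contact condition gives `T = -2 ∑ ε_t ω_t ⊗ ξ_t`, which is parallel because `c` is
skew. Hence the Bianchi identity for three horizontal vectors has only terms quadratic in `T`
(`bianchi_hor`). Its vertical component forces `T(ξ, X)` to be horizontal: traces suffice when `n >
1`, and the Reeb conditions are needed when `n = 1` (`mixed_torsion_eq_zero`). The vertical
component for `X, Y, ξ_s` expresses `η_t(R(X, Y) ξ_s)` through `T(ξ_s, ·)` and `T(ξ_a, ξ_b)`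
(`vertCurv_hor`). These curvature components are the Ricci forms, because `[R(u, v), J_s] = ∑
η_t(R(u, v) ξ_s) J_t` (`vertCurv_eq`). Tracing against the `J_v`, and using that `T(ξ_s, ·)` is
orthogonal to `sp(1, ℝ)`, reduces the vertical torsion to one function `σ`, gives the traces of the
`ρ_s` and expresses `ρ_i + σ ω_i` by torsion (`ricci_forms`). A double trace of the horizontal
Bianchi identity yields `Scal = 8n(n+2) σ`, so `σ = λ` (`scalar_curvature`).

The equation for `dω_i` is then `d(dη_i) = 0`, combined with the curvature equation `dα_j = 2 ε_i
ρ_j + ε_j α_i ∧ α_k` of the bundle `V`. Wedging with `ω_i` and summing cyclically gives `dΩ = -2 ∑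
ε_s dω_s ∧ ω_s`: the `α`-terms cancel, and the `λ`-terms turn `ρ_s` into `ρ⁰_s = ρ_s + λ ω_s`.
Finally, the commutation of the symmetric and skew parts of `T(ξ_s, ·)` with the `J_t`, where the
skew part uses orthogonality to `sp(n, ℝ)`, converts the torsion expression for `ρ⁰_s` on `H` into
`τ` and `μ` (`ricci_forms_torsion`).

Exterior derivatives are evaluated on coordinate vector fields, whose brackets vanish near the
point. -/

instance : IsManifold 𝓘(ℝ, E) ((((⊤ : ℕ∞)) : ℕ∞ω) + 1) M := inferInstanceAs (IsManifold 𝓘(ℝ, E) ∞ M)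

/-- A constant vector field on a vector space. -/
def constField (v : E) : Π y : E, TangentSpace 𝓘(ℝ, E) y := fun _ => v

/-- The vector field with constant coordinates `v` in the preferred chart around `x`, defined on
the domain of this chart. -/
def chartField (x : M) (v : E) : Π y : M, TangentSpace 𝓘(ℝ, E) y :=
  mpullback 𝓘(ℝ, E) 𝓘(ℝ, E) (extChartAt 𝓘(ℝ, E) x) (constField v)

theorem minSmoothness_two_le : minSmoothness ℝ 2 ≤ ∞ := by
  rw [minSmoothness_of_isRCLikeNormedField]
  exact ENat.LEInfty.out

instance : IsManifold 𝓘(ℝ, E) (minSmoothness ℝ 2) M :=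
  IsManifold.of_le (n := ∞) minSmoothness_two_le

instance (x : M) : Inhabited (SmoothBumpFunction 𝓘(ℝ, E) x) :=
  Classical.inhabited_of_nonempty inferInstance

/-- A smooth vector field on `M` which has constant coordinates `v` near `x`. -/
def coordField (x : M) (v : E) : Π y : M, TangentSpace 𝓘(ℝ, E) y :=
  ((default : SmoothBumpFunction 𝓘(ℝ, E) x) : M → ℝ) • chartField x v

theorem chartField_eq {x y : M} (v : E) (hy : y ∈ (extChartAt 𝓘(ℝ, E) x).source) :
    chartField x v y =
      mfderiv 𝓘(ℝ, E) 𝓘(ℝ, E) (extChartAt 𝓘(ℝ, E) x).symm (extChartAt 𝓘(ℝ, E) x y) v := by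
  have h1 := mfderiv_extChartAt_comp_mfderivWithin_extChartAt_symm' (I := 𝓘(ℝ, E)) hy
  have h2 := mfderivWithin_extChartAt_symm_comp_mfderiv_extChartAt' (I := 𝓘(ℝ, E)) hy
  simp only [modelWithCornersSelf_coe, range_id, mfderivWithin_univ] at h1 h2
  rw [chartField, mpullback_apply]
  exact congrArg (fun f => f v) (ContinuousLinearMap.inverse_eq h1 h2)

theorem contMDiff_constField (v : E) : CMDiff ∞ (T% (constField v)) := by
  intro y
  rw [contMDiffAt_vectorSpace_iff_contDiffAt]
  exact contDiffAt_const

theorem chartField_contMDiffAt {x y : M} (v : E) (hy : y ∈ (chartAt E x).source) :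
    CMDiffAt ∞ (T% (chartField x v)) y := by
  refine ContMDiffAt.mpullback_vectorField_preimage (n := ∞) (contMDiff_constField v _)
    (contMDiffAt_extChartAt' hy) ?_ le_rfl
  exact isInvertible_mfderiv_extChartAt (by rwa [extChartAt_source])

theorem coordField_contMDiff (x : M) (v : E) : CMDiff ∞ (T% (coordField x v)) := by
  refine ContMDiffOn.smul_section_of_tsupport (u := (chartAt E x).source)
    (SmoothBumpFunction.contMDiff _).contMDiffOn
    (chartAt E x).open_source (SmoothBumpFunction.tsupport_subset_chartAt_source _) ?_
  exact fun y hy => (chartField_contMDiffAt v hy).contMDiffWithinAt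

theorem coordField_eventuallyEq (x : M) (v : E) : coordField x v =ᶠ[𝓝 x] chartField x v := by
  filter_upwards [(default : SmoothBumpFunction 𝓘(ℝ, E) x).eventuallyEq_one] with y hy
  simp only [coordField, Pi.smul_apply', hy, Pi.one_apply, one_smul]
  rfl

theorem chartField_bracket {x y : M} (v w : E) (hy : y ∈ (chartAt E x).source) :
    mlieBracket 𝓘(ℝ, E) (chartField x v) (chartField x w) y = 0 := by
  rw [chartField, chartField, ← mpullback_mlieBracket (n := ∞)
    (((contMDiff_constField v).contMDiffAt).mdifferentiableAt (by simp))
    (((contMDiff_constField w).contMDiffAt).mdifferentiableAt (by simp))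
    (contMDiffAt_extChartAt' hy) minSmoothness_two_le]
  have : mlieBracket 𝓘(ℝ, E) (constField v) (constField w) = 0 := by
    rw [← mlieBracketWithin_univ, mlieBracketWithin_eq_lieBracketWithin]
    funext z
    exact (by simp [lieBracketWithin] : lieBracketWithin ℝ (fun _ : E => v) (fun _ => w) univ z = 0)
  rw [this, mpullback_zero]; rfl

theorem coordField_bracket (x : M) (v w : E) :
    ∀ᶠ y in 𝓝 x, mlieBracket 𝓘(ℝ, E) (coordField x v) (coordField x w) y = 0 := by
  filter_upwards [(coordField_eventuallyEq x v).mlieBracket_vectorField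
    (coordField_eventuallyEq x w), (chartAt E x).open_source.mem_nhds (mem_chart_source E x)]
    with y hy hy'
  rw [hy, chartField_bracket v w hy']

/-- The coordinates of a tangent vector at `x` in the preferred chart around `x`. -/
def chartVec (x : M) (u : TangentSpace 𝓘(ℝ, E) x) : E :=
  mfderiv 𝓘(ℝ, E) 𝓘(ℝ, E) (extChartAt 𝓘(ℝ, E) x) x u

theorem coordField_self (x : M) (u : TangentSpace 𝓘(ℝ, E) x) :
    coordField x (chartVec x u) x = u := by
  rw [(coordField_eventuallyEq x _).eq_of_nhds, chartField_eq _ (mem_extChartAt_source x)]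
  have h2 := mfderivWithin_extChartAt_symm_comp_mfderiv_extChartAt' (I := 𝓘(ℝ, E))
    (mem_extChartAt_source (I := 𝓘(ℝ, E)) x)
  simp only [modelWithCornersSelf_coe, range_id, mfderivWithin_univ] at h2
  exact congrArg (fun f => f u) h2

theorem mvfderiv_chartField {x y : M} (v : E) (hy : y ∈ (chartAt E x).source) {h : M → ℝ}
    (hh : MDiffAt h y) :
    mvfderiv 𝓘(ℝ, E) h y (chartField x v y) =
      fderiv ℝ (h ∘ (extChartAt 𝓘(ℝ, E) x).symm) (extChartAt 𝓘(ℝ, E) x y) v := by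
  have hy' : y ∈ (extChartAt 𝓘(ℝ, E) x).source := by rwa [extChartAt_source]
  have hz := (extChartAt 𝓘(ℝ, E) x).map_source hy'
  have hs := mdifferentiableWithinAt_extChartAt_symm (I := 𝓘(ℝ, E)) hz
  simp only [modelWithCornersSelf_coe, range_id, mdifferentiableWithinAt_univ] at hs
  have e := mvfderiv_comp_apply_of_eq _ hh hs ((extChartAt 𝓘(ℝ, E) x).left_inv hy') v
  rw [chartField_eq v hy']
  have e' : mvfderiv 𝓘(ℝ, E) (h ∘ (extChartAt 𝓘(ℝ, E) x).symm) (extChartAt 𝓘(ℝ, E) x y) v =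
      fderiv ℝ (h ∘ (extChartAt 𝓘(ℝ, E) x).symm) (extChartAt 𝓘(ℝ, E) x y) v := by
    simp only [mvfderiv, mfderiv_eq_fderiv]; rfl
  rw [← e', e]

theorem mvfderiv_coordField (x : M) (v : E) {h : M → ℝ} (hh : MDiffAt h x) :
    mvfderiv 𝓘(ℝ, E) h x (coordField x v x) =
      fderiv ℝ (h ∘ (extChartAt 𝓘(ℝ, E) x).symm) (extChartAt 𝓘(ℝ, E) x x) v := by
  rw [(coordField_eventuallyEq x v).eq_of_nhds,
    mvfderiv_chartField v (mem_chart_source E x) hh]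

theorem contDiffAt_comp_extChartAt_symm (x : M) {h : M → ℝ} (hh : CMDiff ∞ h) :
    ContDiffAt ℝ ∞ (h ∘ (extChartAt 𝓘(ℝ, E) x).symm) (extChartAt 𝓘(ℝ, E) x x) := by
  rw [← contMDiffAt_iff_contDiffAt]
  exact (hh _).comp _ ((contMDiffOn_extChartAt_symm (I := 𝓘(ℝ, E)) x).contMDiffAt
    (extChartAt_target_mem_nhds x))

theorem mvfderiv_contMDiff {h : M → ℝ} (hh : CMDiff ∞ h) {X : Π x : M, TangentSpace 𝓘(ℝ, E) x}
    (hX : CMDiff ∞ (T% X)) : CMDiff ∞ (fun y => mvfderiv 𝓘(ℝ, E) h y (X y)) :=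
  (contMDiff_snd_tangentBundle_modelSpace ℝ 𝓘(ℝ, ℝ)).comp
    ((hh.contMDiff_tangentMap (m := ∞) le_rfl).comp hX)

/-- Derivatives along coordinate fields commute. -/
theorem mvfderiv_mvfderiv_coordField (x : M) (v w : E) {h : M → ℝ} (hh : CMDiff ∞ h) :
    mvfderiv 𝓘(ℝ, E) (fun y => mvfderiv 𝓘(ℝ, E) h y (coordField x v y)) x (coordField x w x) =
      mvfderiv 𝓘(ℝ, E) (fun y => mvfderiv 𝓘(ℝ, E) h y (coordField x w y)) x
        (coordField x v x) := by
  have hs (u : E) : MDiffAt (fun y => mvfderiv 𝓘(ℝ, E) h y (coordField x u y)) x :=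
    (mvfderiv_contMDiff hh (coordField_contMDiff x u) x).mdifferentiableAt (by simp)
  have hd := contDiffAt_comp_extChartAt_symm x hh
  -- Near the base point the first derivative is the Fréchet derivative of the chart expression; the
  -- statement becomes the symmetry of its second derivative.
  have key : ∀ v : E, (fun y => mvfderiv 𝓘(ℝ, E) h y (coordField x v y)) ∘
      (extChartAt 𝓘(ℝ, E) x).symm =ᶠ[𝓝 (extChartAt 𝓘(ℝ, E) x x)]
      fun z => fderiv ℝ (h ∘ (extChartAt 𝓘(ℝ, E) x).symm) z v := by
    intro v
    have h0 := (continuousAt_extChartAt_symm (I := 𝓘(ℝ, E)) x)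
    have h1 : ∀ᶠ y in 𝓝 ((extChartAt 𝓘(ℝ, E) x).symm (extChartAt 𝓘(ℝ, E) x x)),
        coordField x v y = chartField x v y := by
      rw [extChartAt_to_inv]; exact coordField_eventuallyEq x v
    filter_upwards [h0.eventually h1, extChartAt_target_mem_nhds (I := 𝓘(ℝ, E)) x] with z hz hz'
    have hz2 := (extChartAt 𝓘(ℝ, E) x).map_target hz'
    rw [extChartAt_source] at hz2
    rw [Function.comp_apply, hz, mvfderiv_chartField v hz2 ((hh _).mdifferentiableAt (by simp)),
      (extChartAt 𝓘(ℝ, E) x).right_inv hz']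
  have hdd : DifferentiableAt ℝ (fderiv ℝ (h ∘ (extChartAt 𝓘(ℝ, E) x).symm))
      (extChartAt 𝓘(ℝ, E) x x) :=
    (hd.fderiv_right (m := 1) (by rw [one_add_one_eq_two]; exact ENat.LEInfty.out)).differentiableAt (by simp)
  rw [mvfderiv_coordField x w (hs v), mvfderiv_coordField x v (hs w), (key v).fderiv_eq,
    (key w).fderiv_eq]
  have e : ∀ u : E, fderiv ℝ (fun z => fderiv ℝ (h ∘ (extChartAt 𝓘(ℝ, E) x).symm) z u)
      (extChartAt 𝓘(ℝ, E) x x) = (fderiv ℝ (fderiv ℝ (h ∘ (extChartAt 𝓘(ℝ, E) x).symm))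
      (extChartAt 𝓘(ℝ, E) x x)).flip u := by
    intro u
    rw [fderiv_clm_apply hdd (differentiableAt_const u)]
    simp
  rw [e, e]
  exact (hd.isSymmSndFDerivAt minSmoothness_two_le).eq w v

end Coordinates

/-! ### The exterior derivative in terms of vector fields -/

section FormDeriv

open VectorField Set

variable {E : Type*} [NormedAddCommGroup E] [NormedSpace ℝ E] [FiniteDimensional ℝ E]
  {M : Type*} [TopologicalSpace M] [ChartedSpace E M] [T2Space M] [IsManifold 𝓘(ℝ, E) ∞ M]

/-- A form on a finite-dimensional space is recovered linearly from its finitely many values on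
basis vectors, so differentiability of these values suffices. -/
theorem differentiableAt_of_forall_apply {p : ℕ} {G : E → E [⋀^Fin p]→L[ℝ] ℝ} {z : E}
    (h : ∀ w : Fin p → E, DifferentiableAt ℝ (fun y => G y w) z) : DifferentiableAt ℝ G z := by
  let b := Module.finBasis ℝ E
  let ev : (E [⋀^Fin p]→L[ℝ] ℝ) →ₗ[ℝ] ((Fin p → Fin (Module.finrank ℝ E)) → ℝ) :=
    { toFun := fun ψ i => ψ (fun a => b (i a))
      map_add' := fun _ _ => rfl
      map_smul' := fun _ _ => rfl }
  have hev : LinearMap.ker ev = ⊥ := by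
    rw [LinearMap.ker_eq_bot']
    intro ψ hψ
    apply ContinuousAlternatingMap.toAlternatingMap_injective
    refine b.ext_alternating fun i _ => ?_
    exact congrFun hψ i
  obtain ⟨r, hr⟩ := LinearMap.exists_leftInverse_of_injective ev hev
  have e : G = fun y => LinearMap.toContinuousLinearMap r (ev (G y)) := by
    funext y
    exact (LinearMap.congr_fun hr (G y)).symm
  rw [e]
  exact (LinearMap.toContinuousLinearMap r).differentiableAt.comp z
    (differentiableAt_pi.2 fun i => h _)

/-- The evaluations of the form `ψ` on smooth vector fields are smooth. -/
def IsSmoothForm {p : ℕ} (ψ : Π x : M, TangentSpace 𝓘(ℝ, E) x [⋀^Fin p]→L[ℝ] ℝ) : Prop :=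
  ∀ A : Fin p → Π x : M, TangentSpace 𝓘(ℝ, E) x, (∀ a, CMDiff ∞ (T% (A a))) →
    CMDiff ∞ (fun y => ψ y (fun a => A a y))

/-- In the chart the coordinate fields are constant, so the bracket terms of the invariant formula
for `d` do not occur. -/
theorem formDeriv_apply {p : ℕ} {ψ : Π x : M, TangentSpace 𝓘(ℝ, E) x [⋀^Fin p]→L[ℝ] ℝ}
    (hψ : IsSmoothForm ψ) (x : M) (u : Fin (p + 1) → TangentSpace 𝓘(ℝ, E) x) :
    formDeriv ψ x u = ∑ i : Fin (p + 1), (-1) ^ (i : ℕ) *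
      mvfderiv 𝓘(ℝ, E) (fun y => ψ y (i.removeNth fun a => coordField x (chartVec x (u a)) y)) x
        (u i) := by
  set φ := extChartAt 𝓘(ℝ, E) x with hφ
  let Ψ : E → E [⋀^Fin p]→L[ℝ] ℝ := fun y =>
    ((ψ (φ.symm y)).compContinuousLinearMap (mfderiv 𝓘(ℝ, E) 𝓘(ℝ, E) φ.symm y))
  have key (w : Fin p → E) : (fun z => Ψ z w) =ᶠ[𝓝 (φ x)]
      (fun y => ψ y (fun a => coordField x (w a) y)) ∘ φ.symm := by
    have h0 := (continuousAt_extChartAt_symm (I := 𝓘(ℝ, E)) x)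
    have h1 : ∀ a : Fin p, ∀ᶠ y in 𝓝 (φ.symm (φ x)), coordField x (w a) y = chartField x (w a) y := by
      intro a
      rw [extChartAt_to_inv]; exact coordField_eventuallyEq x (w a)
    filter_upwards [h0.eventually (Filter.eventually_all.2 h1),
      extChartAt_target_mem_nhds (I := 𝓘(ℝ, E)) x] with z hz hz'
    have hz2 := (extChartAt 𝓘(ℝ, E) x).map_target hz'
    have e : (fun a => coordField x (w a) (φ.symm z)) =
        fun a => mfderiv 𝓘(ℝ, E) 𝓘(ℝ, E) φ.symm z (w a) := by
      funext a
      rw [hz a, chartField_eq (w a) hz2, (extChartAt 𝓘(ℝ, E) x).right_inv hz']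
    rw [Function.comp_apply, e]
    rfl
  have hsm (w : Fin p → E) : CMDiff ∞ (fun y => ψ y (fun a => coordField x (w a) y)) :=
    hψ _ fun a => coordField_contMDiff x (w a)
  have hd : DifferentiableAt ℝ Ψ (φ x) := by
    refine differentiableAt_of_forall_apply fun w => ?_
    exact ((contDiffAt_comp_extChartAt_symm x (hsm w)).differentiableAt
      (by simp)).congr_of_eventuallyEq (key w)
  have e1 : formDeriv ψ x u = extDeriv Ψ (φ x) (fun a => chartVec x (u a)) := rfl
  rw [e1, extDeriv_apply hd]
  refine Finset.sum_congr rfl fun i _ => ?_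
  rw [zsmul_eq_mul]
  push_cast
  congr 1
  have e2 := mvfderiv_coordField x (chartVec x (u i))
    ((hsm (i.removeNth fun a => chartVec x (u a)) x).mdifferentiableAt (by simp))
  rw [coordField_self] at e2
  have e3 := (key (i.removeNth fun a => chartVec x (u a))).fderiv_eq (𝕜 := ℝ)
  exact (congrArg (fun f => f (chartVec x (u i))) e3).trans e2.symm

theorem oneForm_apply {W : Type*} [AddCommGroup W] [Module ℝ W] [TopologicalSpace W]
    (a : W →L[ℝ] ℝ) (v : Fin 1 → W) : oneForm a v = a (v 0) := rfl

variable {X Y : Π x : M, TangentSpace 𝓘(ℝ, E) x}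

/-- The operation `Xf` for a vector field `X` and a function `f`. -/
def lieD (X : Π x : M, TangentSpace 𝓘(ℝ, E) x) (f : M → ℝ) (x : M) : ℝ :=
  mvfderiv 𝓘(ℝ, E) f x (X x)

/-- An operation on smooth vector fields which is linear over smooth functions at the point `x`. -/
structure SmoothTensorialAt {A : Type*} [AddCommGroup A] [Module ℝ A]
    (Φ : (Π x : M, TangentSpace 𝓘(ℝ, E) x) → A) (x : M) : Prop where
  add : ∀ {X Y : Π x : M, TangentSpace 𝓘(ℝ, E) x}, CMDiff ∞ (T% X) → CMDiff ∞ (T% Y) →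
    Φ (X + Y) = Φ X + Φ Y
  smul : ∀ {f : M → ℝ} {X : Π x : M, TangentSpace 𝓘(ℝ, E) x}, CMDiff ∞ f → CMDiff ∞ (T% X) →
    Φ (f • X) = f x • Φ X

/-- The coordinate functions around `x`, cut off to be defined globally. -/
def coordFun (x : M) (i : Fin (Module.finrank ℝ E)) : M → ℝ := fun y =>
  (default : SmoothBumpFunction 𝓘(ℝ, E) x) y •
    (Module.finBasis ℝ E).coord i (extChartAt 𝓘(ℝ, E) x y)

theorem coordFun_contMDiff (x : M) (i : Fin (Module.finrank ℝ E)) : CMDiff ∞ (coordFun x i) := by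
  refine SmoothBumpFunction.contMDiff_smul _ ?_
  exact ((LinearMap.toContinuousLinearMap
    ((Module.finBasis ℝ E).coord i)).contDiff.contMDiff).comp_contMDiffOn contMDiffOn_extChartAt

theorem mvfderiv_coordFun (x : M) (i : Fin (Module.finrank ℝ E)) :
    ∀ᶠ y in 𝓝 x, ∀ u : TangentSpace 𝓘(ℝ, E) y, mvfderiv 𝓘(ℝ, E) (coordFun x i) y u =
      (Module.finBasis ℝ E).coord i (mfderiv 𝓘(ℝ, E) 𝓘(ℝ, E) (extChartAt 𝓘(ℝ, E) x) y u) := by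
  filter_upwards [(default : SmoothBumpFunction 𝓘(ℝ, E) x).eventuallyEq_one.eventually_nhds,
    (chartAt E x).open_source.mem_nhds (mem_chart_source E x)] with y hy hy' u
  have e : coordFun x i =ᶠ[𝓝 y] (LinearMap.toContinuousLinearMap
      ((Module.finBasis ℝ E).coord i)) ∘ extChartAt 𝓘(ℝ, E) x := by
    filter_upwards [hy] with z hz
    simp [coordFun, hz]
  have e2 : mvfderiv 𝓘(ℝ, E) (coordFun x i) y = mvfderiv 𝓘(ℝ, E) ((LinearMap.toContinuousLinearMap
      ((Module.finBasis ℝ E).coord i)) ∘ extChartAt 𝓘(ℝ, E) x) y := by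
    simp only [mvfderiv, e.mfderiv_eq]
    rfl
  rw [e2, mvfderiv_comp_apply _ (ContinuousLinearMap.differentiableAt _).mdifferentiableAt
    (mdifferentiableAt_extChartAt hy')]
  simp only [mvfderiv, mfderiv_eq_fderiv, ContinuousLinearMap.fderiv]
  rfl

/-- The coefficients are derivatives of cut-off coordinate functions. They are therefore globally
smooth whenever `Z` is, as tensoriality over smooth functions requires. -/
theorem eventually_eq_sum_coordField (x : M) (Z : Π x : M, TangentSpace 𝓘(ℝ, E) x) :
    ∀ᶠ y in 𝓝 x, Z y = ∑ i, lieD Z (coordFun x i) y •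
      coordField x (Module.finBasis ℝ E i) y := by
  filter_upwards [Filter.eventually_all.2 fun i => mvfderiv_coordFun (E := E) (M := M) x i,
    Filter.eventually_all.2 fun i => coordField_eventuallyEq (E := E) (M := M) x (Module.finBasis ℝ E i),
    (chartAt E x).open_source.mem_nhds (mem_chart_source E x)] with y h1 h2 hy
  rw [← extChartAt_source 𝓘(ℝ, E)] at hy
  simp only [lieD, h1, h2, chartField_eq _ hy]
  have h2 := mfderivWithin_extChartAt_symm_comp_mfderiv_extChartAt' (I := 𝓘(ℝ, E)) hy
  simp only [modelWithCornersSelf_coe, range_id, mfderivWithin_univ] at h2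
  have e := congrArg (fun f => f (Z y)) h2
  have e' := (Module.finBasis ℝ E).sum_repr
    (mfderiv 𝓘(ℝ, E) 𝓘(ℝ, E) (extChartAt 𝓘(ℝ, E) x) y (Z y))
  have e3 := congrArg (fun v : E => mfderiv 𝓘(ℝ, E) 𝓘(ℝ, E) (extChartAt 𝓘(ℝ, E) x).symm
    (extChartAt 𝓘(ℝ, E) x y) v) e'
  refine (e.symm.trans e3.symm).trans ?_
  exact (map_sum _ _ _).trans (Finset.sum_congr rfl fun i _ => map_smul _ _ _)

namespace SmoothTensorialAt

variable {A : Type*} [AddCommGroup A] [Module ℝ A]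
  {Φ : (Π x : M, TangentSpace 𝓘(ℝ, E) x) → A} {x : M}

/-- A bump function equal to `1` at `x`, supported where the two fields agree, makes them equal
everywhere without changing the value of `Φ`. -/
theorem congr_of_eventuallyEq (h : SmoothTensorialAt Φ x) (hX : CMDiff ∞ (T% X))
    (hY : CMDiff ∞ (T% Y)) (hXY : ∀ᶠ y in 𝓝 x, X y = Y y) : Φ X = Φ Y := by
  obtain ⟨f, -, hf⟩ := ((SmoothBumpFunction.nhds_basis_tsupport (I := 𝓘(ℝ, E)) x).mem_iff).1 hXY
  have e : (f : M → ℝ) • X = (f : M → ℝ) • Y := by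
    funext y
    by_cases hy : y ∈ tsupport f
    · have := hf hy
      simp only [Pi.smul_apply', mem_ofPred_eq] at this ⊢
      rw [this]
    · simp [image_eq_zero_of_notMem_tsupport hy]
  have e1 := h.smul f.contMDiff hX
  have e2 := h.smul f.contMDiff hY
  rw [f.eq_one, one_smul] at e1 e2
  rw [← e1, ← e2, e]

theorem zero (h : SmoothTensorialAt Φ x) : Φ 0 = 0 := by
  have hz : CMDiff ∞ (T% (0 : Π x : M, TangentSpace 𝓘(ℝ, E) x)) :=
    Bundle.contMDiff_zeroSection ℝ (TangentSpace 𝓘(ℝ, E) : M → Type _)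
  have := h.add hz hz
  simpa using this

theorem sum (h : SmoothTensorialAt Φ x) {ι : Type*} (s : Finset ι)
    {Z : ι → Π x : M, TangentSpace 𝓘(ℝ, E) x} (hZ : ∀ i, CMDiff ∞ (T% (Z i))) :
    Φ (fun y => ∑ i ∈ s, Z i y) = ∑ i ∈ s, Φ (Z i) := by
  classical
  induction s using Finset.induction_on with
  | empty => exact h.zero
  | insert a s ha ih =>
    simp only [Finset.sum_insert ha, ← ih]
    exact h.add (hZ a) (ContMDiff.sum_section fun i _ => hZ i)

/-- A tensorial operation depends only on the value of the vector field at the point. -/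
theorem pointwise (h : SmoothTensorialAt Φ x) (hX : CMDiff ∞ (T% X)) (hY : CMDiff ∞ (T% Y))
    (hXY : X x = Y x) : Φ X = Φ Y := by
  have key : ∀ {Z : Π x : M, TangentSpace 𝓘(ℝ, E) x}, CMDiff ∞ (T% Z) →
      Φ Z = ∑ i, mvfderiv 𝓘(ℝ, E) (coordFun x i) x (Z x) •
        Φ (coordField x (Module.finBasis ℝ E i)) := by
    intro Z hZ
    have hs (i) : CMDiff ∞ (T% (lieD Z (coordFun x i) • coordField x (Module.finBasis ℝ E i))) :=
      (mvfderiv_contMDiff (coordFun_contMDiff x i) hZ).smul_section (coordField_contMDiff x _)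
    rw [h.congr_of_eventuallyEq hZ (ContMDiff.sum_section fun i _ => hs i)
      (eventually_eq_sum_coordField x Z)]
    refine (h.sum Finset.univ hs).trans (Finset.sum_congr rfl fun i _ => ?_)
    exact h.smul (mvfderiv_contMDiff (coordFun_contMDiff x i) hZ) (coordField_contMDiff x _)
  rw [key hX, key hY, hXY]

end SmoothTensorialAt

theorem ContMDiff.mdiffAt_field (hX : CMDiff ∞ (T% X)) (x : M) : MDiffAt (T% X) x :=
  (hX x).mdifferentiableAt (by simp)

theorem ContMDiff.mdiffAt_fun {f : M → ℝ} (hf : CMDiff ∞ f) (x : M) : MDiffAt f x :=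
  (hf x).mdifferentiableAt (by simp)

theorem mlieBracket_contMDiff (hX : CMDiff ∞ (T% X)) (hY : CMDiff ∞ (T% Y)) :
    CMDiff ∞ (T% (mlieBracket 𝓘(ℝ, E) X Y)) :=
  ContDiff.mlieBracket_vectorField (m := ⊤) (n := ⊤) hX hY
    (by rw [minSmoothness_of_isRCLikeNormedField]; rfl)

theorem lieD_contMDiff (hX : CMDiff ∞ (T% X)) {f : M → ℝ} (hf : CMDiff ∞ f) :
    CMDiff ∞ (lieD X f) := mvfderiv_contMDiff hf hX

theorem lieD_mul {f g : M → ℝ} (hf : CMDiff ∞ f) (hg : CMDiff ∞ g) (x : M) :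
    lieD X (fun y => f y * g y) x = f x * lieD X g x + g x * lieD X f x := by
  simp only [lieD]
  rw [mvfderiv_fun_mul (hf.mdiffAt_fun x) (hg.mdiffAt_fun x)]
  simp

theorem lieD_add {f g : M → ℝ} (hf : CMDiff ∞ f) (hg : CMDiff ∞ g) (x : M) :
    lieD X (fun y => f y + g y) x = lieD X f x + lieD X g x := by
  simp only [lieD]
  rw [mvfderiv_fun_add (hf.mdiffAt_fun x) (hg.mdiffAt_fun x)]
  simp

theorem lieD_sub {f g : M → ℝ} (hf : CMDiff ∞ f) (hg : CMDiff ∞ g) (x : M) :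
    lieD X (fun y => f y - g y) x = lieD X f x - lieD X g x := by
  simp only [lieD]
  rw [mvfderiv_fun_sub (hf.mdiffAt_fun x) (hg.mdiffAt_fun x)]
  simp

theorem lieD_const (c : ℝ) (x : M) : lieD X (fun _ => c) x = 0 := by
  simp [lieD, mvfderiv_const]

theorem lieD_const_mul {f : M → ℝ} (hf : CMDiff ∞ f) (c : ℝ) (x : M) :
    lieD X (fun y => c * f y) x = c * lieD X f x := by
  rw [lieD_mul contMDiff_const hf, lieD_const]; ring

theorem lieD_congr {f g : M → ℝ} {x : M} (h : f =ᶠ[𝓝 x] g) : lieD X f x = lieD X g x := by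
  simp only [lieD, mvfderiv, h.mfderiv_eq]
  rfl

/-- `X(Yf) - Y(Xf) = [X,Y]f`. -/
theorem lieD_lieD_sub (hX : CMDiff ∞ (T% X)) (hY : CMDiff ∞ (T% Y)) {f : M → ℝ}
    (hf : CMDiff ∞ f) (x : M) : lieD X (lieD Y f) x - lieD Y (lieD X f) x =
      lieD (mlieBracket 𝓘(ℝ, E) X Y) f x := by
  -- The defect of the identity is skew and tensorial in each argument, so it is enough to test it
  -- on coordinate fields, where the bracket vanishes and second derivatives commute.
  let Φ : (Π x : M, TangentSpace 𝓘(ℝ, E) x) → (Π x : M, TangentSpace 𝓘(ℝ, E) x) → ℝ :=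
    fun X Y => lieD X (lieD Y f) x - lieD Y (lieD X f) x - lieD (mlieBracket 𝓘(ℝ, E) X Y) f x
  have swap (X Y : Π x : M, TangentSpace 𝓘(ℝ, E) x) : Φ X Y = -Φ Y X := by
    simp only [Φ, lieD]
    rw [mlieBracket_swap_apply, map_neg]
    ring
  have t1 {Y : Π x : M, TangentSpace 𝓘(ℝ, E) x} (hY : CMDiff ∞ (T% Y)) :
      SmoothTensorialAt (Φ · Y) x := by
    constructor
    · intro X X' hX hX'
      have e : lieD (X + X') f = fun y => lieD X f y + lieD X' f y := by
        funext y; simp [lieD]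
      simp only [Φ, e]
      rw [lieD_add (lieD_contMDiff hX hf) (lieD_contMDiff hX' hf)]
      simp only [lieD, Pi.add_apply, map_add,
        mlieBracket_add_left (hX.mdiffAt_field x) (hX'.mdiffAt_field x)]
      ring
    · intro h X hh hX
      have e : lieD (h • X) f = fun y => h y * lieD X f y := by
        funext y; simp [lieD]
      simp only [Φ, e]
      rw [lieD_mul hh (lieD_contMDiff hX hf)]
      simp only [lieD, Pi.smul_apply', map_smul, smul_eq_mul, map_add,
        mlieBracket_smul_left (hh.mdiffAt_fun x) (hX.mdiffAt_field x), neg_smul, map_neg]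
      ring
  have t2 {Y : Π x : M, TangentSpace 𝓘(ℝ, E) x} (hY : CMDiff ∞ (T% Y)) :
      SmoothTensorialAt (Φ Y) x := by
    constructor
    · intro X X' hX hX'
      rw [swap, swap Y X, swap Y X', (t1 hY).add hX hX']; ring
    · intro h X hh hX
      rw [swap, swap Y X, (t1 hY).smul hh hX]; simp
  have h0 : Φ X Y = 0 := by
    have hc := coordField_contMDiff (M := M) (E := E) x
    rw [(t1 hY).pointwise hX (hc (chartVec x (X x))) (coordField_self x _).symm,
      (t2 (hc _)).pointwise hY (hc (chartVec x (Y x))) (coordField_self x _).symm]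
    simp only [Φ]
    have h1 := (coordField_bracket x (chartVec x (X x)) (chartVec x (Y x))).self_of_nhds
    have h2 := mvfderiv_mvfderiv_coordField x (chartVec x (X x)) (chartVec x (Y x)) hf
    simp only [lieD, h1, map_zero, sub_zero]
    exact sub_eq_zero.2 h2.symm
  exact sub_eq_zero.1 h0

/-- The Cartan formula for the exterior derivative of a 1-form. -/
theorem formDeriv_oneForm {β : Π x : M, TangentSpace 𝓘(ℝ, E) x →L[ℝ] ℝ}
    (hβ : ∀ X : Π x : M, TangentSpace 𝓘(ℝ, E) x, CMDiff ∞ (T% X) → CMDiff ∞ (fun y => β y (X y)))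
    (hX : CMDiff ∞ (T% X)) (hY : CMDiff ∞ (T% Y)) (x : M) :
    formDeriv (fun y => oneForm (β y)) x ![X x, Y x] =
      lieD X (fun y => β y (Y y)) x - lieD Y (fun y => β y (X y)) x -
        β x (mlieBracket 𝓘(ℝ, E) X Y x) := by
  have hs : IsSmoothForm (fun y => oneForm (β y)) := fun A hA => hβ (A 0) (hA 0)
  -- The same device: the right-hand side is tensorial in both fields, and on commuting coordinate
  -- fields it is the chart expression of `d`.
  let Φ : (Π x : M, TangentSpace 𝓘(ℝ, E) x) → (Π x : M, TangentSpace 𝓘(ℝ, E) x) → ℝ :=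
    fun X Y => lieD X (fun y => β y (Y y)) x - lieD Y (fun y => β y (X y)) x -
        β x (mlieBracket 𝓘(ℝ, E) X Y x)
  have swap (X Y : Π x : M, TangentSpace 𝓘(ℝ, E) x) : Φ X Y = -Φ Y X := by
    simp only [Φ, lieD]
    rw [mlieBracket_swap_apply, map_neg]
    ring
  have t1 {Y : Π x : M, TangentSpace 𝓘(ℝ, E) x} (hY : CMDiff ∞ (T% Y)) :
      SmoothTensorialAt (Φ · Y) x := by
    constructor
    · intro X X' hX hX'
      have e : (fun y => β y ((X + X') y)) = fun y => β y (X y) + β y (X' y) := by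
        funext y; simp
      simp only [Φ, e]
      rw [lieD_add (hβ X hX) (hβ X' hX')]
      simp only [lieD, Pi.add_apply, map_add,
        mlieBracket_add_left (hX.mdiffAt_field x) (hX'.mdiffAt_field x)]
      ring
    · intro h X hh hX
      have e : (fun y => β y ((h • X) y)) = fun y => h y * β y (X y) := by
        funext y; simp
      simp only [Φ, e]
      rw [lieD_mul hh (hβ X hX)]
      simp only [lieD, Pi.smul_apply', map_smul, smul_eq_mul, map_add,
        mlieBracket_smul_left (hh.mdiffAt_fun x) (hX.mdiffAt_field x), neg_smul, map_neg]
      ring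
  have t2 {Y : Π x : M, TangentSpace 𝓘(ℝ, E) x} (hY : CMDiff ∞ (T% Y)) :
      SmoothTensorialAt (Φ Y) x := by
    constructor
    · intro X X' hX hX'
      rw [swap, swap Y X, swap Y X', (t1 hY).add hX hX']; ring
    · intro h X hh hX
      rw [swap, swap Y X, (t1 hY).smul hh hX]; simp
  have hc := coordField_contMDiff (M := M) (E := E) x
  change _ = Φ X Y
  rw [(t1 hY).pointwise hX (hc (chartVec x (X x))) (coordField_self x _).symm,
    (t2 (hc _)).pointwise hY (hc (chartVec x (Y x))) (coordField_self x _).symm,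
    formDeriv_apply hs]
  have h1 := (coordField_bracket x (chartVec x (X x)) (chartVec x (Y x))).self_of_nhds
  simp only [Φ, h1, map_zero, sub_zero, lieD, coordField_self]
  simp [Fin.sum_univ_succ, oneForm_apply, Fin.removeNth]
  ring

end FormDeriv

/-! ### Curvature and torsion on smooth vector fields -/

section Curvature

open VectorField Set FiberBundle

variable {E : Type*} [NormedAddCommGroup E] [NormedSpace ℝ E] [FiniteDimensional ℝ E]
  [CompleteSpace E]
  {M : Type*} [TopologicalSpace M] [ChartedSpace E M] [T2Space M] [IsManifold 𝓘(ℝ, E) ∞ M]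
  (D : SmoothConnection E M) {X Y Z : Π x : M, TangentSpace 𝓘(ℝ, E) x}

instance : IsManifold 𝓘(ℝ, E) (minSmoothness ℝ 3) M :=
  IsManifold.of_le (n := ∞) (by
    rw [minSmoothness_of_isRCLikeNormedField]; exact ENat.LEInfty.out)

/-- The vector field `∇_X Y`. -/
def SmoothConnection.nabla (X Y : Π x : M, TangentSpace 𝓘(ℝ, E) x) :
    Π x : M, TangentSpace 𝓘(ℝ, E) x := fun x => D.cov Y x (X x)

namespace SmoothConnection

theorem nabla_contMDiff (hX : CMDiff ∞ (T% X)) (hY : CMDiff ∞ (T% Y)) :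
    CMDiff ∞ (T% (D.nabla X Y)) := by
  have h := D.smooth.contMDiff.contMDiff (σ := Y) (by simpa using! hY.contMDiffOn)
  exact ContMDiff.clm_bundle_apply (F₁ := E) (F₂ := E) (b := fun y : M => y)
    (contMDiffOn_univ.1 h) hX

theorem nabla_add_right (hY : CMDiff ∞ (T% Y)) (hZ : CMDiff ∞ (T% Z)) :
    D.nabla X (Y + Z) = D.nabla X Y + D.nabla X Z := by
  funext y
  simp [nabla, D.cov.isCovariantDerivativeOnUniv.add (hY.mdiffAt_field y) (hZ.mdiffAt_field y)]

theorem nabla_smul_right {f : M → ℝ} (hf : CMDiff ∞ f) (hY : CMDiff ∞ (T% Y)) :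
    D.nabla X (f • Y) = f • D.nabla X Y + lieD X f • Y := by
  funext y
  simp [nabla, lieD,
    D.cov.isCovariantDerivativeOnUniv.leibniz (hY.mdiffAt_field y) (hf.mdiffAt_fun y)]

theorem nabla_neg_right (hY : CMDiff ∞ (T% Y)) : D.nabla X (-Y) = -D.nabla X Y := by
  funext y
  have h := D.cov.isCovariantDerivativeOnUniv.smul_const (-1 : ℝ) (hY.mdiffAt_field y)
  simp only [neg_smul, one_smul] at h
  simp [nabla, h]

theorem nabla_sub_right (hY : CMDiff ∞ (T% Y)) (hZ : CMDiff ∞ (T% Z)) :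
    D.nabla X (Y - Z) = D.nabla X Y - D.nabla X Z := by
  rw [sub_eq_add_neg, D.nabla_add_right hY hZ.neg_section, D.nabla_neg_right hZ, sub_eq_add_neg]

theorem nabla_sum_right {ι : Type*} (s : Finset ι) {Z : ι → Π x : M, TangentSpace 𝓘(ℝ, E) x}
    (hZ : ∀ i, CMDiff ∞ (T% (Z i))) :
    D.nabla X (∑ i ∈ s, Z i) = ∑ i ∈ s, D.nabla X (Z i) := by
  classical
  induction s using Finset.induction_on with
  | empty => funext y; simp [nabla]
  | insert a s ha ih =>
    rw [Finset.sum_insert ha, Finset.sum_insert ha, ← ih]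
    refine D.nabla_add_right (hZ a) ?_
    have h := ContMDiff.sum_section (s := s) fun i _ => hZ i
    have e : (fun x => ∑ i ∈ s, Z i x) = ∑ i ∈ s, Z i := by funext x; simp
    rw [← e]; exact h

theorem curvatureOnFields_eq : curvatureOnFields D.cov Z X Y =
    D.nabla X (D.nabla Y Z) - D.nabla Y (D.nabla X Z) - D.nabla (mlieBracket 𝓘(ℝ, E) X Y) Z :=
  rfl

/-- The second derivatives of `f` cancel against the bracket term by `X(Yf) - Y(Xf) = [X, Y]f`. -/
theorem curvatureOnFields_tensorial (hX : CMDiff ∞ (T% X)) (hY : CMDiff ∞ (T% Y)) (x : M) :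
    SmoothTensorialAt (fun Z => curvatureOnFields D.cov Z X Y x) x := by
  constructor
  · intro Z Z' hZ hZ'
    simp only [curvatureOnFields_eq, D.nabla_add_right hZ hZ',
      D.nabla_add_right (D.nabla_contMDiff hY hZ) (D.nabla_contMDiff hY hZ'),
      D.nabla_add_right (D.nabla_contMDiff hX hZ) (D.nabla_contMDiff hX hZ'),
      Pi.add_apply, Pi.sub_apply]
    module
  · intro f Z hf hZ
    have hXf := lieD_contMDiff hX hf
    have hYf := lieD_contMDiff hY hf
    have hXZ := D.nabla_contMDiff hX hZ
    have hYZ := D.nabla_contMDiff hY hZ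
    have e := lieD_lieD_sub hX hY hf x
    simp only [curvatureOnFields_eq, D.nabla_smul_right hf hZ,
      D.nabla_add_right (hf.smul_section hXZ) (hXf.smul_section hZ),
      D.nabla_add_right (hf.smul_section hYZ) (hYf.smul_section hZ),
      D.nabla_smul_right hf hXZ, D.nabla_smul_right hf hYZ, D.nabla_smul_right hXf hZ,
      D.nabla_smul_right hYf hZ, Pi.add_apply, Pi.sub_apply, Pi.smul_apply', ← e]
    module

/-- `curvature` is defined through `extend`, whose smoothness is used only near `x`. A cut-off gives
a global smooth field, to which `SmoothTensorialAt.pointwise` applies. -/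
theorem exists_contMDiff_eventuallyEq_extend {x : M} (w : TangentSpace 𝓘(ℝ, E) x) :
    ∃ W : Π x : M, TangentSpace 𝓘(ℝ, E) x, CMDiff ∞ (T% W) ∧
      ∀ᶠ y in 𝓝 x, W y = extend E w y ∧ MDiffAt (T% (extend E w)) y := by
  obtain ⟨s, hs, hws⟩ := exists_contMDiffOn_extend (k := ∞) 𝓘(ℝ, E) E w
  obtain ⟨u, hus, huo, hxu⟩ := mem_nhds_iff.1 hs
  obtain ⟨f, -, hf⟩ := ((SmoothBumpFunction.nhds_basis_tsupport (I := 𝓘(ℝ, E)) x).mem_iff).1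
    (huo.mem_nhds hxu)
  refine ⟨(f : M → ℝ) • extend E w,
    ContMDiffOn.smul_section_of_tsupport (u := u) f.contMDiff.contMDiffOn huo hf (hws.mono hus),
    ?_⟩
  filter_upwards [f.eventuallyEq_one, huo.mem_nhds hxu] with y hy hyu
  refine ⟨by simp [hy], ?_⟩
  exact (hws.contMDiffAt (Filter.mem_of_superset (huo.mem_nhds hyu) hus)).mdifferentiableAt
    (by simp)

/-- The curvature can be computed with any smooth extensions. -/
theorem curvature_apply (hX : CMDiff ∞ (T% X)) (hY : CMDiff ∞ (T% Y)) (hZ : CMDiff ∞ (T% Z))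
    (x : M) : D.curvature x (Z x) (X x) (Y x) = curvatureOnFields D.cov Z X Y x := by
  obtain ⟨W, hW, hWe⟩ := exists_contMDiff_eventuallyEq_extend (E := E) (Z x)
  have e1 : D.curvature x (Z x) (X x) (Y x) = curvatureOnFields D.cov (extend E (Z x)) X Y x :=
    TensorialAt.mkHom₂_apply _ _ (hX.mdiffAt_field x) (hY.mdiffAt_field x)
  have hcov : ∀ᶠ y in 𝓝 x, D.cov (extend E (Z x)) y = D.cov W y := by
    filter_upwards [hWe.eventually_nhds] with y hy
    exact D.cov.isCovariantDerivativeOnUniv.congr_of_eventuallyEq (s := Set.univ)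
      hy.self_of_nhds.2 (hW.mdiffAt_field y) Filter.univ_mem (hy.mono fun z hz => hz.1.symm)
  have key {X Y : Π x : M, TangentSpace 𝓘(ℝ, E) x} (hY : CMDiff ∞ (T% Y)) :
      D.cov (fun y => D.cov (extend E (Z x)) y (Y y)) x =
        D.cov (fun y => D.cov W y (Y y)) x :=
    D.cov.isCovariantDerivativeOnUniv.congr_of_eventuallyEq (s := Set.univ)
      (D.mdifferentiableAt_extend _ (hY.mdiffAt_field x))
      ((D.nabla_contMDiff hY hW).mdiffAt_field x) Filter.univ_mem
      (hcov.mono fun z hz => by rw [hz])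
  have e2 : curvatureOnFields D.cov (extend E (Z x)) X Y x = curvatureOnFields D.cov W X Y x := by
    simp only [curvatureOnFields]
    rw [key (X := X) hY, key (X := X) hX, hcov.self_of_nhds]
  rw [e1, e2]
  refine (D.curvatureOnFields_tensorial hX hY x).pointwise hW hZ ?_
  rw [hWe.self_of_nhds.1]; simp

/-- The torsion of two vector fields. -/
def tor (X Y : Π x : M, TangentSpace 𝓘(ℝ, E) x) : Π x : M, TangentSpace 𝓘(ℝ, E) x :=
  fun x => D.cov.torsion x (X x) (Y x)

theorem tor_eq (hX : CMDiff ∞ (T% X)) (hY : CMDiff ∞ (T% Y)) :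
    D.tor X Y = D.nabla X Y - D.nabla Y X - mlieBracket 𝓘(ℝ, E) X Y := by
  funext x
  exact D.cov.torsion_apply (hX.mdiffAt_field x) (hY.mdiffAt_field x)

theorem tor_contMDiff (hX : CMDiff ∞ (T% X)) (hY : CMDiff ∞ (T% Y)) :
    CMDiff ∞ (T% (D.tor X Y)) := by
  rw [D.tor_eq hX hY]
  exact ((D.nabla_contMDiff hX hY).sub_section (D.nabla_contMDiff hY hX)).sub_section
    (mlieBracket_contMDiff hX hY)

theorem tor_swap : D.tor X Y = -D.tor Y X := by
  funext x
  exact D.cov.torsion_antisymm _ _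

/-- The first Bianchi identity for a connection with torsion. -/
theorem bianchi (hX : CMDiff ∞ (T% X)) (hY : CMDiff ∞ (T% Y)) (hZ : CMDiff ∞ (T% Z)) :
    curvatureOnFields D.cov Z X Y + curvatureOnFields D.cov X Y Z + curvatureOnFields D.cov Y Z X =
      (D.nabla X (D.tor Y Z) + D.nabla Y (D.tor Z X) + D.nabla Z (D.tor X Y)) +
      (D.tor X (mlieBracket 𝓘(ℝ, E) Y Z) + D.tor Y (mlieBracket 𝓘(ℝ, E) Z X) +
        D.tor Z (mlieBracket 𝓘(ℝ, E) X Y)) := by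
  -- Expanding the torsions leaves second covariant derivatives, which assemble into curvatures, and
  -- nested brackets, which cancel by the Jacobi identity.
  have e {A B C : Π x : M, TangentSpace 𝓘(ℝ, E) x} (hA : CMDiff ∞ (T% A)) (hB : CMDiff ∞ (T% B))
      (hC : CMDiff ∞ (T% C)) : D.nabla A (D.tor B C) + D.tor A (mlieBracket 𝓘(ℝ, E) B C) =
      D.nabla A (D.nabla B C) - D.nabla A (D.nabla C B) - D.nabla (mlieBracket 𝓘(ℝ, E) B C) A -
        mlieBracket 𝓘(ℝ, E) A (mlieBracket 𝓘(ℝ, E) B C) := by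
    rw [D.tor_eq hB hC, D.tor_eq hA (mlieBracket_contMDiff hB hC),
      D.nabla_sub_right ((D.nabla_contMDiff hB hC).sub_section (D.nabla_contMDiff hC hB))
        (mlieBracket_contMDiff hB hC),
      D.nabla_sub_right (D.nabla_contMDiff hB hC) (D.nabla_contMDiff hC hB)]
    abel
  have h2 {A : Π x : M, TangentSpace 𝓘(ℝ, E) x} (hA : CMDiff ∞ (T% A)) :
      CMDiff (minSmoothness ℝ 2) (T% A) := hA.of_le minSmoothness_two_le
  have jac := leibniz_identity_mlieBracket (I := 𝓘(ℝ, E)) (h2 hX) (h2 hY) (h2 hZ)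
  have s1 : mlieBracket 𝓘(ℝ, E) (mlieBracket 𝓘(ℝ, E) X Y) Z =
      -mlieBracket 𝓘(ℝ, E) Z (mlieBracket 𝓘(ℝ, E) X Y) := mlieBracket_swap
  have s2 : mlieBracket 𝓘(ℝ, E) Y (mlieBracket 𝓘(ℝ, E) X Z) =
      -mlieBracket 𝓘(ℝ, E) Y (mlieBracket 𝓘(ℝ, E) Z X) := by
    funext x
    rw [mlieBracket_swap (V := X) (W := Z)]
    have := mlieBracket_const_smul_right (I := 𝓘(ℝ, E)) (V := Y) (c := (-1 : ℝ))
      ((mlieBracket_contMDiff hZ hX).mdiffAt_field x)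
    simp only [neg_smul, one_smul] at this
    exact this
  rw [s1, s2] at jac
  simp only [curvatureOnFields_eq]
  have e1 := e hX hY hZ
  have e2 := e hY hZ hX
  have e3 := e hZ hX hY
  have j0 : mlieBracket 𝓘(ℝ, E) X (mlieBracket 𝓘(ℝ, E) Y Z) +
      mlieBracket 𝓘(ℝ, E) Y (mlieBracket 𝓘(ℝ, E) Z X) +
      mlieBracket 𝓘(ℝ, E) Z (mlieBracket 𝓘(ℝ, E) X Y) = 0 := by rw [jac]; abel
  rw [show ∀ a b c a' b' c' : Π x : M, TangentSpace 𝓘(ℝ, E) x,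
    a + b + c + (a' + b' + c') = (a + a') + (b + b') + (c + c') from fun _ _ _ _ _ _ => by abel,
    e1, e2, e3, ← sub_eq_zero, ← j0]
  abel

end SmoothConnection

end Curvature

/-! ### Contractions with a nondegenerate symmetric form -/

section Contraction

variable {W A : Type*} [AddCommGroup W] [Module ℝ W] [FiniteDimensional ℝ W]
  [AddCommGroup A] [Module ℝ A] (g : LinearMap.BilinForm ℝ W)

theorem gContract_add (F G : W → W → A) :
    gContract g (fun X Y => F X Y + G X Y) = gContract g F + gContract g G := by
  simp [gContract, smul_add, Finset.sum_add_distrib]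

theorem gContract_smul (c : ℝ) (F : W → W → A) :
    gContract g (fun X Y => c • F X Y) = c • gContract g F := by
  simp [gContract, Finset.smul_sum, smul_comm c]

theorem gContract_mul (c : ℝ) (F : W → W → ℝ) :
    gContract g (fun X Y => c * F X Y) = c * gContract g F := gContract_smul g c F

theorem gContract_mul_right (c : ℝ) (F : W → W → ℝ) :
    gContract g (fun X Y => F X Y * c) = gContract g F * c := by
  simp only [mul_comm _ c]; exact gContract_smul g c F

theorem gContract_neg (F : W → W → A) :
    gContract g (fun X Y => -F X Y) = -gContract g F := by
  simpa using gContract_smul g (-1) F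

theorem gContract_sub (F G : W → W → A) :
    gContract g (fun X Y => F X Y - G X Y) = gContract g F - gContract g G := by
  simp only [sub_eq_add_neg, gContract_add, gContract_neg]

theorem gContract_zero : gContract g (fun _ _ => (0 : A)) = 0 := by simp [gContract]

variable {g}

theorem gContract_swap (hg : ∀ X Y, g X Y = g Y X) (F : W → W → A) :
    gContract g (fun X Y => F Y X) = gContract g F := by
  simp only [gContract]
  rw [Finset.sum_comm]
  refine Finset.sum_congr rfl fun i _ => Finset.sum_congr rfl fun j _ => ?_
  congr 1
  set G : Matrix _ _ ℝ := Matrix.of fun i j =>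
    g (Module.finBasis ℝ W i) (Module.finBasis ℝ W j) with hG
  have : G.transpose = G := by
    ext a b; simp [hG, hg (Module.finBasis ℝ W b)]
  conv_lhs => rw [← this, ← Matrix.transpose_nonsing_inv]
  rfl

/-- The `g`-dual of a basis computes contractions. -/
theorem exists_dual_basis (hg : ∀ X Y, g X Y = g Y X) (hn : ∀ X, (∀ Y, g X Y = 0) → X = 0) :
    ∃ d : Fin (Module.finrank ℝ W) → W, (∀ i j, g (Module.finBasis ℝ W i) (d j) =
      if i = j then 1 else 0) ∧
      ∀ F : W →ₗ[ℝ] W →ₗ[ℝ] A, gContract g (fun X Y => F X Y) =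
        ∑ i, F (Module.finBasis ℝ W i) (d i) := by
  set b := Module.finBasis ℝ W with hb
  set G : Matrix _ _ ℝ := Matrix.of fun i j => g (b i) (b j) with hG
  -- A null vector of the Gram matrix would give coefficients of a vector orthogonal to all of `W`.
  have hdet : IsUnit G.det := by
    rw [isUnit_iff_ne_zero]
    intro h0
    obtain ⟨v, hv0, hv⟩ := Matrix.exists_mulVec_eq_zero_iff.2 h0
    apply hv0
    have hz : ∑ j, v j • b j = 0 := by
      apply hn
      intro Y
      rw [← b.sum_repr Y]
      simp only [map_sum, map_smul, LinearMap.sum_apply, LinearMap.smul_apply]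
      refine Finset.sum_eq_zero fun i _ => ?_
      have := congrFun hv i
      simp only [Matrix.mulVec, dotProduct, hG, Matrix.of_apply, Pi.zero_apply] at this
      have e : ∑ j, v j • g (b j) (b i) = 0 := by
        rw [← this]
        exact Finset.sum_congr rfl fun j _ => by rw [hg (b j), smul_eq_mul, mul_comm]
      rw [e, smul_zero]
    funext j
    exact Fintype.linearIndependent_iff.1 b.linearIndependent v hz j
  refine ⟨fun i => ∑ j, G⁻¹ i j • b j, fun i j => ?_, fun F => ?_⟩
  · have h1 := congrFun (congrFun (Matrix.nonsing_inv_mul G hdet) j) i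
    simp only [map_sum, map_smul, smul_eq_mul]
    rw [Matrix.mul_apply, Matrix.one_apply] at h1
    simp only [eq_comm (a := i), ← h1]
    exact Finset.sum_congr rfl fun k _ => by rw [hG, Matrix.of_apply, hg]
  · simp [gContract, ← hb, ← hG, map_sum]

section Expansion

variable {ι : Type*} [Fintype ι] [DecidableEq ι] {b : Module.Basis ι ℝ W} {d : ι → W}

theorem dual_basis_repr (hd : ∀ i j, g (b i) (d j) = if i = j then 1 else 0) (v : W) (k : ι) :
    g v (d k) = b.repr v k := by
  have h : g v (d k) = g (∑ i, b.repr v i • b i) (d k) := by rw [b.sum_repr]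
  rw [h]
  simp only [map_sum, map_smul, LinearMap.sum_apply, LinearMap.smul_apply, hd, smul_eq_mul,
    mul_ite, mul_one, mul_zero, Finset.sum_ite_eq', Finset.mem_univ, if_true]

theorem dual_basis_expansion_left (hd : ∀ i j, g (b i) (d j) = if i = j then 1 else 0) (v : W) :
    v = ∑ k, g v (d k) • b k := by
  simp only [dual_basis_repr hd, b.sum_repr]

theorem dual_basis_expansion_right (hg : ∀ X Y, g X Y = g Y X)
    (hn : ∀ X, (∀ Y, g X Y = 0) → X = 0)
    (hd : ∀ i j, g (b i) (d j) = if i = j then 1 else 0) (w : W) :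
    w = ∑ k, g (b k) w • d k := by
  refine sub_eq_zero.1 (hn _ fun Y => ?_)
  rw [hg]
  have h : (g.flip (w - ∑ k, g (b k) w • d k)) = 0 := by
    refine b.ext fun i => ?_
    simp [map_sum, hd]
  exact LinearMap.congr_fun h Y

end Expansion

variable {F : W → W → ℝ}

/-- Expanding `B` in the basis and `B'` in the dual basis turns both sides into the same double sum.
This is the cyclicity of the trace in the form used below. -/
theorem gContract_adjoint (hg : ∀ X Y, g X Y = g Y X) (hn : ∀ X, (∀ Y, g X Y = 0) → X = 0)
    (hF : IsBilinearMap ℝ F) {B B' : W →ₗ[ℝ] W} (hB : ∀ X Y, g (B X) Y = g X (B' Y)) :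
    gContract g (fun X Y => F (B X) Y) = gContract g (fun X Y => F X (B' Y)) := by
  obtain ⟨d, hd, hc⟩ := exists_dual_basis (A := ℝ) hg hn
  have e1 := hc (hF.toLinearMap.comp B)
  have e2 := hc (hF.toLinearMap.compl₂ B')
  refine (e1.trans ?_).trans e2.symm
  set b := Module.finBasis ℝ W
  have e3 (i) : hF.toLinearMap (B (b i)) (d i) =
      ∑ k, g (B (b i)) (d k) • hF.toLinearMap (b k) (d i) := by
    conv_lhs => rw [dual_basis_expansion_left hd (B (b i))]
    rw [map_sum, LinearMap.sum_apply]
    simp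
  have e4 (k) : hF.toLinearMap (b k) (B' (d k)) =
      ∑ i, g (b i) (B' (d k)) • hF.toLinearMap (b k) (d i) := by
    conv_lhs => rw [dual_basis_expansion_right hg hn hd (B' (d k))]
    rw [map_sum]
    simp
  simp only [LinearMap.comp_apply, LinearMap.compl₂_apply, e3, e4, hB]
  exact Finset.sum_comm

/-- The reproducing property: contracting with the metric is evaluation at the vector. -/
theorem gContract_left (hg : ∀ X Y, g X Y = g Y X) (hn : ∀ X, (∀ Y, g X Y = 0) → X = 0)
    (L : W →ₗ[ℝ] ℝ) (Z : W) : gContract g (fun X Y => g Z X * L Y) = L Z := by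
  obtain ⟨d, hd, hc⟩ := exists_dual_basis (A := ℝ) hg hn
  have e := hc ((g Z).smulRight L)
  refine e.trans ?_
  conv_rhs => rw [dual_basis_expansion_right hg hn hd Z, map_sum]
  simp [hg Z]

theorem gContract_right (hg : ∀ X Y, g X Y = g Y X) (hn : ∀ X, (∀ Y, g X Y = 0) → X = 0)
    (L : W →ₗ[ℝ] ℝ) (Z : W) : gContract g (fun X Y => g Z Y * L X) = L Z := by
  rw [gContract_swap hg (fun X Y => g Z X * L Y), gContract_left hg hn]

theorem gContract_form (hg : ∀ X Y, g X Y = g Y X) (hn : ∀ X, (∀ Y, g X Y = 0) → X = 0) :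
    gContract g (fun X Y => g X Y) = Module.finrank ℝ W := by
  obtain ⟨d, hd, hc⟩ := exists_dual_basis (A := ℝ) hg hn
  rw [hc g]
  simp [hd]

theorem gContract_eq_zero_of_skew (hg : ∀ X Y, g X Y = g Y X) (hF : ∀ X Y, F X Y = -F Y X) :
    gContract g (fun X Y => F X Y) = 0 := by
  have h := gContract_swap hg F
  have h2 := gContract_neg g F
  rw [← h] at h2
  have e : (fun X Y => -F X Y) = fun X Y => F Y X := by funext X Y; rw [hF Y X]
  rw [e] at h2
  rw [h] at h2
  change gContract g F = 0
  linarith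

end Contraction

/-! ### Linear algebra of paraquaternionic vector spaces -/

/-- `(i, j, k)` is a cyclic permutation of `(1, 2, 3)`. -/
def IsCyclic3 (i j k : Fin 3) : Prop := j = i + 1 ∧ k = i + 2

theorem IsCyclic3.rot {i j k : Fin 3} (h : IsCyclic3 i j k) : IsCyclic3 j k i := by
  obtain ⟨rfl, rfl⟩ := h
  constructor <;> fin_cases i <;> rfl

theorem IsCyclic3.of (i : Fin 3) : IsCyclic3 i (i + 1) (i + 2) := ⟨rfl, rfl⟩

/-- Exactly one of the three signs is negative. Splitting into these cases turns the sign
bookkeeping below into linear arithmetic. -/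
theorem IsCyclic3.signs {i j k : Fin 3} (h : IsCyclic3 i j k) :
    (pqSign i = 1 ∧ pqSign j = 1 ∧ pqSign k = -1) ∨ (pqSign i = 1 ∧ pqSign j = -1 ∧ pqSign k = 1) ∨
      (pqSign i = -1 ∧ pqSign j = 1 ∧ pqSign k = 1) := by
  obtain ⟨rfl, rfl⟩ := h
  fin_cases i <;> simp [pqSign]

theorem IsCyclic3.sum_eq {i j k : Fin 3} (h : IsCyclic3 i j k) {A : Type*} [AddCommMonoid A]
    (f : Fin 3 → A) : ∑ s, f s = f i + f j + f k := by
  obtain ⟨rfl, rfl⟩ := h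
  fin_cases i <;> simp only [Fin.sum_univ_three]
  · rfl
  · change f 0 + f 1 + f 2 = f 1 + f 2 + f 0; abel
  · change f 0 + f 1 + f 2 = f 2 + f 0 + f 1; abel

theorem pqSign_mul_self (s : Fin 3) : pqSign s * pqSign s = 1 := by
  fin_cases s <;> simp [pqSign]

section Algebra

variable {W : Type*} [AddCommGroup W] [Module ℝ W] [FiniteDimensional ℝ W]

/-- A paraquaternionic structure with compatible metric on a vector space. -/
structure IsParaquaternionic (g : LinearMap.BilinForm ℝ W) (J : Fin 3 → W →ₗ[ℝ] W) : Prop where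
  symm : ∀ X Y, g X Y = g Y X
  nondegenerate : ∀ X, (∀ Y, g X Y = 0) → X = 0
  sq : ∀ s X, J s (J s X) = pqSign s • X
  mul : ∀ i X, J i (J (i + 1) X) = -(pqSign (i + 2) • J (i + 2) X)
  mul_swap : ∀ i X, J (i + 1) (J i X) = pqSign (i + 2) • J (i + 2) X
  compatible : ∀ s X Y, g (J s X) (J s Y) = -(pqSign s * g X Y)

namespace IsParaquaternionic

variable {g : LinearMap.BilinForm ℝ W} {J : Fin 3 → W →ₗ[ℝ] W} (h : IsParaquaternionic g J)
include h

theorem skew (s : Fin 3) (X Y : W) : g (J s X) Y = -g X (J s Y) := by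
  have e := h.compatible s X (J s Y)
  rw [h.sq, map_smul, smul_eq_mul] at e
  have := pqSign_mul_self s
  linear_combination pqSign s * e - (g (J s X) Y + g X (J s Y)) * this

theorem mul_ij {i j k : Fin 3} (c : IsCyclic3 i j k) (X : W) :
    J i (J j X) = -(pqSign k • J k X) := by
  obtain ⟨rfl, rfl⟩ := c; exact h.mul i X

theorem mul_ji {i j k : Fin 3} (c : IsCyclic3 i j k) (X : W) :
    J j (J i X) = pqSign k • J k X := by
  obtain ⟨rfl, rfl⟩ := c; exact h.mul_swap i X

/-- Traces. -/
theorem contract_J (F : W →ₗ[ℝ] W →ₗ[ℝ] ℝ) (s : Fin 3) :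
    gContract g (fun X Y => F (J s X) Y) = -gContract g (fun X Y => F X (J s Y)) := by
  have hF : IsBilinearMap ℝ (fun X Y => F X Y) :=
    ⟨by simp, by simp, by simp, by simp⟩
  rw [gContract_adjoint (B := J s) (B' := -J s) h.symm h.nondegenerate hF
    (by intro X Y; simp [h.skew]), ← gContract_neg]
  simp

theorem contract_one : gContract g (fun X Y => g X Y) = Module.finrank ℝ W :=
  gContract_form h.symm h.nondegenerate

theorem contract_form_J (s : Fin 3) : gContract g (fun X Y => g X (J s Y)) = 0 := by
  refine gContract_eq_zero_of_skew h.symm fun X Y => ?_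
  rw [h.symm, h.skew]

/-- A linear map `A` whose commutators with the `J_i` are `∑ c_it J_t` has `c` determined by
the traces of `A J_s`. -/
theorem commutator_coeff {i j k : Fin 3} (c : IsCyclic3 i j k) {N : ℝ}
    (hN : (Module.finrank ℝ W : ℝ) = N) (hN0 : N ≠ 0) (A : W →ₗ[ℝ] W)
    (a : Fin 3 → ℝ) (r : Fin 3 → ℝ) (hr : ∀ s, gContract g (fun X Y => g (A X) (J s Y)) = N * r s)
    (hA : ∀ X, A (J i X) - J i (A X) = ∑ t, a t • J t X) :
    a i = 0 ∧ a k = 2 * pqSign i * r j ∧ a j = -2 * pqSign i * r k := by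
  obtain ⟨X0, hX0⟩ : ∃ X : W, X ≠ 0 := by
    by_contra! h0
    have : Subsingleton W := ⟨fun a b => by rw [h0 a, h0 b]⟩
    exact hN0 (by rw [← hN, Module.finrank_zero_of_subsingleton]; simp)
  -- As `J_i²` is a scalar, `[A, J_i]` anticommutes with `J_i`. The terms in `J_j` and `J_k` do so
  -- automatically, which leaves `2 a_i ε_i = 0`.
  have hii : a i = 0 := by
    have e1 := hA (J i X0)
    have e2 := congrArg (J i) (hA X0)
    rw [c.sum_eq] at e1 e2
    simp only [h.sq, map_sub, map_add, map_smul, h.mul_ij c, h.mul_ji c, h.mul_ij c.rot.rot,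
      h.mul_ji c.rot.rot] at e1 e2
    have e3 : (2 * a i * pqSign i) • X0 = 0 := by
      linear_combination (norm := module) -e1 - e2
    have := pqSign_mul_self i
    rcases smul_eq_zero.1 e3 with e | e
    · linear_combination pqSign i / 2 * e - a i * this
    · exact absurd e hX0
  -- Contract the commutator relation against `J_u`. Moving `J_i` across the trace leaves
  -- contractions of `A` with `J_i J_u - J_u J_i`, a multiple of one `r_w` when `u` is `j` or `k`.
  have tr (u : Fin 3) (hA' : ∀ X, A (J i X) - J i (A X) = a j • J j X + a k • J k X) :
      gContract g (fun X Y => g (A X) (J i (J u Y)) - g (A X) (J u (J i Y))) =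
      gContract g (fun X Y => -(a j * g X (J j (J u Y))) + -(a k * g X (J k (J u Y)))) := by
    have e (X Y : W) : -(a j * g X (J j (J u Y))) + -(a k * g X (J k (J u Y))) =
        g (A (J i X)) (J u Y) + g (A X) (J i (J u Y)) := by
      have := congrArg (fun v => g v (J u Y)) (hA' X)
      simp only [map_sub, map_add, map_smul, LinearMap.sub_apply, LinearMap.add_apply,
        LinearMap.smul_apply, smul_eq_mul, h.skew] at this
      linear_combination -this
    simp only [e, gContract_add, gContract_sub]
    have := h.contract_J (LinearMap.compl₂ (LinearMap.comp g A) (J u)) i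
    simp only [LinearMap.compl₂_apply, LinearMap.comp_apply] at this
    rw [this]; ring
  have hA' (X : W) : A (J i X) - J i (A X) = a j • J j X + a k • J k X := by
    rw [hA, c.sum_eq, hii]; simp
  have ek := tr k hA'
  have ej := tr j hA'
  simp only [h.sq, h.mul_ij c, h.mul_ji c, h.mul_ij c.rot, h.mul_ji c.rot,
    h.mul_ij c.rot.rot, h.mul_ji c.rot.rot, map_neg, map_smul, smul_eq_mul, gContract_add,
    gContract_neg, gContract_sub, gContract_mul, hr, h.contract_form_J, h.contract_one, hN] at ek ej
  refine ⟨hii, mul_left_cancel₀ hN0 ?_, mul_left_cancel₀ hN0 ?_⟩ <;>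
  rcases c.signs with ⟨e1, e2, e3⟩ | ⟨e1, e2, e3⟩ | ⟨e1, e2, e3⟩ <;>
  simp only [e1, e2, e3] at ek ej ⊢ <;> linarith

/-- The equation expressing that the vertical part of the torsion is parallel forces the mixed
torsion to be horizontal. -/
theorem mixed_torsion_trace {N : ℝ} (hN : (Module.finrank ℝ W : ℝ) = N) (hN0 : 0 < N)
    (θ : Fin 3 → W →ₗ[ℝ] ℝ)
    (hθ : ∀ X Y Z, ∑ s, pqSign s * (g (J s X) Y * θ s Z + g (J s Y) Z * θ s X +
      g (J s Z) X * θ s Y) = 0) (Z : W) :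
    (∑ s, pqSign s * θ s (J s Z) = 0) ∧ (N ≠ 4 → ∀ s, θ s Z = 0) := by
  -- Contract the hypothesis over `X` and `Y` with `J_i Y` and `J_i Z` in place of `Y` and `Z`. With
  -- `S = ∑ ε_s θ_s(J_s Z)`, summing over `i` gives `(4 - N) S = 6 S`, hence `S = 0` because `N >
  -- 0`.
  have key {i j k : Fin 3} (c : IsCyclic3 i j k) (Z : W) :
      (4 - N) * (pqSign i * θ i (J i Z)) = 2 * (pqSign i * θ i (J i Z) + pqSign j * θ j (J j Z) +
        pqSign k * θ k (J k Z)) := by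
    have e : gContract g (fun X Y => ∑ s, pqSign s * (g (J s X) (J i Y) * θ s (J i Z) +
        g (J s (J i Y)) (J i Z) * θ s X + g (J s (J i Z)) X * θ s (J i Y))) = 0 := by
      simp only [hθ, gContract_zero]
    have l (s) (Z : W) : gContract g (fun X Y => g Z X * θ s (J i Y)) = θ s (J i Z) :=
      gContract_left h.symm h.nondegenerate ((θ s).comp (J i)) Z
    have l2 (s u) (Z : W) : gContract g (fun X Y => g Z (J u X) * θ s (J i Y)) =
        -θ s (J i (J u Z)) := by
      have := l s (-J u Z)
      simpa [h.skew] using this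
    have r (s) (Z : W) : gContract g (fun X Y => g Y Z * θ s X) = θ s Z := by
      simp only [h.symm _ Z]; exact gContract_right h.symm h.nondegenerate (θ s) Z
    have d : gContract g (fun X Y => g X Y) = N := h.contract_one.trans hN
    simp only [c.sum_eq, gContract_add, gContract_mul, gContract_mul_right, h.skew,
      h.sq, h.mul_ij c, h.mul_ji c,
      h.mul_ij c.rot.rot, h.mul_ji c.rot.rot, map_neg, map_smul, smul_eq_mul, gContract_neg, d,
      h.contract_form_J, l, l2, r, neg_mul, mul_assoc] at e
    rcases c.signs with ⟨e1, e2, e3⟩ | ⟨e1, e2, e3⟩ | ⟨e1, e2, e3⟩ <;>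
    simp only [e1, e2, e3] at e ⊢ <;> linarith
  have c := IsCyclic3.of 0
  have S (Z : W) : pqSign 0 * θ 0 (J 0 Z) + pqSign 1 * θ 1 (J 1 Z) + pqSign 2 * θ 2 (J 2 Z) = 0 := by
    have k0 := key c Z
    have k1 := key c.rot Z
    have k2 := key c.rot.rot Z
    simp only [zero_add] at k0 k1 k2
    have : (2 + N) * (pqSign 0 * θ 0 (J 0 Z) + pqSign 1 * θ 1 (J 1 Z) + pqSign 2 * θ 2 (J 2 Z)) = 0 := by
      linear_combination -k0 - k1 - k2
    rcases mul_eq_zero.1 this with e | e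
    · linarith
    · exact e
  refine ⟨by rw [Fin.sum_univ_three]; exact S Z, fun hN4 s => ?_⟩
  have ks := key (IsCyclic3.of s) (J s Z)
  have e := S (J s Z)
  rw [← Fin.sum_univ_three (fun s' => pqSign s' * θ s' (J s' (J s Z))), (IsCyclic3.of s).sum_eq] at e
  rw [e, mul_zero, h.sq, map_smul, smul_eq_mul, ← mul_assoc (pqSign s), pqSign_mul_self, one_mul] at ks
  rcases mul_eq_zero.1 ks with e | e
  · exact absurd (by linarith) hN4
  · exact e

/-- The case of dimension four, where one needs the Reeb conditions. -/
theorem mixed_torsion_eq_zero {N : ℝ} (hN : (Module.finrank ℝ W : ℝ) = N) (hN0 : 0 < N)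
    (θ : Fin 3 → Fin 3 → W →ₗ[ℝ] ℝ)
    (hθ : ∀ t X Y Z, ∑ s, pqSign s * (g (J s X) Y * θ s t Z + g (J s Y) Z * θ s t X +
      g (J s Z) X * θ s t Y) = 0)
    (h4 : N = 4 → ∀ X, (∀ s, θ s s X = 0) ∧ ∀ i j k, IsCyclic3 i j k →
      θ j i X = pqSign k * θ i j X) (s t : Fin 3) (Z : W) : θ s t Z = 0 := by
  by_cases h0 : N = 4
  · have S (t) (Z) := (h.mixed_torsion_trace hN hN0 (fun s => θ s t) (hθ t) Z).1
    have d (X) := (h4 h0 X).1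
    have c (i) (X) := (h4 h0 X).2 i _ _ (IsCyclic3.of i)
    have c0 (X) : θ 1 0 X = -θ 0 1 X := by simpa [pqSign] using c 0 X
    have c1 (X) : θ 2 1 X = θ 1 2 X := by simpa [pqSign] using c 1 X
    have c2 (X) : θ 0 2 X = θ 2 0 X := by simpa [pqSign] using c 2 X
    have s0 (X) : -θ 0 1 (J 1 X) - θ 2 0 (J 2 X) = 0 := by
      simpa [Fin.sum_univ_three, pqSign, d, c0, sub_eq_add_neg] using S 0 X
    have s1 (X) : θ 0 1 (J 0 X) - θ 1 2 (J 2 X) = 0 := by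
      simpa [Fin.sum_univ_three, pqSign, d, c1, sub_eq_add_neg] using S 1 X
    have s2 (X) : θ 2 0 (J 0 X) + θ 1 2 (J 1 X) = 0 := by
      simpa [Fin.sum_univ_three, pqSign, d, c2, sub_eq_add_neg] using S 2 X
    have q0 (X : W) : J 0 (J 0 X) = X := by simpa [pqSign] using h.sq 0 X
    have q1 (X : W) : J 1 (J 1 X) = X := by simpa [pqSign] using h.sq 1 X
    have q2 (X : W) : J 2 (J 2 X) = -X := by simpa [pqSign] using h.sq 2 X
    have m12 (X : W) : J 1 (J 2 X) = -J 0 X := by simpa [pqSign] using h.mul 1 X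
    have m02 (X : W) : J 0 (J 2 X) = J 1 X := by simpa [pqSign] using h.mul_swap 2 X
    -- The Reeb conditions leave only `θ 0 1`, `θ 1 2` and `θ 2 0`. The trace relations for `t = 0,
    -- 1` express the other two through `θ 0 1`, and the one for `t = 2` then reads `-2 θ 0 1 = 0`.
    have eC (X) : θ 2 0 X = -θ 0 1 (J 0 X) := by
      have := s0 (J 2 X); rw [m12, q2, map_neg, map_neg] at this; linarith
    have eB (X) : θ 1 2 X = -θ 0 1 (J 1 X) := by
      have := s1 (J 2 X); rw [m02, q2, map_neg] at this; linarith
    have eA (X) : θ 0 1 X = 0 := by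
      have := s2 X; rw [eC, eB, q0, q1] at this; linarith
    have eB' (X) : θ 1 2 X = 0 := by rw [eB, eA, neg_zero]
    have eC' (X) : θ 2 0 X = 0 := by rw [eC, eA, neg_zero]
    fin_cases s <;> fin_cases t <;> simp [d, c0, c1, c2, eA, eB', eC']
  · exact (h.mixed_torsion_trace hN hN0 (fun s => θ s t) (hθ t) Z).2 h0 s

end IsParaquaternionic

end Algebra

theorem IsCyclic3.exists_of_ne {u v : Fin 3} (huv : u ≠ v) :
    ∃ w, IsCyclic3 u v w ∨ IsCyclic3 v u w := by
  unfold IsCyclic3; revert u v; decide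

/-! ### Traces of the Bianchi identity: vertical torsion, Ricci forms and scalar curvature. -/

section Algebra

variable {W : Type*} [AddCommGroup W] [Module ℝ W] [FiniteDimensional ℝ W]

namespace IsParaquaternionic

variable {g : LinearMap.BilinForm ℝ W} {J : Fin 3 → W →ₗ[ℝ] W} (h : IsParaquaternionic g J)
include h

theorem anticomm {u v : Fin 3} (huv : u ≠ v) (X : W) : J u (J v X) = -J v (J u X) := by
  obtain ⟨w, c | c⟩ := IsCyclic3.exists_of_ne huv
  · rw [h.mul_ij c, h.mul_ji c]
  · rw [h.mul_ij c, h.mul_ji c, neg_neg]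

theorem exists_mul {u v : Fin 3} (huv : u ≠ v) : ∃ (a : ℝ) (w : Fin 3), ∀ X, J u (J v X) = a • J w X := by
  obtain ⟨w, c | c⟩ := IsCyclic3.exists_of_ne huv
  · exact ⟨-pqSign w, w, fun X => by rw [h.mul_ij c, neg_smul]⟩
  · exact ⟨pqSign w, w, h.mul_ji c⟩

theorem contract_form_J_J {N : ℝ} (hN : (Module.finrank ℝ W : ℝ) = N) (u v : Fin 3) :
    gContract g (fun X Y => g X (J u (J v Y))) = if u = v then pqSign u * N else 0 := by
  split_ifs with huv
  · subst huv
    simp only [h.sq, map_smul, smul_eq_mul, gContract_mul, h.contract_one, hN]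
  · obtain ⟨a, w, e⟩ := h.exists_mul huv
    simp only [e, map_smul, smul_eq_mul, gContract_mul, h.contract_form_J, mul_zero]

variable {N : ℝ} (hN : (Module.finrank ℝ W : ℝ) = N) (hN0 : 0 < N)
  {T : Fin 3 → W →ₗ[ℝ] W} (hT : ∀ s u, gContract g (fun X Y => g (T s X) (J u Y)) = 0)
include hN

/-- This contracts the right-hand side of the vertical Bianchi identity against `J_v`. The two
torsion terms have opposite traces. Since `T_s` is orthogonal to every `J_w`, they survive only for
`v = t`, where `J_t J_v` is a scalar. -/
theorem trace_mixed (S : Fin 3 → Fin 3 → Fin 3 → ℝ) (t s v : Fin 3)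
    (hT : ∀ s u, gContract g (fun X Y => g (T s X) (J u Y)) = 0) :
    gContract g (fun X Y => -2 * (∑ u, pqSign u * g (J u X) (J v Y) * S t u s) -
      2 * pqSign t * (g (T s (J v Y)) (J t X) - g (T s X) (J t (J v Y)))) =
    2 * N * S t v s + if v = t then 4 * gContract g (fun X Y => g (T s X) Y) else 0 := by
  have e1 (u) : gContract g (fun X Y => g (J u X) (J v Y)) =
      -(if v = u then pqSign v * N else 0) :=
    (h.contract_J (LinearMap.compl₂ g (J v)) u).trans
      (congrArg Neg.neg (h.contract_form_J_J hN v u :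
        gContract g (fun X Y => g X (J v (J u Y))) = _))
  have e2 : gContract g (fun X Y => g (T s (J v Y)) (J t X)) =
      -gContract g (fun X Y => g (T s X) (J t (J v Y))) := by
    rw [gContract_swap h.symm (fun X Y => g (T s (J v X)) (J t Y))]
    exact h.contract_J (LinearMap.compl₂ (LinearMap.comp g (T s)) (J t)) v
  have e3 : gContract g (fun X Y => g (T s X) (J t (J v Y))) =
      if v = t then pqSign t * gContract g (fun X Y => g (T s X) Y) else 0 := by
    split_ifs with hvt
    · subst hvt
      simp only [h.sq, map_smul, smul_eq_mul, gContract_mul]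
    · obtain ⟨a, w, e⟩ := h.exists_mul (u := t) (v := v) (fun e => hvt e.symm)
      simp only [e, map_smul, smul_eq_mul, gContract_mul, hT, mul_zero]
  have e2' : gContract g (fun X Y => g (T s (J v Y)) (J t X)) =
      if v = t then -(pqSign t * gContract g (fun X Y => g (T s X) Y)) else 0 := by
    rw [e2, e3]; split_ifs <;> simp
  have e4 : gContract g (fun X Y => ∑ u, pqSign u * g (J u X) (J v Y) * S t u s) = -N * S t v s := by
    have q := pqSign_mul_self v
    have e : gContract g (fun X Y => ∑ u, pqSign u * g (J u X) (J v Y) * S t u s) =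
        ∑ u, pqSign u * -(if v = u then pqSign v * N else 0) * S t u s := by
      simp only [Fin.sum_univ_three, gContract_add, gContract_mul, gContract_mul_right, e1]
    rw [e]
    simp only [mul_neg, neg_mul, mul_ite, ite_mul, mul_zero, zero_mul, Finset.sum_neg_distrib,
      Finset.sum_ite_eq, Finset.mem_univ, if_true]
    linear_combination (-N * S t v s) * q
  rw [gContract_sub, gContract_mul, gContract_mul, gContract_sub, e2', e4, e3]
  have q := pqSign_mul_self t
  split_ifs
  · linear_combination 4 * gContract g (fun X Y => g (T s X) Y) * q
  · ring

include hN0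

/-- In the application `S t a b` is `η_t(T(ξ_a, ξ_b))`, `K t s` is `η_t(R(·, ·) ξ_s)`, and `σ` turns
out to be `λ`. The traces of `K i i = 0` kill `tr T_i` and the components of `S` with a repeated
index. Each `ρ_j` occurs in both `K k i` and `K i k`, and computing its trace in these two ways ties
the remaining components of `S` to a single number. -/
theorem ricci_forms (S : Fin 3 → Fin 3 → Fin 3 → ℝ) (hS : ∀ t a b, S t a b = -S t b a)
    (hT : ∀ s u, gContract g (fun X Y => g (T s X) (J u Y)) = 0)
    (K : Fin 3 → Fin 3 → W → W → ℝ) (ρ : Fin 3 → W → W → ℝ)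
    (hK : ∀ t s X Y, K t s X Y = -2 * (∑ u, pqSign u * g (J u X) Y * S t u s) -
      2 * pqSign t * (g (T s Y) (J t X) - g (T s X) (J t Y)))
    (hρ : ∀ i j k, IsCyclic3 i j k → ∀ X Y, K i i X Y = 0 ∧ K k i X Y = 2 * pqSign i * ρ j X Y ∧
      K j i X Y = -2 * pqSign i * ρ k X Y) :
    (∀ s, gContract g (fun X Y => g (T s X) Y) = 0) ∧
    ∃ σ : ℝ, ∀ i j k, IsCyclic3 i j k →
      (S i i j = 0 ∧ S i k i = 0 ∧ S i j k = pqSign i * σ) ∧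
      gContract g (fun X Y => ρ i X (J i Y)) = N * pqSign i * σ ∧
      ∀ X Y, g (T i Y) (J i X) = g (T i X) (J i Y) ∧
        ρ i X Y + σ * g (J i X) Y = pqSign i * (g (T k Y) (J j X) - g (T k X) (J j Y)) ∧
        ρ i X Y + σ * g (J i X) Y = -pqSign i * (g (T j Y) (J k X) - g (T j X) (J k Y)) := by
  have tr (t s v) : gContract g (fun X Y => K t s X (J v Y)) =
      2 * N * S t v s + if v = t then 4 * gContract g (fun X Y => g (T s X) Y) else 0 := by
    simp only [hK]; exact h.trace_mixed hN S t s v hT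
  have hSs (t a) : S t a a = 0 := by have := hS t a a; linarith
  have t0 (s) : gContract g (fun X Y => g (T s X) Y) = 0 := by
    have e := tr s s s
    simp only [(hρ s _ _ (IsCyclic3.of s) _ _).1, gContract_zero, hSs, if_true] at e
    linarith
  simp only [t0, mul_zero, ite_self, add_zero] at tr
  have S0 {i j k} (c : IsCyclic3 i j k) : S i i j = 0 ∧ S i k i = 0 := by
    have e1 := tr i i j
    have e2 := tr i i k
    simp only [(hρ i _ _ c _ _).1, gContract_zero] at e1 e2
    have a1 : S i j i = 0 := by
      rcases mul_eq_zero.1 e1.symm with e | e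
      · linarith
      · exact e
    refine ⟨by rw [hS, a1, neg_zero], ?_⟩
    rcases mul_eq_zero.1 e2.symm with e | e
    · linarith
    · exact e
  have r1 {i j k} (c : IsCyclic3 i j k) :
      gContract g (fun X Y => ρ j X (J j Y)) = N * (pqSign i * S k j i) := by
    have e := tr k i j
    simp only [(hρ i _ _ c _ _).2.1, gContract_mul] at e
    have := pqSign_mul_self i
    linear_combination (pqSign i / 2) * e - gContract g (fun X Y => ρ j X (J j Y)) * this
  have r2 {i j k} (c : IsCyclic3 i j k) :
      gContract g (fun X Y => ρ k X (J k Y)) = -N * (pqSign i * S j k i) := by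
    have e := tr j i k
    simp only [(hρ i _ _ c _ _).2.2, gContract_mul] at e
    have := pqSign_mul_self i
    linear_combination -(pqSign i / 2) * e - gContract g (fun X Y => ρ k X (J k Y)) * this
  have S1 {i j k} (c : IsCyclic3 i j k) : pqSign j * S i j k = pqSign i * S j k i := by
    have e := (r1 c.rot).symm.trans (r2 c)
    rw [hS i k j] at e
    exact mul_left_cancel₀ hN0.ne' (by linarith)
  have S2 {i j k} (c : IsCyclic3 i j k) : pqSign i * S i j k = pqSign j * S j k i := by
    have := S1 c
    rcases c.signs with ⟨e1, e2, e3⟩ | ⟨e1, e2, e3⟩ | ⟨e1, e2, e3⟩ <;>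
    simp only [e1, e2] at this ⊢ <;> linarith
  have S3 {i j k} (c : IsCyclic3 i j k) : pqSign i * S i j k = pqSign 0 * S 0 1 2 := by
    have q := S2 (IsCyclic3.of 0)
    have q' := S2 (IsCyclic3.of 0).rot
    obtain ⟨rfl, rfl⟩ := c
    fin_cases i
    · rfl
    · exact q.symm
    · exact (q.trans q').symm
  have S4 {i j k} (c : IsCyclic3 i j k) : S i j k = pqSign i * (pqSign 0 * S 0 1 2) := by
    rw [← S3 c, ← mul_assoc, pqSign_mul_self, one_mul]
  refine ⟨t0, pqSign 0 * S 0 1 2, fun i j k c => ⟨⟨(S0 c).1, (S0 c).2, S4 c⟩, ?_, fun X Y => ?_⟩⟩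
  · rw [r1 c.rot.rot, hS j i k, S4 c.rot]
    rcases c.signs with ⟨e1, e2, e3⟩ | ⟨e1, e2, e3⟩ | ⟨e1, e2, e3⟩ <;>
    simp only [e1, e2, e3] <;> ring
  · have k1 := (hρ i j k c X Y).1
    have k2 := (hρ _ _ _ c.rot.rot X Y).2.1
    have k3 := (hρ _ _ _ c.rot X Y).2.2
    rw [hK, c.sum_eq] at k1 k2 k3
    rw [hS i j i, (S0 c).1, (S0 c).2, hSs] at k1
    rw [hS j i k, S4 c.rot, (S0 c.rot).1, hSs] at k2
    rw [S4 c.rot.rot, hS k k j, (S0 c.rot.rot).2, hSs] at k3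
    rcases c.signs with ⟨e1, e2, e3⟩ | ⟨e1, e2, e3⟩ | ⟨e1, e2, e3⟩ <;>
    simp only [e1, e2, e3] at k1 k2 k3 ⊢ <;> refine ⟨?_, ?_, ?_⟩ <;> linarith


/-- The trace of the horizontal first Bianchi identity computes the scalar curvature. -/
theorem scalar_curvature (hT : ∀ s u, gContract g (fun X Y => g (T s X) (J u Y)) = 0)
    (R : W →ₗ[ℝ] W →ₗ[ℝ] W →ₗ[ℝ] W) (ρ : Fin 3 → W →ₗ[ℝ] W →ₗ[ℝ] ℝ) (σ : ℝ)
    (hR : ∀ Z X Y, R Z X Y = -R Z Y X)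
    (hJ : ∀ i j k, IsCyclic3 i j k → ∀ X Y Z, R (J i Z) X Y - J i (R Z X Y) =
      (2 * pqSign i * ρ j X Y) • J k Z + (-2 * pqSign i * ρ k X Y) • J j Z)
    (hρ : ∀ s X Y, gContract g (fun Z Z' => g (R Z X Y) (J s Z')) = N * ρ s X Y)
    (hσ : ∀ s, gContract g (fun X Y => ρ s X (J s Y)) = N * pqSign s * σ)
    (hB : ∀ X Y Z, R Z X Y + R X Y Z + R Y Z X = (-2 : ℝ) • ∑ s, pqSign s • (
      g (J s X) Y • T s Z + g (J s Y) Z • T s X + g (J s Z) X • T s Y)) :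
    2 * gContract g (fun B C => gContract g (fun X Y => g (R C X B) Y)) = N * (N + 8) * σ := by
  have c := IsCyclic3.of 0
  simp only [zero_add] at c
  set ric : W →ₗ[ℝ] W →ₗ[ℝ] ℝ := gContract g (fun X Y => ((R.flip X).compr₂ (g.flip Y)).flip)
    with hric
  have ric_apply (B C) : ric B C = gContract g (fun X Y => g (R C X B) Y) := by
    simp [hric, gContract, LinearMap.sum_apply]
  have tl (L : W →ₗ[ℝ] ℝ) (Z : W) : gContract g (fun X Y => g Z X * L Y) = L Z :=
    gContract_left h.symm h.nondegenerate L Z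
  have tl' (s u) (X Z : W) : gContract g (fun Z₁ Z₂ => g Z Z₁ * g (T s X) (J u Z₂)) =
      g (T s X) (J u Z) := tl ((g (T s X)).comp (J u)) Z
  have tr (s) (X Z : W) : gContract g (fun Z₁ Z₂ => ρ s Z₁ X * g Z Z₂) = ρ s Z X := by
    have := gContract_right h.symm h.nondegenerate ((ρ s).flip X) Z
    simpa only [LinearMap.flip_apply, mul_comm] using this
  have s0 : pqSign 0 = 1 := rfl
  -- The horizontal Bianchi identity contracted over `Z` against `J_0`. The first curvature term is
  -- a Ricci form. In the other two, `J_0` is moved onto the vector on which `R` acts; this gives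
  -- `ric` and, from the commutators, `ρ_1` and `ρ_2`.
  have key (X Y : W) : N * ρ 0 X Y + (ric Y (J 0 X) - 2 * (ρ 1 (J 2 X) Y - ρ 2 (J 1 X) Y)) -
      (ric X (J 0 Y) - 2 * (ρ 1 (J 2 Y) X - ρ 2 (J 1 Y) X)) =
      -2 * ∑ s, pqSign s * (g (T s X) (J 0 (J s Y)) - g (T s Y) (J 0 (J s X))) := by
    have e2 (X Y Z Z' : W) : g (R X Y Z) (J 0 Z') = g (R (J 0 X) Z Y) Z' -
        2 * (ρ 1 Z Y * g (J 2 X) Z' - ρ 2 Z Y * g (J 1 X) Z') := by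
      have e := congrArg (fun v => g v Z') (hJ 0 1 2 c Z Y X)
      simp only [map_sub, map_add, map_smul, LinearMap.sub_apply, LinearMap.add_apply,
        LinearMap.smul_apply, smul_eq_mul, h.skew, s0] at e
      rw [hR X Y Z, map_neg, LinearMap.neg_apply]
      simp only [h.skew]
      linarith
    have e : gContract g (fun Z Z' => g (R Z X Y + R X Y Z + R Y Z X) (J 0 Z')) =
      gContract g (fun Z Z' => g ((-2 : ℝ) • ∑ s, pqSign s • (
      g (J s X) Y • T s Z + g (J s Y) Z • T s X + g (J s Z) X • T s Y)) (J 0 Z')) := by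
      simp only [hB]
    have e5 (s) (Z : W) : g (J s Z) X = -g (J s X) Z := by rw [h.skew, h.symm (J s X)]
    simp only [map_add, LinearMap.add_apply, gContract_add, hρ] at e
    simp only [hR Y _ X, map_add, LinearMap.add_apply, gContract_add, map_neg,
      LinearMap.neg_apply, gContract_neg, e2, gContract_sub, gContract_mul, tr, ← ric_apply,
      map_smul, LinearMap.smul_apply, smul_eq_mul, Fin.sum_univ_three, e5, hT, tl', neg_mul] at e
    simp only [Fin.sum_univ_three]
    linarith
  have tric : gContract g (fun X Y => ric (J 0 Y) (J 0 X)) = -gContract g (fun X Y => ric X Y) := by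
    rw [gContract_swap h.symm (fun X Y => ric (J 0 X) (J 0 Y))]
    refine (h.contract_J (LinearMap.compl₂ ric (J 0)) 0).trans ?_
    simp [h.sq, s0]
  have tρ (s u : Fin 3) : gContract g (fun X Y => ρ s (J u X) (J 0 Y)) =
      -gContract g (fun X Y => ρ s X (J 0 (J u Y))) :=
    h.contract_J (LinearMap.compl₂ (ρ s) (J 0)) u
  have tρ' (s u : Fin 3) : gContract g (fun X Y => ρ s (J u Y) X) =
      -gContract g (fun X Y => ρ s X (J u Y)) := by
    rw [gContract_swap h.symm (fun X Y => ρ s (J u X) Y)]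
    exact h.contract_J (ρ s) u
  have tT (s u v) : gContract g (fun X Y => g (T s (J u Y)) (J v X)) =
      -gContract g (fun X Y => g (T s X) (J v (J u Y))) := by
    rw [gContract_swap h.symm (fun X Y => g (T s (J u X)) (J v Y))]
    exact h.contract_J (LinearMap.compl₂ (LinearMap.comp g (T s)) (J v)) u
  have m01 (X) : J 0 (J 1 X) = J 2 X := by simpa [pqSign] using h.mul 0 X
  have m02 (X) : J 0 (J 2 X) = J 1 X := by simpa [pqSign] using h.mul_swap 2 X
  have m10 (X) : J 1 (J 0 X) = -J 2 X := by simpa [pqSign] using h.mul_swap 0 X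
  have m20 (X) : J 2 (J 0 X) = -J 1 X := by simpa [pqSign] using h.mul 2 X
  have m00 (X) : J 0 (J 0 X) = X := by simpa [pqSign] using h.sq 0 X
  -- The second trace, with `J_0 Y` in place of `Y`. Every torsion term becomes a contraction of
  -- `T_s` with a multiple of one `J_w` and so vanishes.
  have fin : gContract g (fun X Y => N * ρ 0 X (J 0 Y) +
      (ric (J 0 Y) (J 0 X) - 2 * (ρ 1 (J 2 X) (J 0 Y) - ρ 2 (J 1 X) (J 0 Y))) -
      (ric X (J 0 (J 0 Y)) - 2 * (ρ 1 (J 2 (J 0 Y)) X - ρ 2 (J 1 (J 0 Y)) X))) =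
      gContract g (fun X Y => -2 * ∑ s, pqSign s *
        (g (T s X) (J 0 (J s (J 0 Y))) - g (T s (J 0 Y)) (J 0 (J s X)))) := by simp only [key]
  simp only [Fin.sum_univ_three, gContract_add, gContract_sub, gContract_mul, tρ, tρ', tric, m00,
    m01, m02, m10, m20, hσ, map_neg, LinearMap.neg_apply, gContract_neg, hT] at fin
  have tT0 (s v) (hv : v ≠ 0) : gContract g (fun X Y => g (T s (J 0 Y)) (J v X)) = 0 := by
    rw [tT]
    obtain ⟨a, w, e⟩ := h.exists_mul hv
    simp only [e, map_smul, smul_eq_mul, gContract_mul, hT, mul_zero, neg_zero]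
  have tT1 (s) : gContract g (fun X Y => g (T s (J 0 Y)) X) = 0 := by
    rw [gContract_swap h.symm (fun X Y => g (T s (J 0 X)) Y)]
    exact (h.contract_J (LinearMap.comp g (T s)) 0).trans (by
      rw [neg_eq_zero]; exact hT s 0)
  rw [tT1, tT0 _ 2 (by decide), tT0 _ 1 (by decide)] at fin
  simp only [← ric_apply]
  simp only [pqSign, Matrix.cons_val_zero, Matrix.cons_val_one, Matrix.cons_val] at fin
  linarith

end IsParaquaternionic

end Algebra

/-! ### Orthogonality to `sp(n, ℝ)` and the Ricci forms in terms of `τ` and `μ`. -/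

section Algebra

variable {W : Type*} [AddCommGroup W] [Module ℝ W] [FiniteDimensional ℝ W]

namespace IsParaquaternionic

variable {g : LinearMap.BilinForm ℝ W} {J : Fin 3 → W →ₗ[ℝ] W} (h : IsParaquaternionic g J)
include h

/-- A skew endomorphism orthogonal to the centralizer `sp(n, ℝ)`. -/
theorem orthogonal_sp (T : W →ₗ[ℝ] W)
    (hT : ∀ B : W →ₗ[ℝ] W, (∀ X Y, g (B X) Y = -g X (B Y)) → (∀ t X, B (J t X) = J t (B X)) →
      gContract g (fun X Y => g (T X) (B Y)) = 0) (X Y : W) :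
    g (T X) Y - g (T Y) X = ∑ u, pqSign u * (g (T (J u X)) (J u Y) - g (T (J u Y)) (J u X)) := by
  let b : W → W → W →ₗ[ℝ] W := fun X Y => (g X).smulRight Y - (g Y).smulRight X
  have hb (X Y Z) : b X Y Z = g X Z • Y - g Y Z • X := rfl
  -- `B` is the sum of the conjugates of the skew map `b X Y` by the identity and the three `J_u`,
  -- since `J_u (b X Y) J_u⁻¹ = -ε_u b (J_u X) (J_u Y)`. It is therefore skew and commutes with
  -- every `J_t`.
  let B : W →ₗ[ℝ] W := b X Y - ∑ u, pqSign u • b (J u X) (J u Y)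
  have hB (Z) : B Z = g X Z • Y - g Y Z • X -
      ∑ u, pqSign u • (g (J u X) Z • J u Y - g (J u Y) Z • J u X) := by
    simp [B, hb, LinearMap.sum_apply]
  have e := hT B (fun Z Z' => ?_) (fun t Z => ?_)
  · have l (U V : W) : gContract g (fun Z Z' => g (T Z) V * g U Z') = g (T U) V := by
      have := gContract_right h.symm h.nondegenerate ((g.flip V).comp T) U
      simpa [mul_comm] using this
    have l (U V : W) : gContract g (fun Z Z' => g U Z' * g (T Z) V) = g (T U) V := by
      have := gContract_right h.symm h.nondegenerate ((g.flip V).comp T) U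
      simpa [mul_comm] using this
    simp only [hB, Fin.sum_univ_three, map_sub, map_add, map_smul, smul_eq_mul, gContract_add,
      gContract_sub, gContract_mul, l] at e
    simp only [Fin.sum_univ_three]
    linarith
  · simp only [hB, Fin.sum_univ_three, map_sub, map_add, map_smul, smul_eq_mul, LinearMap.add_apply,
      LinearMap.sub_apply, LinearMap.smul_apply]
    simp only [h.symm Z]
    ring
  · have c := IsCyclic3.of t
    simp only [hB, c.sum_eq, map_sub, map_add, map_smul, h.sq, h.mul_ij c, h.mul_ji c,
      h.mul_ij c.rot.rot, h.mul_ji c.rot.rot, h.skew, map_neg, smul_eq_mul]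
    rcases c.signs with ⟨e1, e2, e3⟩ | ⟨e1, e2, e3⟩ | ⟨e1, e2, e3⟩ <;>
    simp only [e1, e2, e3] <;> module

variable (T : Fin 3 → W →ₗ[ℝ] W)

/-- The torsion tensors `τ` and `μ` determine the trace-free Ricci forms. -/
theorem ricci_forms_torsion
    (hperp : ∀ s X Y, g (T s X) Y - g (T s Y) X =
      ∑ u, pqSign u * (g (T s (J u X)) (J u Y) - g (T s (J u Y)) (J u X)))
    (r : Fin 3 → W → W → ℝ)
    (h1 : ∀ i j k, IsCyclic3 i j k → ∀ X Y, g (T i Y) (J i X) = g (T i X) (J i Y) ∧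
        r i X Y = pqSign i * (g (T k Y) (J j X) - g (T k X) (J j Y)) ∧
        r i X Y = -pqSign i * (g (T j Y) (J k X) - g (T j X) (J k Y)))
    (τ : W → W → ℝ) (hτ : ∀ X Y, τ X Y = -∑ s, pqSign s *
      ((g (T s (J s X)) Y + g (T s Y) (J s X)) / 2))
    (μ : Fin 3 → W → W → ℝ) (hμ : ∀ s X Y, μ s X Y = pqSign s *
      ((g (T s (J s X)) Y - g (T s Y) (J s X)) / 2)) (s t : Fin 3) (X Y : W) :
    r s X Y = (τ X (J s Y) - τ (J s X) Y) / 2 + 2 * μ t X (J s Y) := by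
  -- symmetric and skew parts
  set t0 : Fin 3 → W → W → ℝ := fun s X Y => (g (T s X) Y + g (T s Y) X) / 2 with ht0
  set ta : Fin 3 → W → W → ℝ := fun s X Y => (g (T s X) Y - g (T s Y) X) / 2 with hta
  have dec (s X Y) : g (T s X) Y = t0 s X Y + ta s X Y := by simp only [ht0, hta]; ring
  have t0s (s X Y) : t0 s X Y = t0 s Y X := by simp only [ht0]; ring
  have tas (s X Y) : ta s X Y = -ta s Y X := by simp only [hta]; ring
  have t0m (s) (a : ℝ) (X Y) : t0 s X (a • Y) = a * t0 s X Y := by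
    simp only [ht0, map_smul, LinearMap.smul_apply, smul_eq_mul]; ring
  have tam (s) (a : ℝ) (X Y) : ta s X (a • Y) = a * ta s X Y := by
    simp only [hta, map_smul, LinearMap.smul_apply, smul_eq_mul]; ring
  have t0n (s) (X Y) : t0 s X (-Y) = -t0 s X Y := by
    simp only [ht0, map_neg, LinearMap.neg_apply]; ring
  have tan (s) (X Y) : ta s X (-Y) = -ta s X Y := by
    simp only [hta, map_neg, LinearMap.neg_apply]; ring
  have qs := pqSign_mul_self
  -- behaviour under `J`
  have J0 (s X Y) : t0 s (J s X) Y = t0 s X (J s Y) := by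
    have e1 := (h1 s _ _ (IsCyclic3.of s) X Y).1
    have e2 := (h1 s _ _ (IsCyclic3.of s) (J s X) (J s Y)).1
    simp only [h.sq, map_smul, smul_eq_mul] at e2
    have e3 : g (T s (J s Y)) X = g (T s (J s X)) Y := by
      linear_combination pqSign s * e2 - (g (T s (J s Y)) X - g (T s (J s X)) Y) * qs s
    simp only [ht0]; linarith
  have Jas (s X Y) : ta s (J s X) Y = -ta s X (J s Y) := by
    have e1 := (h1 s _ _ (IsCyclic3.of s) X Y).1
    have e2 := (h1 s _ _ (IsCyclic3.of s) (J s X) (J s Y)).1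
    simp only [h.sq, map_smul, smul_eq_mul] at e2
    have e3 : g (T s (J s Y)) X = g (T s (J s X)) Y := by
      linear_combination pqSign s * e2 - (g (T s (J s Y)) X - g (T s (J s X)) Y) * qs s
    simp only [hta]; linarith
  have perp (s X Y) : ta s X Y = ∑ u, pqSign u * ta s (J u X) (J u Y) := by
    have e := hperp s X Y
    simp only [Fin.sum_univ_three] at e ⊢
    simp only [hta]; linarith
  have t0m' (s) (a : ℝ) (X Y) : t0 s (a • X) Y = a * t0 s X Y := by rw [t0s, t0m, t0s]
  have tam' (s) (a : ℝ) (X Y) : ta s (a • X) Y = a * ta s X Y := by rw [tas, tam, tas]; ring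
  have t0n' (s) (X Y) : t0 s (-X) Y = -t0 s X Y := by rw [t0s, t0n, t0s]
  have tan' (s) (X Y) : ta s (-X) Y = -ta s X Y := by rw [tas, tan, tas, neg_neg]
  -- Orthogonality to `sp(n, ℝ)` makes the skew part of `T_i` anticommute with `J_j` and `J_k`.
  have Jaj {i j k} (c : IsCyclic3 i j k) (X Y) :
      ta i (J j X) Y = ta i X (J j Y) ∧ ta i (J k X) Y = ta i X (J k Y) := by
    have sqi (X Y) : ta i (J i X) (J i Y) = -(pqSign i * ta i X Y) := by
      rw [Jas, h.sq, tam]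
    have sqk (X Y) : ta i (J k X) (J k Y) = -(pqSign i * ta i (J j X) (J j Y)) := by
      have e := sqi (J j X) (J j Y)
      rw [h.mul_ij c, h.mul_ij c, tan, tan', tam, tam', neg_neg, ← mul_assoc, qs, one_mul] at e
      exact e
    have sqj (X Y) : ta i (J j X) (J j Y) = pqSign j * ta i X Y := by
      have e := perp i X Y
      rw [c.sum_eq, sqi, sqk] at e
      rcases c.signs with ⟨e1, e2, e3⟩ | ⟨e1, e2, e3⟩ | ⟨e1, e2, e3⟩ <;>
      simp only [e1, e2, e3] at e ⊢ <;> linarith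
    have fj := sqj X (J j Y)
    have fk := sqk X (J k Y)
    rw [sqj] at fk
    rw [h.sq, tam] at fj fk
    rcases c.signs with ⟨e1, e2, e3⟩ | ⟨e1, e2, e3⟩ | ⟨e1, e2, e3⟩ <;>
    simp only [e1, e2, e3] at fj fk ⊢ <;> constructor <;> linarith
  -- The two expressions for `r i` agree at `(X, Y)` and at `(J_j X, J_j Y)`. The symmetric and skew
  -- contributions transform with opposite signs under this substitution, so the equality splits
  -- into one for each.
  have key {i j k} (c : IsCyclic3 i j k) (X Y) : ta j X (J k Y) = -ta k X (J j Y) ∧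
      t0 j Y (J k X) - t0 j X (J k Y) = -(t0 k Y (J j X) - t0 k X (J j Y)) ∧
      r i X Y = pqSign i * (t0 k Y (J j X) - t0 k X (J j Y) - 2 * ta k X (J j Y)) := by
    have e1 (X Y) : r i X Y = pqSign i * (t0 k Y (J j X) - t0 k X (J j Y) - 2 * ta k X (J j Y)) := by
      rw [(h1 i j k c X Y).2.1, dec, dec, tas k Y, (Jaj c.rot.rot X Y).2]; ring
    have e2 (X Y) : r i X Y =
        -pqSign i * (t0 j Y (J k X) - t0 j X (J k Y) - 2 * ta j X (J k Y)) := by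
      rw [(h1 i j k c X Y).2.2, dec, dec, tas j Y, (Jaj c.rot X Y).1]; ring
    have f := (e1 X Y).symm.trans (e2 X Y)
    have f' := (e1 (J j X) (J j Y)).symm.trans (e2 (J j X) (J j Y))
    simp only [h.sq, t0m, tam, (Jaj c.rot.rot _ _).2, J0, Jas, h.mul_ji c.rot,
      h.mul_ji c, t0s k (J j _)] at f'
    refine ⟨?_, ?_, e1 X Y⟩ <;>
    rcases c.signs with ⟨e1, e2, e3⟩ | ⟨e1, e2, e3⟩ | ⟨e1, e2, e3⟩ <;>
    simp only [e1, e2, e3] at f f' ⊢ <;> linarith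
  have hτ' (X Y) : τ X Y = -∑ s, pqSign s * t0 s (J s X) Y := hτ X Y
  have hμ' (s X Y) : μ s X Y = pqSign s * ta s (J s X) Y := hμ s X Y
  have hμn (s X Y) : μ s X (-Y) = -μ s X Y := by rw [hμ', hμ', tan]; ring
  have hμm (s X) (a : ℝ) (Y) : μ s X (a • Y) = a * μ s X Y := by rw [hμ', hμ', tam]; ring
  have μk {i j k} (c : IsCyclic3 i j k) (X Y) :
      μ k X (J i Y) = pqSign k * pqSign j * ta k X (J j Y) := by
    rw [hμ', Jas, h.mul_ij c.rot.rot, tan, tam]; ring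
  have μj {i j k} (c : IsCyclic3 i j k) (X Y) :
      μ j X (J i Y) = pqSign k * pqSign j * ta k X (J j Y) := by
    rw [hμ', Jas, h.mul_ji c, tam, (key c X Y).1]; ring
  have μeq {i j k} (c : IsCyclic3 i j k) (X Y) : μ k X Y = μ j X Y := by
    have e := (μk c X (J i Y)).trans (μj c X (J i Y)).symm
    rw [h.sq, hμm, hμm] at e
    linear_combination pqSign i * e - (μ k X Y - μ j X Y) * qs i
  have c := IsCyclic3.of s
  have μt (X Y) : μ t X Y = μ (s + 2) X Y := by
    have a1 := μeq c X Y
    have a2 := μeq c.rot X Y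
    have a3 := μeq c.rot.rot X Y
    have : t = s ∨ t = s + 1 ∨ t = s + 2 := by clear * -; decide +revert
    rcases this with rfl | rfl | rfl
    · exact a2
    · exact a1.symm
    · rfl
  obtain ⟨-, e2, e3⟩ := key c X Y
  rw [μt, μk c, e3, hτ', hτ', c.sum_eq, c.sum_eq]
  simp only [J0, h.sq, t0m, t0m', t0n, t0n', h.mul_ji c, h.mul_ij c.rot.rot]
  rcases c.signs with ⟨e1, e2, e3⟩ | ⟨e1, e2, e3⟩ | ⟨e1, e2, e3⟩ <;>
  simp only [e1, e2, e3] <;> rw [t0s _ (J _ X), t0s _ (J _ X)] <;> linarith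

end IsParaquaternionic

end Algebra

/-! ### Evaluation of wedge products -/

section Wedge

theorem sum_perm_fin_succ {m : ℕ} (f : Equiv.Perm (Fin (m + 1)) → ℝ) :
    ∑ σ, f σ = ∑ i, ∑ τ : Equiv.Perm (Fin m), f (Equiv.Perm.decomposeFin.symm (i, τ)) := by
  rw [← Equiv.sum_comp Equiv.Perm.decomposeFin.symm, Fintype.sum_prod_type]

variable {W : Type*} [AddCommGroup W] [Module ℝ W] [TopologicalSpace W]

theorem wedge_apply {p q : ℕ} (a : W [⋀^Fin p]→L[ℝ] ℝ) (b : W [⋀^Fin q]→L[ℝ] ℝ)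
    (v : Fin (p + q) → W) : (a ⋏ b) v = (p.factorial * q.factorial : ℝ)⁻¹ *
      ∑ σ : Equiv.Perm (Fin (p + q)), (σ.sign : ℝ) * (a (fun i => v (σ (Fin.castAdd q i))) *
        b (fun i => v (σ (Fin.natAdd p i)))) := by
  rw [wedge, ContinuousAlternatingMap.smul_apply,
    ContinuousMultilinearMap.alternatization_apply_apply, smul_eq_mul]
  congr 1
  refine Finset.sum_congr rfl fun σ _ => ?_
  simp [formTensor_apply, Units.smul_def]

theorem form_one_eta (a : W [⋀^Fin 1]→L[ℝ] ℝ) (f : Fin 1 → W) : a f = a ![f 0] :=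
  congrArg a (by funext i; fin_cases i; rfl)

theorem form_two_eta (a : W [⋀^Fin 2]→L[ℝ] ℝ) (f : Fin 2 → W) : a f = a ![f 0, f 1] :=
  congrArg a (by funext i; fin_cases i <;> rfl)

theorem form_two_swap (a : W [⋀^Fin 2]→L[ℝ] ℝ) (X Y : W) : a ![X, Y] = -a ![Y, X] := by
  have := a.toAlternatingMap.map_swap ![Y, X] (i := 0) (j := 1) (by decide)
  refine Eq.trans ?_ this
  exact congrArg a (by funext i; fin_cases i <;> rfl)

/-- Permutations are sorted by the image of the first index, which selects the argument of the
1-form. The `q!` orderings of the other arguments contribute equally and cancel the normalization.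
The tuples `v` and `v'` differ only by the identification of `1 + q` with `q + 1`. -/
theorem wedge_one_left {q : ℕ} (a : W [⋀^Fin 1]→L[ℝ] ℝ) (b : W [⋀^Fin q]→L[ℝ] ℝ)
    (v : Fin (q + 1) → W) (v' : Fin (1 + q) → W) (hv : ∀ i, v' i = v (Fin.cast (add_comm 1 q) i)) :
    (a ⋏ b) v' = ∑ i : Fin (q + 1), (-1) ^ (i : ℕ) * (a ![v i] * b (i.removeNth v)) := by
  rw [wedge_apply]
  let c : Equiv.Perm (Fin (q + 1)) ≃ Equiv.Perm (Fin (1 + q)) :=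
    (finCongr (add_comm q 1)).permCongr
  rw [← Equiv.sum_comp c, sum_perm_fin_succ]
  have e (i : Fin (q + 1)) : ∑ τ : Equiv.Perm (Fin q),
      ((c (Equiv.Perm.decomposeFin.symm (i, τ))).sign : ℝ) *
        (a (fun m => v' (c (Equiv.Perm.decomposeFin.symm (i, τ)) (Fin.castAdd q m))) *
        b (fun m => v' (c (Equiv.Perm.decomposeFin.symm (i, τ)) (Fin.natAdd 1 m)))) =
      q.factorial * ((if i = 0 then 1 else -1) *
        (a ![v i] * b (fun m => v (Equiv.swap 0 i m.succ)))) := by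
    have e' (τ : Equiv.Perm (Fin q)) : ((c (Equiv.Perm.decomposeFin.symm (i, τ))).sign : ℝ) *
        (a (fun m => v' (c (Equiv.Perm.decomposeFin.symm (i, τ)) (Fin.castAdd q m))) *
        b (fun m => v' (c (Equiv.Perm.decomposeFin.symm (i, τ)) (Fin.natAdd 1 m)))) =
      (if i = 0 then 1 else -1) * (a ![v i] * b (fun m => v (Equiv.swap 0 i m.succ))) := by
      have h1 : (fun m => v' (c (Equiv.Perm.decomposeFin.symm (i, τ)) (Fin.castAdd q m))) =
          ![v i] := by
        funext m
        fin_cases m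
        rw [hv]
        have : Fin.cast (add_comm 1 q) (Fin.castAdd q (0 : Fin 1)) = 0 := by ext; rfl
        simp [c, this]
      have h2 : (fun m => v' (c (Equiv.Perm.decomposeFin.symm (i, τ)) (Fin.natAdd 1 m))) =
          (fun m => v (Equiv.swap 0 i m.succ)) ∘ τ := by
        funext m
        rw [hv]
        simp [c]
      have h3 := b.toAlternatingMap.map_perm (fun m => v (Equiv.swap 0 i m.succ)) τ
      have h4 : ((τ.sign : ℤ) : ℝ) * ((τ.sign : ℤ) : ℝ) = 1 := by
        rcases Int.units_eq_one_or τ.sign with h | h <;> simp [h]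
      rw [h1, h2]
      change _ * (_ * b.toAlternatingMap (_ ∘ τ)) = _
      rw [h3, Units.smul_def, zsmul_eq_mul, Equiv.Perm.sign_permCongr,
        Equiv.Perm.decomposeFin.symm_sign]
      change _ * (_ * (_ * b _)) = _
      split_ifs <;> push_cast
      · linear_combination (a ![v i] * b (fun m => v (Equiv.swap 0 i m.succ))) * h4
      · linear_combination -(a ![v i] * b (fun m => v (Equiv.swap 0 i m.succ))) * h4
    simp only [e', Finset.sum_const, Finset.card_univ, Fintype.card_perm, Fintype.card_fin,
      nsmul_eq_mul]
  simp only [e, ← Finset.mul_sum]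
  rw [Nat.factorial_one, Nat.cast_one, one_mul, inv_mul_cancel_left₀ (by positivity),
    Fin.sum_univ_succ, Fin.sum_univ_succ]
  refine congrArg₂ (· + ·) (by simp; left; rfl) ?_
  · refine Finset.sum_congr rfl fun i _ => ?_
    -- The transposition of `0` and `i + 1` leaves the remaining vectors out of order by the cycle
    -- `i.cycleRange` of sign `(-1)^i`. Together with the sign of the transposition this gives
    -- `(-1)^(i+1)`.
    have h5 : (fun m : Fin q => v (Equiv.swap 0 i.succ m.succ)) =
        (i.succ.removeNth v) ∘ i.cycleRange := by
      funext m
      simp [Fin.removeNth, Fin.succAbove_cycleRange]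
    have h6 := b.toAlternatingMap.map_perm (i.succ.removeNth v) i.cycleRange
    rw [h5, if_neg (Fin.succ_ne_zero i)]
    change _ * (_ * b.toAlternatingMap (_ ∘ _)) = _
    rw [h6, Units.smul_def, zsmul_eq_mul, Fin.sign_cycleRange]
    change _ * (_ * (_ * b _)) = _
    push_cast [Fin.val_succ]
    ring

theorem wedge_one_one (a b : W [⋀^Fin 1]→L[ℝ] ℝ) (v : Fin 2 → W) :
    (a ⋏ b) v = a ![v 0] * b ![v 1] - a ![v 1] * b ![v 0] := by
  rw [wedge_one_left a b v v (fun i => rfl), Fin.sum_univ_two, form_one_eta b,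
    form_one_eta b (Fin.removeNth 1 v)]
  simp [Fin.removeNth, sub_eq_add_neg]

theorem wedge_one_two (a : W [⋀^Fin 1]→L[ℝ] ℝ) (b : W [⋀^Fin 2]→L[ℝ] ℝ) (v : Fin 3 → W) :
    (a ⋏ b) v =
      a ![v 0] * b ![v 1, v 2] - a ![v 1] * b ![v 0, v 2] + a ![v 2] * b ![v 0, v 1] := by
  rw [wedge_one_left a b v v (fun i => rfl), Fin.sum_univ_three, form_two_eta b,
    form_two_eta b (Fin.removeNth 1 v), form_two_eta b (Fin.removeNth 2 v)]
  simp [Fin.removeNth, sub_eq_add_neg, Fin.succAbove, Fin.lt_def]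

theorem wedge_one_four (a : W [⋀^Fin 1]→L[ℝ] ℝ) (b : W [⋀^Fin 4]→L[ℝ] ℝ) (v : Fin 5 → W) :
    (a ⋏ b) v = a ![v 0] * b ![v 1, v 2, v 3, v 4] - a ![v 1] * b ![v 0, v 2, v 3, v 4] +
      a ![v 2] * b ![v 0, v 1, v 3, v 4] - a ![v 3] * b ![v 0, v 1, v 2, v 4] +
      a ![v 4] * b ![v 0, v 1, v 2, v 3] := by
  have e (w w' : Fin 4 → W) (h : w 0 = w' 0 ∧ w 1 = w' 1 ∧ w 2 = w' 2 ∧ w 3 = w' 3) :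
      b w = b w' := congrArg b (by funext i; fin_cases i <;> simp [h])
  rw [wedge_one_left a b v v (fun i => rfl), Fin.sum_univ_five,
    e (Fin.removeNth 0 v) ![v 1, v 2, v 3, v 4] ⟨rfl, rfl, rfl, rfl⟩,
    e (Fin.removeNth 1 v) ![v 0, v 2, v 3, v 4] ⟨rfl, rfl, rfl, rfl⟩,
    e (Fin.removeNth 2 v) ![v 0, v 1, v 3, v 4] ⟨rfl, rfl, rfl, rfl⟩,
    e (Fin.removeNth 3 v) ![v 0, v 1, v 2, v 4] ⟨rfl, rfl, rfl, rfl⟩,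
    e (Fin.removeNth 4 v) ![v 0, v 1, v 2, v 3] ⟨rfl, rfl, rfl, rfl⟩]
  simp [sub_eq_add_neg, pow_succ]

theorem decomposeFin_symm_apply_two {m : ℕ} (e : Equiv.Perm (Fin (m + 2))) (p : Fin (m + 3)) :
    (Equiv.Perm.decomposeFin.symm (p, e)) 2 = Equiv.swap 0 p (e 1).succ :=
  Equiv.Perm.decomposeFin_symm_apply_succ e p 1

theorem decomposeFin_symm_apply_three {m : ℕ} (e : Equiv.Perm (Fin (m + 3))) (p : Fin (m + 4)) :
    (Equiv.Perm.decomposeFin.symm (p, e)) 3 = Equiv.swap 0 p (e 2).succ :=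
  Equiv.Perm.decomposeFin_symm_apply_succ e p 2

theorem wedge_two_one (a : W [⋀^Fin 2]→L[ℝ] ℝ) (b : W [⋀^Fin 1]→L[ℝ] ℝ) (v : Fin 3 → W) :
    (a ⋏ b) v =
      a ![v 0, v 1] * b ![v 2] - a ![v 0, v 2] * b ![v 1] + a ![v 1, v 2] * b ![v 0] := by
  set A : W → W → ℝ := fun X Y => a ![X, Y] with hA
  have e (f : Fin 2 → W) : a f = A (f 0) (f 1) := form_two_eta a f
  have hs (X Y : W) : A X Y = -A Y X := form_two_swap a X Y
  set B : W → ℝ := fun X => b ![X] with hB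
  have eB (f : Fin 1 → W) : b f = B (f 0) := form_one_eta b f
  rw [wedge_apply]
  simp only [e, eB, sum_perm_fin_succ, Fin.sum_univ_succ, Fintype.sum_unique]
  simp [Equiv.Perm.decomposeFin_symm_apply_one, decomposeFin_symm_apply_two]
  rw [show Equiv.swap (0 : Fin 3) 1 2 = 2 by decide, show Equiv.swap (0 : Fin 3) 2 1 = 1 by decide,
    hs (v 1) (v 0), hs (v 2) (v 1), hs (v 2) (v 0)]
  ring

theorem wedge_two_two (a b : W [⋀^Fin 2]→L[ℝ] ℝ) (v : Fin 4 → W) :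
    (a ⋏ b) v = a ![v 0, v 1] * b ![v 2, v 3] - a ![v 0, v 2] * b ![v 1, v 3] +
      a ![v 0, v 3] * b ![v 1, v 2] + a ![v 1, v 2] * b ![v 0, v 3] -
      a ![v 1, v 3] * b ![v 0, v 2] + a ![v 2, v 3] * b ![v 0, v 1] := by
  set A : W → W → ℝ := fun X Y => a ![X, Y] with hA
  have e (f : Fin 2 → W) : a f = A (f 0) (f 1) := form_two_eta a f
  have hs (X Y : W) : A X Y = -A Y X := form_two_swap a X Y
  set B : W → W → ℝ := fun X Y => b ![X, Y] with hB
  have eB (f : Fin 2 → W) : b f = B (f 0) (f 1) := form_two_eta b f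
  have hsB (X Y : W) : B X Y = -B Y X := form_two_swap b X Y
  rw [wedge_apply]
  simp only [e, eB, sum_perm_fin_succ, Fin.sum_univ_succ, Fintype.sum_unique]
  simp [Equiv.Perm.decomposeFin_symm_apply_one, decomposeFin_symm_apply_two,
    decomposeFin_symm_apply_three]
  simp only [show Equiv.swap (0 : Fin 3) 1 2 = 2 by decide,
    show Equiv.swap (0 : Fin 3) 2 1 = 1 by decide,
    show (1 : Fin 3).succ = 2 by decide, show (2 : Fin 3).succ = 3 by decide,
    show Equiv.swap (0 : Fin 4) 1 2 = 2 by decide, show Equiv.swap (0 : Fin 4) 1 3 = 3 by decide,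
    show Equiv.swap (0 : Fin 4) 2 1 = 1 by decide, show Equiv.swap (0 : Fin 4) 2 3 = 3 by decide,
    show Equiv.swap (0 : Fin 4) 3 1 = 1 by decide, show Equiv.swap (0 : Fin 4) 3 2 = 2 by decide,
    show Equiv.swap (0 : Fin 4) 2 2 = 0 by decide, show Equiv.swap (0 : Fin 4) 3 3 = 0 by decide,
    hs (v 1) (v 0), hs (v 2) (v 1), hs (v 2) (v 0), hs (v 3) (v 0), hs (v 3) (v 1), hs (v 3) (v 2),
    hsB (v 1) (v 0), hsB (v 2) (v 1), hsB (v 2) (v 0), hsB (v 3) (v 0), hsB (v 3) (v 1),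
    hsB (v 3) (v 2)]
  ring

end Wedge

/-! ### Horizontal fields and the connection forms of a pqc structure -/

section PqcGeometry

open VectorField

variable {n : ℕ} {M : Type*} [TopologicalSpace M] [T2Space M] [ChartedSpace (PqcModel n) M]
  [IsManifold 𝓘(ℝ, PqcModel n) ∞ M]

/-- The function `f` is of class `C^∞`. -/
abbrev IsSmoothFn (f : M → ℝ) : Prop := ContMDiff 𝓘(ℝ, PqcModel n) 𝓘(ℝ, ℝ) ∞ f

namespace PqcStructure

variable {P : PqcStructure n M}

theorem mem_H_iff {x : M} {v : TangentSpace 𝓘(ℝ, PqcModel n) x} :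
    v ∈ P.H x ↔ ∀ s, P.η s x v = 0 := by
  simp [PqcStructure.H, horizontalSpace]

theorem η_of_mem {x : M} (X : P.H x) (s : Fin 3) : P.η s x X = 0 := mem_H_iff.1 X.2 s

theorem η_contMDiff (s : Fin 3) {X : Π x : M, TangentSpace 𝓘(ℝ, PqcModel n) x}
    (hX : IsSmoothField X) : IsSmoothFn (n := n) (fun x => P.η s x (X x)) := by
  have h := ContMDiff.clm_bundle_apply (E₂ := Bundle.Trivial M ℝ) (F₂ := ℝ) (b := fun x : M => x)
    (ϕ := fun x => P.η s x) (v := X) (P.η_smooth s) hX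
  intro x
  simpa using (Bundle.contMDiffAt_totalSpace.1 (h x)).2

theorem isParaquaternionic (P : PqcStructure n M) (x : M) :
    IsParaquaternionic (P.g x) (fun s => P.J s x) where
  symm := P.g_symm x
  nondegenerate := P.g_nondegenerate x
  sq s X := P.J_sq s x X
  mul i X := P.J_mul i x X
  mul_swap i X := P.J_mul_swap i x X
  compatible s X Y := P.g_compatible s x X Y

theorem exists_smoothField {x : M} (v : TangentSpace 𝓘(ℝ, PqcModel n) x) :
    ∃ Y : Π x : M, TangentSpace 𝓘(ℝ, PqcModel n) x, IsSmoothField Y ∧ Y x = v :=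
  ⟨coordField x (chartVec x v), coordField_contMDiff x _, coordField_self x v⟩

namespace Complement

variable (V : P.Complement)

theorem proj_coe (x : M) (v : TangentSpace 𝓘(ℝ, PqcModel n) x) :
    (V.proj x v : TangentSpace 𝓘(ℝ, PqcModel n) x) = v - ∑ s, P.η s x v • V.ξ s x := by
  change (ContinuousLinearMap.id ℝ (TangentSpace 𝓘(ℝ, PqcModel n) x) -
    ∑ s, (P.η s x).smulRight (V.ξ s x)) v = _
  simp

theorem proj_of_mem {x : M} {v : TangentSpace 𝓘(ℝ, PqcModel n) x} (hv : v ∈ P.H x) :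
    V.proj x v = ⟨v, hv⟩ := by
  apply Subtype.ext
  rw [proj_coe]
  simp [mem_H_iff.1 hv]

theorem proj_self {x : M} (X : P.H x) : V.proj x X = X := V.proj_of_mem X.2

theorem decomposition (x : M) (v : TangentSpace 𝓘(ℝ, PqcModel n) x) :
    v = (V.proj x v : TangentSpace 𝓘(ℝ, PqcModel n) x) + ∑ s, P.η s x v • V.ξ s x := by
  rw [proj_coe]; abel

theorem eq_of_mem_vertical {x : M} {v : TangentSpace 𝓘(ℝ, PqcModel n) x}
    (hv : v ∈ Submodule.span ℝ (Set.range fun t => V.ξ t x)) : v = ∑ t, P.η t x v • V.ξ t x := by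
  obtain ⟨a, rfl⟩ := (Submodule.mem_span_range_iff_exists_fun ℝ).1 hv
  simp [V.dual]

/-- The horizontal part of a vector field. -/
def hor (X : Π x : M, TangentSpace 𝓘(ℝ, PqcModel n) x) :
    Π x : M, TangentSpace 𝓘(ℝ, PqcModel n) x := fun x => V.proj x (X x)

theorem hor_eq (X : Π x : M, TangentSpace 𝓘(ℝ, PqcModel n) x) :
    V.hor X = X - ∑ s, (fun x => P.η s x (X x)) • V.ξ s := by
  funext x
  simp [hor, proj_coe]

theorem hor_isHorizontal {X : Π x : M, TangentSpace 𝓘(ℝ, PqcModel n) x} (hX : IsSmoothField X) :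
    P.IsHorizontalField (V.hor X) where
  smooth := by
    rw [hor_eq, Fin.sum_univ_three]
    have h (s) := ContMDiff.smul_section (P.η_contMDiff s hX) (V.ξ_smooth s)
    exact hX.sub_section (((h 0).add_section (h 1)).add_section (h 2))
  horizontal x := (V.proj x (X x)).2

include V in
theorem exists_horizontalField {x : M} (X : P.H x) :
    ∃ Y, P.IsHorizontalField Y ∧ Y x = X := by
  obtain ⟨Y, hY, e⟩ := exists_smoothField (X : TangentSpace 𝓘(ℝ, PqcModel n) x)
  exact ⟨V.hor Y, V.hor_isHorizontal hY, by rw [hor, e, proj_self]⟩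

include V in
theorem finrank_H (x : M) : Module.finrank ℝ (P.H x) = 4 * n := by
  let f : TangentSpace 𝓘(ℝ, PqcModel n) x →ₗ[ℝ] (Fin 3 → ℝ) :=
    LinearMap.pi fun s => (P.η s x).toLinearMap
  have hk : LinearMap.ker f = P.H x := by
    ext v
    simp [f, mem_H_iff, funext_iff]
  have hr : LinearMap.range f = ⊤ := by
    rw [LinearMap.range_eq_top]
    intro a
    refine ⟨∑ s, a s • V.ξ s x, ?_⟩
    funext t
    simp [f, V.dual]
  have h := LinearMap.finrank_range_add_finrank_ker f
  rw [hk, hr, finrank_top] at h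
  have e : Module.finrank ℝ (TangentSpace 𝓘(ℝ, PqcModel n) x) = 4 * n + 3 := by
    change Module.finrank ℝ (EuclideanSpace ℝ (Fin (4 * n + 3))) = _
    simp
  rw [e] at h
  simp at h
  omega

theorem gH_contMDiff {Y Z : Π x : M, TangentSpace 𝓘(ℝ, PqcModel n) x}
    (hY : P.IsHorizontalField Y) (hZ : P.IsHorizontalField Z) :
    IsSmoothFn (n := n) (fun x => V.gH x (Y x) (Z x)) := by
  have := P.g_smooth Y Z hY.horizontal hZ.horizontal hY.smooth hZ.smooth
  simpa only [gH, V.proj_of_mem (hY.horizontal _), V.proj_of_mem (hZ.horizontal _)] using this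

theorem JH_isHorizontal (s : Fin 3) {Y : Π x : M, TangentSpace 𝓘(ℝ, PqcModel n) x}
    (hY : P.IsHorizontalField Y) : P.IsHorizontalField (fun x => V.JH s x (Y x)) where
  smooth := by
    have := P.J_smooth s Y hY.horizontal hY.smooth
    simpa only [JH, V.proj_of_mem (hY.horizontal _)] using this
  horizontal x := (P.J s x (V.proj x (Y x))).2

end Complement

end PqcStructure

end PqcGeometry

/-! ### The matrix of connection forms and its skewness. -/

section PqcGeometry

open VectorField

variable {n : ℕ} {M : Type*} [TopologicalSpace M] [T2Space M] [ChartedSpace (PqcModel n) M]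
  [IsManifold 𝓘(ℝ, PqcModel n) ∞ M]

namespace PqcStructure.Complement

variable {P : PqcStructure n M} (V : P.Complement) (D : SmoothConnection (PqcModel n) M)

/-- The connection coefficients, `∇_v ξ_s = ∑ c_st(v) ξ_t`. -/
def coeff (s t : Fin 3) (x : M) (v : TangentSpace 𝓘(ℝ, PqcModel n) x) : ℝ :=
  P.η t x (D.cov (V.ξ s) x v)

variable {V D}

theorem IsCanonical.cov_ξ (hD : V.IsCanonical D) (s : Fin 3) (x : M)
    (v : TangentSpace 𝓘(ℝ, PqcModel n) x) :
    D.cov (V.ξ s) x v = ∑ t, V.coeff D s t x v • V.ξ t x :=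
  V.eq_of_mem_vertical (hD.preserves_V s x v)

theorem IsCanonical.nabla_isHorizontal (hD : V.IsCanonical D)
    {A Y : Π x : M, TangentSpace 𝓘(ℝ, PqcModel n) x} (hA : IsSmoothField A)
    (hY : P.IsHorizontalField Y) : P.IsHorizontalField (D.nabla A Y) :=
  ⟨D.nabla_contMDiff hA hY.smooth, fun x => hD.preserves_H Y hY x _⟩

theorem IsCanonical.cov_JH (hD : V.IsCanonical D) (s : Fin 3)
    {Y : Π x : M, TangentSpace 𝓘(ℝ, PqcModel n) x} (hY : P.IsHorizontalField Y) (x : M)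
    (v : TangentSpace 𝓘(ℝ, PqcModel n) x) :
    D.cov (fun y => V.JH s y (Y y)) x v =
      V.JH s x (D.cov Y x v) + ∑ t, V.coeff D s t x v • V.JH t x (Y x) := by
  simp only [coeff]
  rw [← hD.parallel s Y hY x v]; abel

theorem JH_add (s : Fin 3) (x : M) (u v : TangentSpace 𝓘(ℝ, PqcModel n) x) :
    V.JH s x (u + v) = V.JH s x u + V.JH s x v := by
  simp [JH]

theorem JH_smul (s : Fin 3) (x : M) (a : ℝ) (v : TangentSpace 𝓘(ℝ, PqcModel n) x) :
    V.JH s x (a • v) = a • V.JH s x v := by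
  simp [JH]

theorem JH_sum {ι : Type*} (T : Finset ι) (s : Fin 3) (x : M)
    (v : ι → TangentSpace 𝓘(ℝ, PqcModel n) x) :
    V.JH s x (∑ i ∈ T, v i) = ∑ i ∈ T, V.JH s x (v i) := by
  simp [JH, map_sum]

theorem JH_coe (s : Fin 3) {x : M} (X : P.H x) :
    V.JH s x X = (P.J s x X : TangentSpace 𝓘(ℝ, PqcModel n) x) := by
  rw [JH, proj_self]

theorem JH_JH (s t : Fin 3) {x : M} (v : TangentSpace 𝓘(ℝ, PqcModel n) x) :
    V.JH s x (V.JH t x v) = (P.J s x (P.J t x (V.proj x v)) : TangentSpace 𝓘(ℝ, PqcModel n) x) := by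
  rw [JH, JH, proj_self]

theorem JH_anticomm (s t : Fin 3) {x : M} {v : TangentSpace 𝓘(ℝ, PqcModel n) x} (hv : v ∈ P.H x) :
    V.JH s x (V.JH t x v) + V.JH t x (V.JH s x v) = (if s = t then 2 * pqSign s else 0) • v := by
  rw [JH_JH, JH_JH, V.proj_of_mem hv, ← Submodule.coe_add]
  split_ifs with h
  · subst h
    rw [P.J_sq]
    simp only [Submodule.coe_add, Submodule.coe_smul]
    module
  · have := (P.isParaquaternionic x).anticomm h ⟨v, hv⟩
    rw [this]; simp

theorem exists_ne_zero (hn : 0 < n) (V : P.Complement) (x : M) : ∃ X : P.H x, X ≠ 0 := by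
  have : 0 < Module.finrank ℝ (P.H x) := by rw [V.finrank_H]; omega
  exact Module.finrank_pos_iff_exists_ne_zero.1 this

/-- The `J_s` differentiate with the same coefficients as the `ξ_s`, so this is the derivative of
`J_s J_t + J_t J_s = 2 ε_s δ_st` applied to a nonzero horizontal vector, which exists because `n >
0`. -/
theorem IsCanonical.coeff_anticomm (hD : V.IsCanonical D) (hn : 0 < n) (s t : Fin 3) (x : M)
    (v : TangentSpace 𝓘(ℝ, PqcModel n) x) :
    pqSign s * V.coeff D t s x v + pqSign t * V.coeff D s t x v = 0 := by
  obtain ⟨X, hX⟩ := exists_ne_zero hn V x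
  obtain ⟨Y, hY, rfl'⟩ := V.exists_horizontalField X
  obtain ⟨A, hA, rfl⟩ := exists_smoothField v
  have e1 (s t) : D.cov (fun y => V.JH s y (V.JH t y (Y y))) x (A x) = _ :=
    hD.cov_JH s (V.JH_isHorizontal t hY) x (A x)
  simp only [hD.cov_JH _ hY] at e1
  have e2 : D.cov (fun y => V.JH s y (V.JH t y (Y y))) x (A x) +
      D.cov (fun y => V.JH t y (V.JH s y (Y y))) x (A x) =
      (if s = t then 2 * pqSign s else 0) • D.cov Y x (A x) := by
    have f1 := D.nabla_add_right (X := A) (V.JH_isHorizontal s (V.JH_isHorizontal t hY)).smooth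
      (V.JH_isHorizontal t (V.JH_isHorizontal s hY)).smooth
    have f2 := D.nabla_smul_right (X := A) (f := fun _ => if s = t then 2 * pqSign s else 0)
      contMDiff_const hY.smooth
    have f3 : ((fun y => V.JH s y (V.JH t y (Y y))) + (fun y => V.JH t y (V.JH s y (Y y))) :
        Π y : M, TangentSpace 𝓘(ℝ, PqcModel n) y) =
        (fun _ : M => if s = t then 2 * pqSign s else 0) • Y := by
      funext y
      exact JH_anticomm s t (hY.horizontal y)
    rw [f3, f2] at f1
    have := congrFun f1 x
    simp only [Pi.add_apply, Pi.smul_apply', lieD_const, zero_smul, add_zero] at this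
    exact this.symm
  rw [e1, e1] at e2
  have e3 := JH_anticomm (V := V) s t (hD.preserves_H Y hY x (A x))
  simp only [JH_add, JH_sum, JH_smul] at e2
  have e4 : (2 * (pqSign s * V.coeff D t s x (A x) + pqSign t * V.coeff D s t x (A x))) • Y x = 0 := by
    have a1 : ∑ u, V.coeff D t u x (A x) • (V.JH s x (V.JH u x (Y x)) + V.JH u x (V.JH s x (Y x))) =
        (2 * pqSign s * V.coeff D t s x (A x)) • Y x := by
      simp only [JH_anticomm _ _ (hY.horizontal x)]
      simp [smul_smul, mul_comm]
    have a2 : ∑ u, V.coeff D s u x (A x) • (V.JH t x (V.JH u x (Y x)) + V.JH u x (V.JH t x (Y x))) =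
        (2 * pqSign t * V.coeff D s t x (A x)) • Y x := by
      simp only [JH_anticomm _ _ (hY.horizontal x)]
      simp [smul_smul, mul_comm]
    simp only [smul_add, Finset.sum_add_distrib] at a1 a2
    rw [mul_add, add_smul, ← mul_assoc, ← mul_assoc, ← a1, ← a2]
    linear_combination (norm := module) e2 - e3
  rcases smul_eq_zero.1 e4 with e | e
  · linarith
  · exact absurd (Subtype.ext (rfl'.symm.trans e)) hX

theorem IsCanonical.coeff_self (hD : V.IsCanonical D) (hn : 0 < n) (s : Fin 3) (x : M)
    (v : TangentSpace 𝓘(ℝ, PqcModel n) x) : V.coeff D s s x v = 0 := by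
  have h := hD.coeff_anticomm hn s s x v
  have := pqSign_mul_self s
  linear_combination pqSign s / 2 * h - V.coeff D s s x v * this

theorem α_apply (s : Fin 3) (x : M) (v : TangentSpace 𝓘(ℝ, PqcModel n) x) :
    V.α D s x ![v] = V.coeff D (s + 2) (s + 1) x v := rfl

theorem coeff_ik {i j k : Fin 3} (c : IsCyclic3 i j k) (x : M)
    (v : TangentSpace 𝓘(ℝ, PqcModel n) x) : V.coeff D i k x v = V.α D j x ![v] := by
  obtain ⟨rfl, rfl⟩ := c
  rw [α_apply]
  fin_cases i <;> rfl

theorem IsCanonical.coeff_ij (hD : V.IsCanonical D) (hn : 0 < n) {i j k : Fin 3}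
    (c : IsCyclic3 i j k) (x : M) (v : TangentSpace 𝓘(ℝ, PqcModel n) x) :
    V.coeff D i j x v = pqSign k * V.α D k x ![v] := by
  have h := hD.coeff_anticomm hn i j x v
  rw [coeff_ik c.rot] at h
  rcases c.signs with ⟨e1, e2, e3⟩ | ⟨e1, e2, e3⟩ | ⟨e1, e2, e3⟩ <;>
  simp only [e1, e2, e3] at h ⊢ <;> linarith

/-- The forms `α_s` are the connection forms. -/
theorem IsCanonical.connection_forms (hD : V.IsCanonical D) (hn : 0 < n) {i j k : Fin 3}
    (c : IsCyclic3 i j k) :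
    (∀ Y, P.IsHorizontalField Y → ∀ x v,
        D.cov (fun y => V.JH i y (Y y)) x v - V.JH i x (D.cov Y x v) =
          V.α D j x ![v] • V.JH k x (Y x) + (pqSign k * V.α D k x ![v]) • V.JH j x (Y x)) ∧
      ∀ x v, D.cov (V.ξ i) x v =
        V.α D j x ![v] • V.ξ k x + (pqSign k * V.α D k x ![v]) • V.ξ j x := by
  refine ⟨fun Y hY x v => ?_, fun x v => ?_⟩
  · rw [hD.cov_JH i hY, c.sum_eq, hD.coeff_self hn, coeff_ik c, hD.coeff_ij hn c]
    module
  · rw [hD.cov_ξ, c.sum_eq, hD.coeff_self hn, coeff_ik c, hD.coeff_ij hn c]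
    module

/-! ### The exterior derivative of the contact forms -/

theorem _root_.PqcStructure.dη_apply (s : Fin 3) {X Y : Π x : M, TangentSpace 𝓘(ℝ, PqcModel n) x}
    (hX : IsSmoothField X) (hY : IsSmoothField Y) (x : M) :
    P.dη s x ![X x, Y x] = lieD X (fun y => P.η s y (Y y)) x - lieD Y (fun y => P.η s y (X y)) x -
      P.η s x (mlieBracket 𝓘(ℝ, PqcModel n) X Y x) :=
  formDeriv_oneForm (fun _ hZ => P.η_contMDiff s hZ) hX hY x

/-- `X (η_t(Y)) = η_t(∇_X Y) - ∑ η_s(Y) c_st(X)`. -/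
theorem IsCanonical.lieD_η (hD : V.IsCanonical D) (t : Fin 3)
    {X Y : Π x : M, TangentSpace 𝓘(ℝ, PqcModel n) x} (hY : IsSmoothField Y) (x : M) :
    lieD X (fun y => P.η t y (Y y)) x =
      P.η t x (D.nabla X Y x) - ∑ s, P.η s x (Y x) * V.coeff D s t x (X x) := by
  have h0 := V.hor_isHorizontal hY
  have h (s) := ContMDiff.smul_section (P.η_contMDiff s hY) (V.ξ_smooth s)
  -- The horizontal part of `Y` contributes nothing, as `∇` preserves `H`; only the product rule for
  -- the vertical part remains.
  have e : Y = V.hor Y + ∑ s, (fun y => P.η s y (Y y)) • V.ξ s := by rw [V.hor_eq]; abel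
  have e1 : D.nabla X Y = D.nabla X (V.hor Y) + ∑ s, ((fun y => P.η s y (Y y)) • D.nabla X (V.ξ s) +
      lieD X (fun y => P.η s y (Y y)) • V.ξ s) := by
    conv_lhs => rw [e]
    rw [D.nabla_add_right h0.smooth (by
      rw [Fin.sum_univ_three]; exact ((h 0).add_section (h 1)).add_section (h 2)),
      D.nabla_sum_right _ (fun s => h s)]
    congr 1
    exact Finset.sum_congr rfl fun s _ => D.nabla_smul_right (P.η_contMDiff s hY) (V.ξ_smooth s)
  have e2 := congrArg (P.η t x) (congrFun e1 x)
  have e3 : P.η t x (D.nabla X (V.hor Y) x) = 0 :=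
    mem_H_iff.1 (hD.preserves_H _ h0 x (X x)) t
  simp only [Pi.add_apply, Finset.sum_apply, Pi.smul_apply', map_add, map_sum, map_smul,
    smul_eq_mul, V.dual, e3, Finset.sum_add_distrib, mul_ite, mul_one, mul_zero,
    Finset.sum_ite_eq, Finset.mem_univ, if_true, zero_add] at e2
  rw [e2]
  simp only [coeff, SmoothConnection.nabla]
  ring

/-- `dη_t(u, v) = η_t(T(u, v)) + ∑ (η_s(u) c_st(v) - η_s(v) c_st(u))`. -/
theorem IsCanonical.dη_eq (hD : V.IsCanonical D) (t : Fin 3) (x : M)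
    (u v : TangentSpace 𝓘(ℝ, PqcModel n) x) :
    P.dη t x ![u, v] = P.η t x (D.cov.torsion x u v) +
      ∑ s, (P.η s x u * V.coeff D s t x v - P.η s x v * V.coeff D s t x u) := by
  obtain ⟨X, hX, rfl⟩ := exists_smoothField u
  obtain ⟨Y, hY, rfl⟩ := exists_smoothField v
  have e : D.cov.torsion x (X x) (Y x) = _ := congrFun (D.tor_eq hX hY) x
  rw [dη_apply t hX hY, hD.lieD_η t hY, hD.lieD_η t hX, e]
  simp only [Pi.sub_apply, map_sub, Finset.sum_sub_distrib]
  ring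

end PqcStructure.Complement

end PqcGeometry

/-! ### The curvature of the canonical connection -/

section PqcGeometry

open VectorField

variable {n : ℕ} {M : Type*} [TopologicalSpace M] [T2Space M] [ChartedSpace (PqcModel n) M]
  [IsManifold 𝓘(ℝ, PqcModel n) ∞ M]

/-- The definition extends `w` to a field. Linearity in `w` comes from the freedom to use any smooth
fields with the prescribed values. -/
theorem SmoothConnection.curvature_add_left (D : SmoothConnection (PqcModel n) M) (x : M)
    (w w' u v : TangentSpace 𝓘(ℝ, PqcModel n) x) :
    D.curvature x (w + w') u v = D.curvature x w u v + D.curvature x w' u v := by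
  obtain ⟨X, hX, rfl⟩ := PqcStructure.exists_smoothField u
  obtain ⟨Y, hY, rfl⟩ := PqcStructure.exists_smoothField v
  obtain ⟨W, hW, rfl⟩ := PqcStructure.exists_smoothField w
  obtain ⟨W', hW', rfl⟩ := PqcStructure.exists_smoothField w'
  rw [D.curvature_apply hX hY hW, D.curvature_apply hX hY hW',
    ← (D.curvatureOnFields_tensorial hX hY x).add hW hW']
  exact D.curvature_apply hX hY (hW.add_section hW') x

theorem SmoothConnection.curvature_smul_left (D : SmoothConnection (PqcModel n) M) (x : M) (a : ℝ)
    (w u v : TangentSpace 𝓘(ℝ, PqcModel n) x) :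
    D.curvature x (a • w) u v = a • D.curvature x w u v := by
  obtain ⟨X, hX, rfl⟩ := PqcStructure.exists_smoothField u
  obtain ⟨Y, hY, rfl⟩ := PqcStructure.exists_smoothField v
  obtain ⟨W, hW, rfl⟩ := PqcStructure.exists_smoothField w
  have hs : IsSmoothField ((fun _ : M => a) • W) := contMDiff_const.smul_section hW
  rw [D.curvature_apply hX hY hW]
  refine Eq.trans ?_ ((D.curvatureOnFields_tensorial hX hY x).smul
    (contMDiff_const (c := a)) hW)
  exact D.curvature_apply hX hY hs x

namespace PqcStructure.Complement

variable {P : PqcStructure n M} {V : P.Complement} {D : SmoothConnection (PqcModel n) M}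
  {A B : Π x : M, TangentSpace 𝓘(ℝ, PqcModel n) x}

theorem coeff_contMDiff (s t : Fin 3) (hA : IsSmoothField A) :
    IsSmoothFn (n := n) (fun x => V.coeff D s t x (A x)) :=
  P.η_contMDiff t (D.nabla_contMDiff hA (V.ξ_smooth s))

variable (V D) in
/-- The curvature of the connection forms `c_st`. -/
def curvCoeff (s t : Fin 3) (A B : Π x : M, TangentSpace 𝓘(ℝ, PqcModel n) x) (x : M) : ℝ :=
  lieD A (fun y => V.coeff D s t y (B y)) x - lieD B (fun y => V.coeff D s t y (A y)) x -
    V.coeff D s t x (mlieBracket 𝓘(ℝ, PqcModel n) A B x) +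
  ∑ u, (V.coeff D s u x (B x) * V.coeff D u t x (A x) -
    V.coeff D s u x (A x) * V.coeff D u t x (B x))

theorem IsCanonical.nabla_ξ (hD : V.IsCanonical D) (s : Fin 3) :
    D.nabla A (V.ξ s) = ∑ t, (fun x => V.coeff D s t x (A x)) • V.ξ t := by
  funext x
  simp only [Finset.sum_apply, Pi.smul_apply']
  exact hD.cov_ξ s x (A x)

theorem IsCanonical.nabla_nabla_ξ (hD : V.IsCanonical D) (hB : IsSmoothField B) (s : Fin 3)
    (x : M) : D.nabla A (D.nabla B (V.ξ s)) x =
      ∑ t, (lieD A (fun y => V.coeff D s t y (B y)) x +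
        ∑ u, V.coeff D s u x (B x) * V.coeff D u t x (A x)) • V.ξ t x := by
  rw [hD.nabla_ξ (A := B),
    D.nabla_sum_right _ (fun t => (coeff_contMDiff s t hB).smul_section (V.ξ_smooth t))]
  simp only [fun t => D.nabla_smul_right (X := A) (coeff_contMDiff (V := V) (D := D) s t hB)
    (V.ξ_smooth t), hD.nabla_ξ (A := A)]
  simp only [Fin.sum_univ_three, Pi.add_apply, Pi.smul_apply']
  module

theorem IsCanonical.curvatureOnFields_ξ (hD : V.IsCanonical D) (hA : IsSmoothField A)
    (hB : IsSmoothField B) (s : Fin 3) (x : M) :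
    curvatureOnFields D.cov (V.ξ s) A B x = ∑ t, V.curvCoeff D s t A B x • V.ξ t x := by
  rw [D.curvatureOnFields_eq]
  rw [Pi.sub_apply, Pi.sub_apply, hD.nabla_nabla_ξ hA, hD.nabla_nabla_ξ hB, hD.nabla_ξ]
  simp only [curvCoeff, Fin.sum_univ_three, Pi.add_apply, Pi.smul_apply']
  module

theorem IsCanonical.nabla_JH (hD : V.IsCanonical D) {Y : Π x : M, TangentSpace 𝓘(ℝ, PqcModel n) x}
    (hY : P.IsHorizontalField Y) (s : Fin 3) :
    D.nabla A (fun y => V.JH s y (Y y)) = (fun y => V.JH s y (D.nabla A Y y)) +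
      ∑ t, (fun x => V.coeff D s t x (A x)) • (fun y => V.JH t y (Y y)) := by
  funext x
  simp only [Pi.add_apply, Finset.sum_apply, Pi.smul_apply']
  exact hD.cov_JH s hY x (A x)

theorem IsCanonical.nabla_nabla_JH (hD : V.IsCanonical D) (hB : IsSmoothField B)
    {Y : Π x : M, TangentSpace 𝓘(ℝ, PqcModel n) x} (hY : P.IsHorizontalField Y) (s : Fin 3)
    (x : M) : D.nabla A (D.nabla B (fun y => V.JH s y (Y y))) x =
      V.JH s x (D.nabla A (D.nabla B Y) x) +
      (∑ t, V.coeff D s t x (A x) • V.JH t x (D.nabla B Y x) +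
        ∑ t, V.coeff D s t x (B x) • V.JH t x (D.nabla A Y x)) +
      ∑ t, (lieD A (fun y => V.coeff D s t y (B y)) x +
        ∑ u, V.coeff D s u x (B x) * V.coeff D u t x (A x)) • V.JH t x (Y x) := by
  have h1 (t) := (coeff_contMDiff (V := V) (D := D) s t hB).smul_section
    (V.JH_isHorizontal t hY).smooth
  rw [hD.nabla_JH (A := B) hY,
    D.nabla_add_right (V.JH_isHorizontal s (hD.nabla_isHorizontal hB hY)).smooth (by
      rw [Fin.sum_univ_three]; exact ((h1 0).add_section (h1 1)).add_section (h1 2)),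
    D.nabla_sum_right _ h1]
  simp only [fun t => D.nabla_smul_right (X := A) (coeff_contMDiff (V := V) (D := D) s t hB)
    (V.JH_isHorizontal t hY).smooth, hD.nabla_JH (A := A) hY,
    hD.nabla_JH (A := A) (hD.nabla_isHorizontal hB hY)]
  simp only [Fin.sum_univ_three, Pi.add_apply, Pi.smul_apply']
  module

theorem IsCanonical.curvatureOnFields_JH (hD : V.IsCanonical D) (hA : IsSmoothField A)
    (hB : IsSmoothField B) {Y : Π x : M, TangentSpace 𝓘(ℝ, PqcModel n) x}
    (hY : P.IsHorizontalField Y) (s : Fin 3) (x : M) :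
    curvatureOnFields D.cov (fun y => V.JH s y (Y y)) A B x -
      V.JH s x (curvatureOnFields D.cov Y A B x) =
      ∑ t, V.curvCoeff D s t A B x • V.JH t x (Y x) := by
  have hsub (u v : TangentSpace 𝓘(ℝ, PqcModel n) x) :
      V.JH s x (u - v) = V.JH s x u - V.JH s x v := by simp [JH]
  rw [D.curvatureOnFields_eq, D.curvatureOnFields_eq, Pi.sub_apply, Pi.sub_apply, Pi.sub_apply,
    Pi.sub_apply, hD.nabla_nabla_JH hA hY, hD.nabla_nabla_JH hB hY, hD.nabla_JH hY, hsub, hsub]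
  simp only [curvCoeff, Fin.sum_univ_three, Pi.add_apply, Pi.smul_apply']
  module

variable (V D) in
/-- `η_t(R(u, v) ξ_s)`. -/
def vertCurv (s t : Fin 3) (x : M) (u v : TangentSpace 𝓘(ℝ, PqcModel n) x) : ℝ :=
  P.η t x (D.curvature x (V.ξ s x) u v)

theorem IsCanonical.vertCurv_apply (hD : V.IsCanonical D) (hA : IsSmoothField A)
    (hB : IsSmoothField B) (s t : Fin 3) (x : M) :
    V.vertCurv D s t x (A x) (B x) = V.curvCoeff D s t A B x := by
  rw [vertCurv, D.curvature_apply hA hB (V.ξ_smooth s), hD.curvatureOnFields_ξ hA hB]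
  simp [V.dual]

theorem IsCanonical.curvature_mem_H (hD : V.IsCanonical D) {x : M} (X : P.H x)
    (u v : TangentSpace 𝓘(ℝ, PqcModel n) x) : D.curvature x X u v ∈ P.H x := by
  obtain ⟨A, hA, rfl⟩ := exists_smoothField u
  obtain ⟨B, hB, rfl⟩ := exists_smoothField v
  obtain ⟨Y, hY, e⟩ := V.exists_horizontalField X
  rw [← e, D.curvature_apply hA hB hY.smooth, D.curvatureOnFields_eq]
  exact Submodule.sub_mem _ (Submodule.sub_mem _
    ((hD.nabla_isHorizontal hA (hD.nabla_isHorizontal hB hY)).horizontal x)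
    ((hD.nabla_isHorizontal hB (hD.nabla_isHorizontal hA hY)).horizontal x))
    (hD.preserves_H Y hY x _)

variable (V D) in
/-- The endomorphism `R(u, v)` of `H`. -/
def curvEnd (x : M) (u v : TangentSpace 𝓘(ℝ, PqcModel n) x) : P.H x →ₗ[ℝ] P.H x where
  toFun X := V.proj x (D.curvature x X u v)
  map_add' X Y := by rw [Submodule.coe_add, D.curvature_add_left, map_add]
  map_smul' a X := by rw [Submodule.coe_smul, D.curvature_smul_left, map_smul, RingHom.id_apply]

/-- The curvature acts on the bundle spanned by the `J_s` by the same matrix as on `V`, because `ξ_s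
↦ J_s` is parallel. -/
theorem IsCanonical.curvEnd_commutator (hD : V.IsCanonical D) {x : M} (s : Fin 3) (X : P.H x)
    (u v : TangentSpace 𝓘(ℝ, PqcModel n) x) :
    V.curvEnd D x u v (P.J s x X) - P.J s x (V.curvEnd D x u v X) =
      ∑ t, V.vertCurv D s t x u v • P.J t x X := by
  obtain ⟨A, hA, rfl⟩ := exists_smoothField u
  obtain ⟨B, hB, rfl⟩ := exists_smoothField v
  obtain ⟨Y, hY, e⟩ := V.exists_horizontalField X
  have h := hD.curvatureOnFields_JH hA hB hY s x
  rw [← D.curvature_apply hA hB hY.smooth,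
    ← D.curvature_apply hA hB (V.JH_isHorizontal s hY).smooth, e] at h
  simp only [JH_coe, ← hD.vertCurv_apply hA hB] at h
  have h2 := congrArg (V.proj x) h
  simp only [map_sub, map_sum, map_smul, proj_self, JH] at h2
  exact h2

theorem ρ_apply (s : Fin 3) (x : M) (u v : TangentSpace 𝓘(ℝ, PqcModel n) x) :
    V.ρ D s x ![u, v] = 1 / (4 * n) *
      gContract (P.g x) (fun X Y => P.g x (V.curvEnd D x u v X) (P.J s x Y)) := by
  have e : (gContract (P.g x) (V.curvatureForm D s x)) u v =
      gContract (P.g x) (fun X Y => P.g x (V.curvEnd D x u v X) (P.J s x Y)) := by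
    simp [gContract, LinearMap.sum_apply, curvatureForm_apply, curvEnd]
  rw [← e]
  rfl

/-- The Ricci forms are the curvature of the bundle `V`. -/
theorem IsCanonical.vertCurv_eq (hD : V.IsCanonical D) (hn : 0 < n) {i j k : Fin 3}
    (c : IsCyclic3 i j k) (x : M) (u v : TangentSpace 𝓘(ℝ, PqcModel n) x) :
    V.vertCurv D i i x u v = 0 ∧ V.vertCurv D i k x u v = 2 * pqSign i * V.ρ D j x ![u, v] ∧
      V.vertCurv D i j x u v = -2 * pqSign i * V.ρ D k x ![u, v] := by
  have hn' : (4 * n : ℝ) ≠ 0 := by positivity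
  refine (P.isParaquaternionic x).commutator_coeff c (N := 4 * n) ?_ hn' (V.curvEnd D x u v)
    (fun t => V.vertCurv D i t x u v) (fun s => V.ρ D s x ![u, v]) (fun s => ?_)
    (fun X => hD.curvEnd_commutator i X u v)
  · rw [V.finrank_H]; push_cast; ring
  · rw [ρ_apply]; field_simp

/-- `dα_j = 2 ε_i ρ_j + ε_j α_i ∧ α_k`. -/
theorem IsCanonical.dα (hD : V.IsCanonical D) (hn : 0 < n) {i j k : Fin 3}
    (c : IsCyclic3 i j k) (hA : IsSmoothField A) (hB : IsSmoothField B) (x : M) :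
    lieD A (fun y => V.α D j y ![B y]) x - lieD B (fun y => V.α D j y ![A y]) x -
      V.α D j x ![mlieBracket 𝓘(ℝ, PqcModel n) A B x] =
    2 * pqSign i * V.ρ D j x ![A x, B x] + pqSign j *
      (V.α D i x ![A x] * V.α D k x ![B x] - V.α D i x ![B x] * V.α D k x ![A x]) := by
  -- This is the `(i, k)` entry of the curvature of `V`, where `c_ik = α_j`. The diagonal of `c`
  -- vanishes, so in the quadratic term only the intermediate index `j` survives.
  have h := (hD.vertCurv_eq hn c x (A x) (B x)).2.1
  rw [hD.vertCurv_apply hA hB, curvCoeff, c.sum_eq] at h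
  simp only [coeff_ik c, hD.coeff_self hn, hD.coeff_ij hn c, hD.coeff_ij hn c.rot] at h
  rcases c.signs with ⟨e1, e2, e3⟩ | ⟨e1, e2, e3⟩ | ⟨e1, e2, e3⟩ <;>
  simp only [e1, e2, e3] at h ⊢ <;> linarith

end PqcStructure.Complement

end PqcGeometry

/-! ### The torsion of the canonical connection -/

section PqcGeometry

open VectorField

variable {n : ℕ} {M : Type*} [TopologicalSpace M] [T2Space M] [ChartedSpace (PqcModel n) M]
  [IsManifold 𝓘(ℝ, PqcModel n) ∞ M]

namespace SmoothConnection

variable (D : SmoothConnection (PqcModel n) M) {X Y Z : Π x : M, TangentSpace 𝓘(ℝ, PqcModel n) x}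

/-- The covariant derivative of the torsion, `(∇_X T)(Y, Z)`. -/
def nablaTor (X Y Z : Π x : M, TangentSpace 𝓘(ℝ, PqcModel n) x) :
    Π x : M, TangentSpace 𝓘(ℝ, PqcModel n) x :=
  D.nabla X (D.tor Y Z) - D.tor (D.nabla X Y) Z - D.tor Y (D.nabla X Z)

theorem tor_sub_right : D.tor X (Y - Z) = D.tor X Y - D.tor X Z := by
  funext x; simp [tor]

/-- Trading each bracket `[B, C]` for `∇_B C - ∇_C B - T(B, C)` puts the Bianchi identity in a form
where the parallelism of the torsion on `H` can be used. -/
theorem bianchi_nablaTor (hX : IsSmoothField X) (hY : IsSmoothField Y) (hZ : IsSmoothField Z) :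
    curvatureOnFields D.cov Z X Y + curvatureOnFields D.cov X Y Z + curvatureOnFields D.cov Y Z X =
      (D.nablaTor X Y Z + D.nablaTor Y Z X + D.nablaTor Z X Y) -
      (D.tor X (D.tor Y Z) + D.tor Y (D.tor Z X) + D.tor Z (D.tor X Y)) := by
  have e {A B C : Π x : M, TangentSpace 𝓘(ℝ, PqcModel n) x} (hB : IsSmoothField B)
      (hC : IsSmoothField C) : D.tor A (mlieBracket 𝓘(ℝ, PqcModel n) B C) =
      D.tor A (D.nabla B C) - D.tor A (D.nabla C B) - D.tor A (D.tor B C) := by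
    rw [D.tor_eq hB hC, ← tor_sub_right, ← tor_sub_right]
    congr 1
    abel
  rw [D.bianchi hX hY hZ, e hX hY, e hY hZ, e hZ hX]
  simp only [nablaTor]
  rw [D.tor_swap (X := D.nabla X Y), D.tor_swap (X := D.nabla Y Z), D.tor_swap (X := D.nabla Z X)]
  abel

end SmoothConnection

namespace PqcStructure.Complement

variable {P : PqcStructure n M} {V : P.Complement} {D : SmoothConnection (PqcModel n) M}
  {A B : Π x : M, TangentSpace 𝓘(ℝ, PqcModel n) x}

/-- The torsion of horizontal vectors is vertical by assumption, and its components are the values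
of `dη_t`, which the contact condition prescribes. -/
theorem IsCanonical.torsion_hor (hD : V.IsCanonical D) {x : M} (X Y : P.H x) :
    D.cov.torsion x X Y = ∑ t, (-2 * pqSign t * P.g x (P.J t x X) Y) • V.ξ t x := by
  obtain ⟨A, hA, eA⟩ := V.exists_horizontalField X
  obtain ⟨B, hB, eB⟩ := V.exists_horizontalField Y
  have h := hD.torsion_horizontal A B hA hB x
  rw [eA, eB] at h
  have h2 (t) : P.η t x (D.cov.torsion x X Y) = -2 * pqSign t * P.g x (P.J t x X) Y := by
    rw [← P.contact]
    have := hD.dη_eq t x X Y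
    simp only [η_of_mem, zero_mul, sub_zero, Finset.sum_const_zero, add_zero] at this
    exact this.symm
  simp only [← h2]
  rw [h]
  simp [V.dual]

theorem gH_JH {x : M} (s : Fin 3) {u v : TangentSpace 𝓘(ℝ, PqcModel n) x} (hu : u ∈ P.H x)
    (hv : v ∈ P.H x) : V.gH x (V.JH s x u) v = P.g x (P.J s x ⟨u, hu⟩) ⟨v, hv⟩ := by
  rw [gH, JH, proj_self, V.proj_of_mem hu, V.proj_of_mem hv]

theorem IsCanonical.tor_hor (hD : V.IsCanonical D) (hA : P.IsHorizontalField A)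
    (hB : P.IsHorizontalField B) : D.tor A B =
      ∑ t, (fun y => (-2 * pqSign t) * V.gH y (V.JH t y (A y)) (B y)) • V.ξ t := by
  funext x
  have := hD.torsion_hor ⟨A x, hA.horizontal x⟩ ⟨B x, hB.horizontal x⟩
  simp only [Finset.sum_apply, Pi.smul_apply', gH_JH _ (hA.horizontal x) (hB.horizontal x)]
  exact this

theorem gH_add_left {x : M} (u u' v : TangentSpace 𝓘(ℝ, PqcModel n) x) :
    V.gH x (u + u') v = V.gH x u v + V.gH x u' v := by simp [gH]

theorem gH_smul_left {x : M} (a : ℝ) (u v : TangentSpace 𝓘(ℝ, PqcModel n) x) :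
    V.gH x (a • u) v = a * V.gH x u v := by simp [gH]

/-- The torsion is parallel on horizontal arguments. -/
theorem IsCanonical.nablaTor_hor (hD : V.IsCanonical D) (hn : 0 < n)
    {C : Π x : M, TangentSpace 𝓘(ℝ, PqcModel n) x} (hC : IsSmoothField C)
    (hA : P.IsHorizontalField A) (hB : P.IsHorizontalField B) : D.nablaTor C A B = 0 := by
  funext x
  have hs (t) : IsSmoothFn (n := n) (fun y => V.gH y (V.JH t y (A y)) (B y)) :=
    V.gH_contMDiff (V.JH_isHorizontal t hA) hB
  have hs' (t) : IsSmoothFn (n := n) (fun y => (-2 * pqSign t) * V.gH y (V.JH t y (A y)) (B y)) :=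
    contMDiff_const.mul (hs t)
  have l (t) : lieD C (fun y => (-2 * pqSign t) * V.gH y (V.JH t y (A y)) (B y)) x =
      (-2 * pqSign t) * (V.gH x (V.JH t x (D.nabla C A x)) (B x) +
        ∑ u, V.coeff D t u x (C x) * V.gH x (V.JH u x (A x)) (B x) +
        V.gH x (V.JH t x (A x)) (D.nabla C B x)) := by
    rw [lieD_const_mul (hs t)]
    congr 1
    refine (hD.metric _ B (V.JH_isHorizontal t hA) hB x (C x)).trans ?_
    rw [hD.cov_JH t hA, gH_add_left]
    congr 2
    simp only [Fin.sum_univ_three, gH_add_left, gH_smul_left]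
  simp only [SmoothConnection.nablaTor, Pi.sub_apply, hD.tor_hor hA hB,
    hD.tor_hor (hD.nabla_isHorizontal hC hA) hB, hD.tor_hor hA (hD.nabla_isHorizontal hC hB)]
  rw [D.nabla_sum_right _ (fun t => (hs' t).smul_section (V.ξ_smooth t))]
  simp only [fun t => D.nabla_smul_right (X := C) (hs' t) (V.ξ_smooth t), hD.nabla_ξ,
    Fin.sum_univ_three, Pi.add_apply, Pi.smul_apply', l, hD.coeff_self hn]
  -- The derivatives of the `ω_t` and of the `ξ_t` both involve the `c_st`. In `∑ ε_t ω_t ⊗ ξ_t`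
  -- they cancel because `c` is skew relative to `diag(ε)`.
  have c01 := hD.coeff_anticomm hn 0 1 x (C x)
  have c02 := hD.coeff_anticomm hn 0 2 x (C x)
  have c12 := hD.coeff_anticomm hn 1 2 x (C x)
  simp only [pqSign, Matrix.cons_val_zero, Matrix.cons_val_one, Matrix.cons_val] at c01 c02 c12 ⊢
  rw [show V.coeff D 0 1 x (C x) = -V.coeff D 1 0 x (C x) by linarith,
    show V.coeff D 0 2 x (C x) = V.coeff D 2 0 x (C x) by linarith,
    show V.coeff D 1 2 x (C x) = V.coeff D 2 1 x (C x) by linarith, Pi.zero_apply]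
  module

/-- The horizontal first Bianchi identity. -/
theorem IsCanonical.bianchi_hor (hD : V.IsCanonical D) (hn : 0 < n) {x : M} (X Y Z : P.H x) :
    D.curvature x Z X Y + D.curvature x X Y Z + D.curvature x Y Z X =
      (-2 : ℝ) • ∑ s, pqSign s • (P.g x (P.J s x X) Y • D.cov.torsion x (V.ξ s x) Z +
        P.g x (P.J s x Y) Z • D.cov.torsion x (V.ξ s x) X +
        P.g x (P.J s x Z) X • D.cov.torsion x (V.ξ s x) Y) := by
  obtain ⟨A, hA, eA⟩ := V.exists_horizontalField X
  obtain ⟨B, hB, eB⟩ := V.exists_horizontalField Y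
  obtain ⟨C, hC, eC⟩ := V.exists_horizontalField Z
  have h := congrFun (D.bianchi_nablaTor hA.smooth hB.smooth hC.smooth) x
  rw [hD.nablaTor_hor hn hA.smooth hB hC, hD.nablaTor_hor hn hB.smooth hC hA,
    hD.nablaTor_hor hn hC.smooth hA hB] at h
  simp only [Pi.add_apply, Pi.sub_apply, Pi.zero_apply,
    ← D.curvature_apply hA.smooth hB.smooth hC.smooth,
    ← D.curvature_apply hB.smooth hC.smooth hA.smooth,
    ← D.curvature_apply hC.smooth hA.smooth hB.smooth, eA, eB, eC] at h
  rw [h]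
  -- `T(Y, Z)` is a combination of the `ξ_s`, so the quadratic terms involve only the mixed torsion.
  have e (X Y Z : P.H x) : D.cov.torsion x X (D.cov.torsion x Y Z) =
      ∑ s, (2 * pqSign s * P.g x (P.J s x Y) Z) • D.cov.torsion x (V.ξ s x) X := by
    rw [hD.torsion_hor, map_sum]
    refine Finset.sum_congr rfl fun s _ => ?_
    rw [map_smul, D.cov.torsion_antisymm]
    module
  simp only [SmoothConnection.tor, eA, eB, eC, e, Fin.sum_univ_three]
  module

/-- The mixed torsion is horizontal. -/
theorem IsCanonical.torsion_mixed (hD : V.IsCanonical D) (hn : 0 < n) {x : M} (s : Fin 3)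
    (X : P.H x) : D.cov.torsion x (V.ξ s x) X ∈ P.H x := by
  rw [mem_H_iff]
  intro t
  let θ : Fin 3 → Fin 3 → P.H x →ₗ[ℝ] ℝ := fun s t =>
    ((P.η t x).comp ((D.cov.torsion x (V.ξ s x)).comp (P.H x).subtypeL)).toLinearMap
  have hθ (s t) (X : P.H x) : θ s t X = P.η t x (D.cov.torsion x (V.ξ s x) X) := rfl
  rw [← hθ]
  refine (P.isParaquaternionic x).mixed_torsion_eq_zero (N := 4 * n) ?_ (by positivity) θ ?_ ?_ s t X
  · rw [V.finrank_H]; push_cast; ring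
  -- The curvature terms of the horizontal Bianchi identity lie in `H`, so `η_t` leaves a relation
  -- on the mixed torsion alone.
  · intro t X Y Z
    have h := congrArg (P.η t x) (hD.bianchi_hor hn X Y Z)
    simp only [map_add, map_smul, map_sum, smul_eq_mul, ← hθ,
      mem_H_iff.1 (hD.curvature_mem_H _ _ _) t] at h
    linarith
  · intro h4 X
    have hn1 : n = 1 := by
      have : (n : ℝ) = 1 := by linarith
      exact_mod_cast this
    obtain ⟨r1, r2⟩ := hD.reeb_dim_seven hn1 x X X.2
    -- The Reeb conditions concern `dη`. The connection coefficients drop out of them: `c_ss = 0`,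
    -- and skewness says `c_ji = ε_k c_ij`.
    have e (s t) : P.dη t x ![V.ξ s x, X] = θ s t X + V.coeff D s t x X := by
      rw [hD.dη_eq, hθ]
      simp [V.dual, η_of_mem]
    refine ⟨fun s => ?_, fun i j k c => ?_⟩
    · have := r1 s
      rwa [e, hD.coeff_self hn, add_zero] at this
    · have h1 := r2 i
      have h2 := hD.coeff_anticomm hn i j x X
      obtain ⟨rfl, rfl⟩ := c
      rw [e, e] at h1
      rcases (IsCyclic3.of i).signs with ⟨e1, e2, e3⟩ | ⟨e1, e2, e3⟩ | ⟨e1, e2, e3⟩ <;>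
      simp only [e1, e2, e3] at h1 h2 ⊢ <;> linarith

end PqcStructure.Complement

end PqcGeometry

/-! ### Vertical torsion, the identity `σ = λ` and the Ricci forms on the manifold. -/

section PqcGeometry

open VectorField

variable {n : ℕ} {M : Type*} [TopologicalSpace M] [T2Space M] [ChartedSpace (PqcModel n) M]
  [IsManifold 𝓘(ℝ, PqcModel n) ∞ M]

namespace PqcStructure.Complement

variable {P : PqcStructure n M} {V : P.Complement} {D : SmoothConnection (PqcModel n) M}
  {A B : Π x : M, TangentSpace 𝓘(ℝ, PqcModel n) x}

variable (V D) in
/-- The endomorphism `T(ξ_s, ·)` of `H`, as a linear map. -/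
def torsionLin (s : Fin 3) (x : M) : P.H x →ₗ[ℝ] P.H x :=
  ((V.proj x).comp ((D.cov.torsion x (V.ξ s x)).comp (P.H x).subtypeL)).toLinearMap

theorem IsCanonical.torsionLin_coe (hD : V.IsCanonical D) (hn : 0 < n) {x : M} (s : Fin 3)
    (X : P.H x) : (V.torsionLin D s x X : TangentSpace 𝓘(ℝ, PqcModel n) x) =
      D.cov.torsion x (V.ξ s x) X := by
  change (V.proj x (D.cov.torsion x (V.ξ s x) X) : TangentSpace 𝓘(ℝ, PqcModel n) x) = _
  rw [V.proj_of_mem (hD.torsion_mixed hn s X)]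

variable (V D) in
/-- The vertical torsion `η_t(T(ξ_a, ξ_b))`. -/
def vertTor (t a b : Fin 3) (x : M) : ℝ := P.η t x (D.cov.torsion x (V.ξ a x) (V.ξ b x))

theorem IsCanonical.η_tor_hor_vert (hD : V.IsCanonical D) (hn : 0 < n) {x : M} (t : Fin 3)
    (X : P.H x) (a : Fin 3 → ℝ) :
    P.η t x (D.cov.torsion x X (∑ s, a s • V.ξ s x)) = 0 := by
  have e (s) : P.η t x (D.cov.torsion x X (V.ξ s x)) = 0 := by
    rw [D.cov.torsion_antisymm, map_neg, mem_H_iff.1 (hD.torsion_mixed hn s X) t, neg_zero]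
  simp [map_sum, e]

/-- The vertical part of the first Bianchi identity for `X, Y, ξ_s`. -/
theorem IsCanonical.vertCurv_hor (hD : V.IsCanonical D) (hn : 0 < n) {x : M} (t s : Fin 3)
    (X Y : P.H x) : V.vertCurv D s t x X Y =
      -2 * (∑ u, pqSign u * P.g x (P.J u x X) Y * V.vertTor D t u s x) -
      2 * pqSign t * (P.g x (V.torsionLin D s x Y) (P.J t x X) -
        P.g x (V.torsionLin D s x X) (P.J t x Y)) := by
  obtain ⟨A, hA, eA⟩ := V.exists_horizontalField X
  obtain ⟨B, hB, eB⟩ := V.exists_horizontalField Y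
  have hξ := V.ξ_smooth s
  have h := congrFun (D.bianchi_nablaTor hA.smooth hB.smooth hξ) x
  rw [hD.nablaTor_hor hn hξ hA hB] at h
  -- The mixed torsion is horizontal and `∇` preserves both `H` and `V`, so its covariant derivative
  -- has no vertical component.
  have z {A B : Π x : M, TangentSpace 𝓘(ℝ, PqcModel n) x} (hA : P.IsHorizontalField A)
      (hB : P.IsHorizontalField B) : P.η t x (D.nablaTor A B (V.ξ s) x) = 0 := by
    have hT : P.IsHorizontalField (D.tor B (V.ξ s)) := by
      refine ⟨D.tor_contMDiff hB.smooth hξ, fun y => ?_⟩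
      rw [D.tor_swap]
      exact Submodule.neg_mem _ (hD.torsion_mixed hn s ⟨B y, hB.horizontal y⟩)
    have e1 := mem_H_iff.1 ((hD.nabla_isHorizontal hA.smooth hT).horizontal x) t
    have e2 := hD.η_tor_hor_vert hn t
      ⟨D.nabla A B x, (hD.nabla_isHorizontal hA.smooth hB).horizontal x⟩ (Pi.single s 1)
    have e3 := hD.η_tor_hor_vert hn t ⟨B x, hB.horizontal x⟩
      (fun u => V.coeff D s u x (A x))
    rw [← hD.cov_ξ] at e3
    simp only [Pi.single_apply, ite_smul, one_smul, zero_smul, Finset.sum_ite_eq',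
      Finset.mem_univ, if_true] at e2
    simp only [SmoothConnection.nablaTor, Pi.sub_apply, map_sub, e1]
    change 0 - P.η t x (D.cov.torsion x (D.nabla A B x) (V.ξ s x)) -
      P.η t x (D.cov.torsion x (B x) (D.cov (V.ξ s) x (A x))) = 0
    rw [e2, e3]; simp
  have z' : P.η t x (D.nablaTor B (V.ξ s) A x) = 0 := by
    have : D.nablaTor B (V.ξ s) A = -D.nablaTor B A (V.ξ s) := by
      simp only [SmoothConnection.nablaTor]
      rw [D.tor_swap (X := V.ξ s) (Y := A), D.tor_swap (X := D.nabla B (V.ξ s)),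
        D.tor_swap (X := V.ξ s) (Y := D.nabla B A),
        D.nabla_neg_right (D.tor_contMDiff hA.smooth hξ)]
      abel
    rw [this, Pi.neg_apply, map_neg, z hB hA, neg_zero]
  have h2 := congrArg (P.η t x) h
  simp only [Pi.add_apply, Pi.sub_apply, Pi.zero_apply, map_add, map_sub, z hA hB, z', map_zero,
    ← D.curvature_apply hA.smooth hB.smooth hξ,
    ← D.curvature_apply hB.smooth hξ hA.smooth,
    ← D.curvature_apply hξ hA.smooth hB.smooth, eA, eB,
    mem_H_iff.1 (hD.curvature_mem_H _ _ _) t] at h2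
  have tt (X Y : P.H x) : P.η t x (D.cov.torsion x X Y) = -2 * pqSign t * P.g x (P.J t x X) Y := by
    rw [hD.torsion_hor]; simp [V.dual]
  have f1 : P.η t x (D.tor A (D.tor B (V.ξ s)) x) =
      2 * pqSign t * P.g x (P.J t x X) (V.torsionLin D s x Y) := by
    change P.η t x (D.cov.torsion x (A x) (D.cov.torsion x (B x) (V.ξ s x))) = _
    rw [D.cov.torsion_antisymm (B x), map_neg, map_neg, eA, eB, ← hD.torsionLin_coe hn, tt]
    ring
  have f2 : P.η t x (D.tor B (D.tor (V.ξ s) A) x) =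
      -2 * pqSign t * P.g x (P.J t x Y) (V.torsionLin D s x X) := by
    change P.η t x (D.cov.torsion x (B x) (D.cov.torsion x (V.ξ s x) (A x))) = _
    rw [eA, eB, ← hD.torsionLin_coe hn, tt]
  have f3 : P.η t x (D.tor (V.ξ s) (D.tor A B) x) =
      2 * ∑ u, pqSign u * P.g x (P.J u x X) Y * V.vertTor D t u s x := by
    change P.η t x (D.cov.torsion x (V.ξ s x) (D.cov.torsion x (A x) (B x))) = _
    rw [eA, eB, hD.torsion_hor, map_sum, map_sum, Finset.mul_sum]
    refine Finset.sum_congr rfl fun u _ => ?_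
    rw [map_smul, map_smul, D.cov.torsion_antisymm, map_neg, smul_eq_mul, vertTor]
    ring
  rw [f1, f2, f3] at h2
  have g1 := P.g_symm x (P.J t x X) (V.torsionLin D s x Y)
  have g2 := P.g_symm x (P.J t x Y) (V.torsionLin D s x X)
  rw [g1, g2] at h2
  change P.η t x (D.curvature x (V.ξ s x) X Y) = _
  linarith

theorem ω_apply (s : Fin 3) (x : M) (u v : TangentSpace 𝓘(ℝ, PqcModel n) x) :
    V.ω_ s x ![u, v] = P.g x (P.J s x (V.proj x u)) (V.proj x v) := by
  have h := P.contact s x (V.proj x u) (V.proj x v)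
  have e : V.ω_ s x ![u, v] = -(pqSign s / 2) * P.dη s x ![V.proj x u, V.proj x v] := by
    refine congrArg (fun w => -(pqSign s / 2) * P.dη s x w) ?_
    funext i; fin_cases i <;> rfl
  rw [e, PqcStructure.dη, h]
  linear_combination P.g x (P.J s x (V.proj x u)) (V.proj x v) * pqSign_mul_self s

theorem ω_hor (s : Fin 3) {x : M} (X Y : P.H x) : V.ω_ s x ![X, Y] = P.g x (P.J s x X) Y := by
  rw [ω_apply, proj_self, proj_self]

variable (V D) in
/-- The Ricci form `ρ_s` on `H`, as a bilinear map. -/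
def ricciBilin (s : Fin 3) (x : M) : P.H x →ₗ[ℝ] P.H x →ₗ[ℝ] ℝ :=
  ((1 / (4 * n) : ℝ) • gContract (P.g x) (V.curvatureForm D s x)).domRestrict₁₂ (P.H x) (P.H x)

theorem ricciBilin_apply (s : Fin 3) (x : M) (X Y : P.H x) :
    V.ricciBilin D s x X Y = V.ρ D s x ![X, Y] := rfl

variable (V D) in
/-- The curvature on `H`, `horCurv Z X Y = R(X, Y) Z`. -/
def horCurv (x : M) : P.H x →ₗ[ℝ] P.H x →ₗ[ℝ] P.H x →ₗ[ℝ] P.H x where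
  toFun Z := ((D.curvature x Z).toLinearMap₁₂.domRestrict₁₂ (P.H x) (P.H x)).compr₂
    (V.proj x).toLinearMap
  map_add' Z Z' := by
    ext X Y
    have := congrArg (V.proj x) (D.curvature_add_left x Z Z' X Y)
    rw [map_add] at this
    exact congrArg Subtype.val this
  map_smul' a Z := by
    ext X Y
    have := congrArg (V.proj x) (D.curvature_smul_left x a Z X Y)
    rw [map_smul] at this
    exact congrArg Subtype.val this

theorem horCurv_apply (x : M) (X Y Z : P.H x) :
    V.horCurv D x Z X Y = V.proj x (D.curvature x Z X Y) := rfl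

theorem IsCanonical.torsionLin_perp (hD : V.IsCanonical D) (x : M) (s u : Fin 3) :
    gContract (P.g x) (fun X Y => P.g x (V.torsionLin D s x X) (P.J u x Y)) = 0 :=
  hD.torsion_perp_sp1 s u x

theorem curvature_swap (x : M) (w u v : TangentSpace 𝓘(ℝ, PqcModel n) x) :
    D.curvature x w u v = -D.curvature x w v u := by
  have h := D.curvature_self x w (u + v)
  simp only [map_add, add_apply, D.curvature_self, zero_add, add_zero] at h
  exact eq_neg_of_add_eq_zero_right h

theorem IsCanonical.horCurv_commutator (hD : V.IsCanonical D) (hn : 0 < n) (x : M) {i j k : Fin 3}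
    (c : IsCyclic3 i j k) (X Y Z : P.H x) :
    V.horCurv D x (P.J i x Z) X Y - P.J i x (V.horCurv D x Z X Y) =
      (2 * pqSign i * V.ricciBilin D j x X Y) • P.J k x Z +
        (-2 * pqSign i * V.ricciBilin D k x X Y) • P.J j x Z := by
  have e := hD.curvEnd_commutator i Z (X : TangentSpace 𝓘(ℝ, PqcModel n) x) Y
  obtain ⟨e1, e2, e3⟩ := hD.vertCurv_eq hn c x (X : TangentSpace 𝓘(ℝ, PqcModel n) x) Y
  rw [c.sum_eq, e1, e2, e3, zero_smul, zero_add] at e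
  exact e.trans (add_comm _ _)

theorem horCurv_trace (hn : 0 < n) (x : M) (s : Fin 3) (X Y : P.H x) :
    gContract (P.g x) (fun Z Z' => P.g x (V.horCurv D x Z X Y) (P.J s x Z')) =
      4 * n * V.ricciBilin D s x X Y := by
  have hn' : (4 * n : ℝ) * (1 / (4 * n)) = 1 := mul_one_div_cancel (by positivity)
  rw [ricciBilin_apply, ρ_apply]
  exact ((mul_assoc _ _ _).symm.trans (by rw [hn', one_mul]; rfl)).symm

theorem IsCanonical.horCurv_bianchi (hD : V.IsCanonical D) (hn : 0 < n) (x : M) (X Y Z : P.H x) :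
    V.horCurv D x Z X Y + V.horCurv D x X Y Z + V.horCurv D x Y Z X =
      (-2 : ℝ) • ∑ s, pqSign s • (P.g x (P.J s x X) Y • V.torsionLin D s x Z +
        P.g x (P.J s x Y) Z • V.torsionLin D s x X +
        P.g x (P.J s x Z) X • V.torsionLin D s x Y) := by
  have e := congrArg (V.proj x) (hD.bianchi_hor hn X Y Z)
  simp only [map_add, map_smul, map_sum] at e
  exact e

/-- The consequences of the Bianchi identity at a point. -/
theorem IsCanonical.torsion_ricci (hD : V.IsCanonical D) (hn : 0 < n) (x : M) {i j k : Fin 3}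
    (c : IsCyclic3 i j k) :
    (V.vertTor D i i j x = 0 ∧ V.vertTor D i k i x = 0 ∧
      V.vertTor D i j k x = pqSign i * V.lam D x) ∧
    gContract (P.g x) (fun X Y : P.H x => V.ρ D i x ![X, P.J i x Y]) =
      4 * n * pqSign i * V.lam D x ∧
    ∀ X Y : P.H x, P.g x (V.torsionLin D i x Y) (P.J i x X) =
        P.g x (V.torsionLin D i x X) (P.J i x Y) ∧
      V.ρ D i x ![X, Y] + V.lam D x * P.g x (P.J i x X) Y = pqSign i *
        (P.g x (V.torsionLin D k x Y) (P.J j x X) - P.g x (V.torsionLin D k x X) (P.J j x Y)) ∧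
      V.ρ D i x ![X, Y] + V.lam D x * P.g x (P.J i x X) Y = -pqSign i *
        (P.g x (V.torsionLin D j x Y) (P.J k x X) - P.g x (V.torsionLin D j x X) (P.J k x Y)) := by
  have hN : (Module.finrank ℝ (P.H x) : ℝ) = 4 * n := by rw [V.finrank_H]; push_cast; ring
  have hn' : (0 : ℝ) < n := by exact_mod_cast hn
  obtain ⟨-, σ, h⟩ := (P.isParaquaternionic x).ricci_forms hN (by positivity)
    (T := fun s => V.torsionLin D s x)
    (fun t a b => V.vertTor D t a b x)
    (fun t a b => by simp only [vertTor]; rw [D.cov.torsion_antisymm, map_neg])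
    (hD.torsionLin_perp x) (fun t s X Y => V.vertCurv D s t x X Y)
    (fun s X Y => V.ρ D s x ![X, Y]) (fun t s X Y => hD.vertCurv_hor hn t s X Y)
    (fun i j k c X Y => hD.vertCurv_eq hn c x X Y)
  have hσ (s) := (h s _ _ (IsCyclic3.of s)).2.1
  have hs := (P.isParaquaternionic x).scalar_curvature hN (by positivity)
    (T := fun s => V.torsionLin D s x) (hD.torsionLin_perp x) (V.horCurv D x)
    (fun s => V.ricciBilin D s x) σ
    (fun Z X Y => by rw [horCurv_apply, horCurv_apply, curvature_swap, map_neg])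
    (fun i j k c X Y Z => hD.horCurv_commutator hn x c X Y Z)
    (fun s X Y => horCurv_trace hn x s X Y) hσ (fun X Y Z => hD.horCurv_bianchi hn x X Y Z)
  -- With `N = 4n` the trace identity is `Scal = N (N + 8) σ / 2 = 8n(n+2) σ`, which explains the
  -- normalization of `λ`.
  have hl : V.lam D x = σ := by
    have e : V.scal D x = gContract (P.g x) (fun B C : P.H x =>
        gContract (P.g x) (fun X Y : P.H x => P.g x (V.horCurv D x C X B) Y)) := by
      simp only [scal, ric, gH, proj_self, horCurv_apply]
    rw [← e] at hs
    rw [lam, div_eq_iff (by positivity)]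
    linarith
  rw [hl]
  exact h i j k c

theorem IsCanonical.lam_eq (hD : V.IsCanonical D) (hn : 0 < n) (x : M) :
    V.lam D x = V.vertTor D 0 1 2 x := by
  have h := (hD.torsion_ricci hn x (IsCyclic3.of 0)).1.2.2
  simp only [pqSign, Matrix.cons_val_zero, one_mul] at h
  exact h.symm

/-- `λ` is defined by pointwise contractions. Its smoothness comes from the identity `λ = η₁(T(ξ₂,
ξ₃))`. -/
theorem IsCanonical.lam_contMDiff (hD : V.IsCanonical D) (hn : 0 < n) :
    IsSmoothFn (n := n) (V.lam D) := by
  have e : V.lam D = fun x => P.η 0 x (D.tor (V.ξ 1) (V.ξ 2) x) := funext (hD.lam_eq hn)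
  rw [e]
  exact P.η_contMDiff 0 (D.tor_contMDiff (V.ξ_smooth 1) (V.ξ_smooth 2))

/-- The trace of `ρ_s` equals `4n ε_s λ`, so removing it adds exactly `λ ω_s`. -/
theorem IsCanonical.ρ₀_eq (hD : V.IsCanonical D) (hn : 0 < n) (s : Fin 3) (x : M) :
    V.ρ₀ D s x = V.ρ D s x + V.lam D x • V.ω_ s x := by
  have hn' : (n : ℝ) ≠ 0 := by positivity
  have q := pqSign_mul_self s
  have e : -(pqSign s / (4 * n)) * (4 * n * pqSign s * V.lam D x) = -V.lam D x := by
    field_simp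
    linear_combination -V.lam D x * q
  rw [ρ₀, (hD.torsion_ricci hn x (IsCyclic3.of s)).2.1, e]
  ext v
  change V.ρ D s x v - -V.lam D x * V.ω_ s x v = V.ρ D s x v + V.lam D x * V.ω_ s x v
  ring

/-- The horizontal part of the trace-free Ricci forms. -/
theorem IsCanonical.ρ₀_hor (hD : V.IsCanonical D) (hn : 0 < n) (s t : Fin 3) (x : M)
    (X Y : P.H x) : V.ρ₀ D s x ![X, Y] =
      (V.τ D x X (P.J s x Y) - V.τ D x (P.J s x X) Y) / 2 + 2 * V.μ D t x X (P.J s x Y) := by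
  rw [hD.ρ₀_eq hn]
  have h := (P.isParaquaternionic x).ricci_forms_torsion (fun s => V.torsionLin D s x)
    (fun s X Y => (P.isParaquaternionic x).orthogonal_sp (V.torsionLin D s x)
      (fun B h1 h2 => hD.torsion_perp_sp s x B h1 h2) X Y)
    (fun i X Y => V.ρ D i x ![X, Y] + V.lam D x * P.g x (P.J i x X) Y)
    (fun i j k c X Y => (hD.torsion_ricci hn x c).2.2 X Y)
    (V.τ D x) (fun X Y => rfl) (fun s => V.μ D s x) (fun s X Y => rfl) s t X Y
  rw [← h, ← ω_hor (V := V)]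
  rfl

end PqcStructure.Complement

end PqcGeometry

/-! ### The structure equation for the contact forms. -/

section PqcGeometry

open VectorField

variable {n : ℕ} {M : Type*} [TopologicalSpace M] [T2Space M] [ChartedSpace (PqcModel n) M]
  [IsManifold 𝓘(ℝ, PqcModel n) ∞ M]

namespace PqcStructure.Complement

variable {P : PqcStructure n M} {V : P.Complement} {D : SmoothConnection (PqcModel n) M}

theorem vertTor_swap (t a b : Fin 3) (x : M) : V.vertTor D t a b x = -V.vertTor D t b a x := by
  simp only [vertTor]
  rw [D.cov.torsion_antisymm, map_neg]

/-- The vertical part of the torsion. -/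
theorem IsCanonical.η_torsion (hD : V.IsCanonical D) (hn : 0 < n) {i j k : Fin 3}
    (c : IsCyclic3 i j k) (x : M) (u v : TangentSpace 𝓘(ℝ, PqcModel n) x) :
    P.η i x (D.cov.torsion x u v) = -2 * pqSign i * V.ω_ i x ![u, v] +
      pqSign i * V.lam D x * (P.η j x u * P.η k x v - P.η j x v * P.η k x u) := by
  obtain ⟨h1, h2, h3⟩ := (hD.torsion_ricci hn x c).1
  have e (X : P.H x) (a : Fin 3 → ℝ) :
      P.η i x (D.cov.torsion x (∑ s, a s • V.ξ s x) X) = 0 := by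
    rw [D.cov.torsion_antisymm, map_neg, hD.η_tor_hor_vert hn, neg_zero]
  have e' (a b : Fin 3 → ℝ) : P.η i x (D.cov.torsion x (∑ s, a s • V.ξ s x)
      (∑ s, b s • V.ξ s x)) = ∑ s, ∑ t, a s * (b t * V.vertTor D i s t x) := by
    simp only [map_sum, _root_.sum_apply, map_smul, _root_.smul_apply,
      smul_eq_mul, Finset.mul_sum, vertTor]
    rw [Finset.sum_comm]
    exact Finset.sum_congr rfl fun s _ => Finset.sum_congr rfl fun t _ => by ring
  conv_lhs => rw [V.decomposition x u, V.decomposition x v]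
  simp only [map_add, _root_.add_apply, e, hD.η_tor_hor_vert hn]
  have s1 (a) : V.vertTor D i a a x = 0 := by have := V.vertTor_swap (D := D) i a a x; linarith
  have s2 := V.vertTor_swap (D := D) i j i x
  have s3 := V.vertTor_swap (D := D) i i k x
  have s4 := V.vertTor_swap (D := D) i k j x
  have tt : P.η i x (D.cov.torsion x (V.proj x u) (V.proj x v)) = -2 * pqSign i * V.ω_ i x ![u, v] := by
    rw [hD.torsion_hor, ω_apply]; simp [V.dual]
  rw [e', tt]
  simp only [c.sum_eq, s1, s2, s3, s4, h1, h2, h3]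
  ring

/-- The structure equation for `dη_i`, evaluated. -/
theorem IsCanonical.dη_apply_eq (hD : V.IsCanonical D) (hn : 0 < n) {i j k : Fin 3}
    (c : IsCyclic3 i j k) (x : M) (u v : TangentSpace 𝓘(ℝ, PqcModel n) x) :
    P.dη i x ![u, v] = -2 * pqSign i * V.ω_ i x ![u, v] +
      (P.η j x u * V.α D k x ![v] - P.η j x v * V.α D k x ![u]) +
      pqSign j * (P.η k x u * V.α D j x ![v] - P.η k x v * V.α D j x ![u]) +
      pqSign i * V.lam D x * (P.η j x u * P.η k x v - P.η j x v * P.η k x u) := by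
  rw [hD.dη_eq, hD.η_torsion hn c, c.sum_eq]
  simp only [hD.coeff_self hn, coeff_ik c.rot, hD.coeff_ij hn c.rot.rot]
  ring

/-- The structure equation for `dη_i`. -/
theorem IsCanonical.dη_formula (hD : V.IsCanonical D) (hn : 0 < n) {i j k : Fin 3}
    (c : IsCyclic3 i j k) (x : M) : P.dη i x = (-2 * pqSign i) • V.ω_ i x +
      P.η₁ j x ⋏ V.α D k x + pqSign j • (P.η₁ k x ⋏ V.α D j x) +
      (pqSign i * V.lam D x) • (P.η₁ j x ⋏ P.η₁ k x) := by
  ext w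
  have e : w = ![w 0, w 1] := by funext a; fin_cases a <;> rfl
  rw [e, hD.dη_apply_eq hn c]
  change _ = -2 * pqSign i * V.ω_ i x ![w 0, w 1] + (P.η₁ j x ⋏ V.α D k x) ![w 0, w 1] +
    pqSign j * (P.η₁ k x ⋏ V.α D j x) ![w 0, w 1] +
    pqSign i * V.lam D x * (P.η₁ j x ⋏ P.η₁ k x) ![w 0, w 1]
  rw [wedge_one_one, wedge_one_one, wedge_one_one]
  rfl

theorem ω_contMDiff (s : Fin 3) {A B : Π x : M, TangentSpace 𝓘(ℝ, PqcModel n) x}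
    (hA : IsSmoothField A) (hB : IsSmoothField B) :
    IsSmoothFn (n := n) (fun y => V.ω_ s y ![A y, B y]) := by
  have e : (fun y => V.ω_ s y ![A y, B y]) = fun y => V.gH y (V.JH s y (V.hor A y)) (V.hor B y) := by
    funext y
    simp only [ω_apply, gH, JH, hor, proj_self]
  rw [e]
  exact V.gH_contMDiff (V.JH_isHorizontal s (V.hor_isHorizontal hA)) (V.hor_isHorizontal hB)

theorem ω_isSmoothForm (s : Fin 3) : IsSmoothForm (V.ω_ s) := by
  intro A hA
  have e : (fun y => V.ω_ s y (fun a => A a y)) = fun y => V.ω_ s y ![A 0 y, A 1 y] :=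
    funext fun y => form_two_eta _ _
  rw [e]
  exact V.ω_contMDiff s (hA 0) (hA 1)

theorem α_contMDiff (s : Fin 3) {A : Π x : M, TangentSpace 𝓘(ℝ, PqcModel n) x}
    (hA : IsSmoothField A) : IsSmoothFn (n := n) (fun y => V.α D s y ![A y]) :=
  V.coeff_contMDiff (D := D) (s + 2) (s + 1) hA

end PqcStructure.Complement

end PqcGeometry

/-! ### The structure equation for the fundamental 2-forms. -/

section PqcGeometry

open VectorField

variable {n : ℕ} {M : Type*} [TopologicalSpace M] [T2Space M] [ChartedSpace (PqcModel n) M]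
  [IsManifold 𝓘(ℝ, PqcModel n) ∞ M]

namespace PqcStructure.Complement

variable {P : PqcStructure n M} {V : P.Complement} {D : SmoothConnection (PqcModel n) M}
  {A B C : Π x : M, TangentSpace 𝓘(ℝ, PqcModel n) x}

variable (P) in
/-- The function `η_s(A)`. -/
def etaFn (s : Fin 3) (A : Π x : M, TangentSpace 𝓘(ℝ, PqcModel n) x) : M → ℝ :=
  fun y => P.η s y (A y)

variable (V D) in
/-- The function `α_s(A)`. -/
def alphaFn (s : Fin 3) (A : Π x : M, TangentSpace 𝓘(ℝ, PqcModel n) x) : M → ℝ :=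
  fun y => V.α D s y ![A y]

theorem smoothFn_mul {f g : M → ℝ} (hf : IsSmoothFn (n := n) f) (hg : IsSmoothFn (n := n) g) :
    IsSmoothFn (n := n) (fun y => f y * g y) := hf.mul hg

theorem smoothFn_add {f g : M → ℝ} (hf : IsSmoothFn (n := n) f) (hg : IsSmoothFn (n := n) g) :
    IsSmoothFn (n := n) (fun y => f y + g y) := hf.add hg

theorem smoothFn_sub {f g : M → ℝ} (hf : IsSmoothFn (n := n) f) (hg : IsSmoothFn (n := n) g) :
    IsSmoothFn (n := n) (fun y => f y - g y) := hf.sub hg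

theorem lieD_mul_sub_mul {f g f' g' : M → ℝ} (hf : IsSmoothFn (n := n) f)
    (hg : IsSmoothFn (n := n) g) (hf' : IsSmoothFn (n := n) f') (hg' : IsSmoothFn (n := n) g')
    (x : M) : lieD A (fun y => f y * g y - f' y * g' y) x =
      f x * lieD A g x + g x * lieD A f x - (f' x * lieD A g' x + g' x * lieD A f' x) := by
  rw [lieD_sub (smoothFn_mul hf hg) (smoothFn_mul hf' hg'), lieD_mul hf hg, lieD_mul hf' hg']

/-- `dη_s` on commuting fields. -/
theorem IsCanonical.lieD_etaFn (hD : V.IsCanonical D) (hn : 0 < n) {i j k : Fin 3}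
    (c : IsCyclic3 i j k) {x : M} (hA : IsSmoothField A) (hB : IsSmoothField B)
    (h : mlieBracket 𝓘(ℝ, PqcModel n) A B x = 0) :
    lieD A (etaFn P i B) x - lieD B (etaFn P i A) x = -2 * pqSign i * V.ω_ i x ![A x, B x] +
      (etaFn P j A x * alphaFn V D k B x - etaFn P j B x * alphaFn V D k A x) +
      pqSign j * (etaFn P k A x * alphaFn V D j B x - etaFn P k B x * alphaFn V D j A x) +
      pqSign i * V.lam D x * (etaFn P j A x * etaFn P k B x - etaFn P j B x * etaFn P k A x) := by
  have h1 := hD.dη_apply_eq hn c x (A x) (B x)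
  rw [dη_apply i hA hB, h, map_zero, sub_zero] at h1
  exact h1

/-- The derivative of `ω_i(B, C)` for commuting vector fields `B`, `C`. -/
theorem IsCanonical.lieD_ω (hD : V.IsCanonical D) (hn : 0 < n) {i j k : Fin 3}
    (c : IsCyclic3 i j k) {x : M} (hB : IsSmoothField B) (hC : IsSmoothField C)
    (h : ∀ᶠ y in 𝓝 x, mlieBracket 𝓘(ℝ, PqcModel n) B C y = 0) :
    2 * lieD A (fun y => V.ω_ i y ![B y, C y]) x = -pqSign i *
      (lieD A (lieD B (etaFn P i C)) x - lieD A (lieD C (etaFn P i B)) x -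
      (etaFn P j B x * lieD A (alphaFn V D k C) x + alphaFn V D k C x * lieD A (etaFn P j B) x -
        (etaFn P j C x * lieD A (alphaFn V D k B) x +
          alphaFn V D k B x * lieD A (etaFn P j C) x)) -
      pqSign j * (etaFn P k B x * lieD A (alphaFn V D j C) x +
        alphaFn V D j C x * lieD A (etaFn P k B) x -
        (etaFn P k C x * lieD A (alphaFn V D j B) x +
          alphaFn V D j B x * lieD A (etaFn P k C) x)) -
      pqSign i * (V.lam D x * (etaFn P j B x * lieD A (etaFn P k C) x +
        etaFn P k C x * lieD A (etaFn P j B) x -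
        (etaFn P j C x * lieD A (etaFn P k B) x + etaFn P k B x * lieD A (etaFn P j C) x)) +
        (etaFn P j B x * etaFn P k C x - etaFn P j C x * etaFn P k B x) *
          lieD A (V.lam D) x)) := by
  have sη (s) {Z : Π x : M, TangentSpace 𝓘(ℝ, PqcModel n) x} (hZ : IsSmoothField Z) :
      IsSmoothFn (n := n) (etaFn P s Z) := P.η_contMDiff s hZ
  have sα (s) {Z : Π x : M, TangentSpace 𝓘(ℝ, PqcModel n) x} (hZ : IsSmoothField Z) :
      IsSmoothFn (n := n) (alphaFn V D s Z) := V.α_contMDiff s hZ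
  have sl := hD.lam_contMDiff hn
  -- The equation for `dη_i` solved for `ω_i`. It must hold on a neighbourhood of `x` because it is
  -- differentiated next, so the bracket of `B` and `C` has to vanish near `x`.
  have e : (fun y => V.ω_ i y ![B y, C y]) =ᶠ[𝓝 x] fun y => -(pqSign i / 2) *
      (lieD B (etaFn P i C) y - lieD C (etaFn P i B) y -
        (etaFn P j B y * alphaFn V D k C y - etaFn P j C y * alphaFn V D k B y) -
        pqSign j * (etaFn P k B y * alphaFn V D j C y - etaFn P k C y * alphaFn V D j B y) -
        pqSign i * (V.lam D y *
          (etaFn P j B y * etaFn P k C y - etaFn P j C y * etaFn P k B y))) := by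
    filter_upwards [h] with y hy
    have h1 := hD.lieD_etaFn hn c hB hC hy
    have h2 := pqSign_mul_self i
    linear_combination (-V.ω_ i y ![B y, C y]) * h2 + pqSign i / 2 * h1
  have s1 := smoothFn_sub (smoothFn_mul (sη j hB) (sα k hC)) (smoothFn_mul (sη j hC) (sα k hB))
  have s2 := smoothFn_sub (smoothFn_mul (sη k hB) (sα j hC)) (smoothFn_mul (sη k hC) (sα j hB))
  have s3 := smoothFn_sub (smoothFn_mul (sη j hB) (sη k hC)) (smoothFn_mul (sη j hC) (sη k hB))
  have s4 := smoothFn_sub (lieD_contMDiff hB (sη i hC)) (lieD_contMDiff hC (sη i hB))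
  have s5 := smoothFn_mul sl s3
  have cc (a : ℝ) : IsSmoothFn (n := n) (fun _ : M => a) := contMDiff_const
  have s6 := smoothFn_mul (cc (pqSign j)) s2
  have s7 := smoothFn_mul (cc (pqSign i)) s5
  have s8 := smoothFn_sub s4 s1
  have s9 := smoothFn_sub s8 s6
  rw [lieD_congr e, lieD_const_mul (smoothFn_sub s9 s7), lieD_sub s9 s7, lieD_sub s8 s6,
    lieD_sub s4 s1, lieD_sub (lieD_contMDiff hB (sη i hC)) (lieD_contMDiff hC (sη i hB)),
    lieD_const_mul s2, lieD_const_mul s5, lieD_mul sl s3,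
    lieD_mul_sub_mul (sη j hB) (sα k hC) (sη j hC) (sα k hB),
    lieD_mul_sub_mul (sη k hB) (sα j hC) (sη k hC) (sα j hB),
    lieD_mul_sub_mul (sη j hB) (sη k hC) (sη j hC) (sη k hB)]
  ring

/-- `dα_s` on commuting fields. -/
theorem IsCanonical.lieD_alphaFn (hD : V.IsCanonical D) (hn : 0 < n) {i j k : Fin 3}
    (c : IsCyclic3 i j k) {x : M} (hA : IsSmoothField A) (hB : IsSmoothField B)
    (h : ∀ᶠ y in 𝓝 x, mlieBracket 𝓘(ℝ, PqcModel n) A B y = 0) :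
    lieD A (alphaFn V D j B) x - lieD B (alphaFn V D j A) x =
      2 * pqSign i * V.ρ D j x ![A x, B x] + pqSign j *
      (alphaFn V D i A x * alphaFn V D k B x - alphaFn V D i B x * alphaFn V D k A x) := by
  have h1 := hD.dα hn c hA hB x
  have z : V.α D j x ![(0 : TangentSpace 𝓘(ℝ, PqcModel n) x)] = 0 := by
    rw [α_apply, coeff, map_zero, map_zero]
  rw [h.self_of_nhds, z, sub_zero] at h1
  exact h1

theorem lieD_lieD_comm {f : M → ℝ} {x : M} (hA : IsSmoothField A) (hB : IsSmoothField B)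
    (hf : IsSmoothFn (n := n) f) (h : ∀ᶠ y in 𝓝 x, mlieBracket 𝓘(ℝ, PqcModel n) A B y = 0) :
    lieD A (lieD B f) x = lieD B (lieD A f) x := by
  have h1 := lieD_lieD_sub hA hB hf x
  rw [lieD, lieD, lieD, h.self_of_nhds, map_zero] at h1
  exact sub_eq_zero.1 h1

theorem formDeriv_two {ψ : Π x : M, TangentSpace 𝓘(ℝ, PqcModel n) x [⋀^Fin 2]→L[ℝ] ℝ}
    (hψ : IsSmoothForm ψ) (x : M) (u : Fin 3 → TangentSpace 𝓘(ℝ, PqcModel n) x) :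
    let A := fun a => coordField x (chartVec x (u a))
    formDeriv ψ x u = lieD (A 0) (fun y => ψ y ![A 1 y, A 2 y]) x -
      lieD (A 1) (fun y => ψ y ![A 0 y, A 2 y]) x + lieD (A 2) (fun y => ψ y ![A 0 y, A 1 y]) x := by
  intro A
  have e (a b : Fin 3) (w : Π y : M, Fin 2 → TangentSpace 𝓘(ℝ, PqcModel n) y)
      (hw : ∀ y, w y 0 = A a y ∧ w y 1 = A b y) :
      (fun y => ψ y (w y)) = fun y => ψ y ![A a y, A b y] := by
    funext y
    rw [form_two_eta, (hw y).1, (hw y).2]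
  rw [formDeriv_apply hψ, Fin.sum_univ_three,
    e 1 2 (fun y => (0 : Fin 3).removeNth fun a => coordField x (chartVec x (u a)) y)
      fun y => ⟨rfl, rfl⟩,
    e 0 2 (fun y => (1 : Fin 3).removeNth fun a => coordField x (chartVec x (u a)) y)
      fun y => ⟨rfl, rfl⟩,
    e 0 1 (fun y => (2 : Fin 3).removeNth fun a => coordField x (chartVec x (u a)) y)
      fun y => ⟨rfl, rfl⟩]
  simp only [lieD, A, coordField_self]
  simp [sub_eq_add_neg]

/-- The structure equation for `dω_i`, evaluated. -/
theorem IsCanonical.dω_apply (hD : V.IsCanonical D) (hn : 0 < n) {i j k : Fin 3}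
    (c : IsCyclic3 i j k) (x : M) (u : Fin 3 → TangentSpace 𝓘(ℝ, PqcModel n) x) :
    pqSign i * formDeriv (V.ω_ i) x u = 
      (V.ω_ j x ⋏ (-(pqSign j • V.α D k x) + (pqSign k * V.lam D x) • P.η₁ k x)) u +
      (V.ω_ k x ⋏ (pqSign i • V.α D j x - (pqSign j * V.lam D x) • P.η₁ j x)) u -
      pqSign j * (V.ρ D k x ⋏ P.η₁ j x) u + pqSign k * (V.ρ D j x ⋏ P.η₁ k x) u +
      pqSign i / 2 * (V.dlam D x ⋏ P.η₁ j x ⋏ P.η₁ k x) u := by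
  set A : Fin 3 → Π y : M, TangentSpace 𝓘(ℝ, PqcModel n) y :=
    fun a => coordField x (chartVec x (u a))
  have sA (a) : IsSmoothField (A a) := coordField_contMDiff x _
  have br (a b) := coordField_bracket (M := M) x (chartVec x (u a)) (chartVec x (u b))
  have ev (a) : u a = A a x := (coordField_self x (u a)).symm
  have sη (s a) : IsSmoothFn (n := n) (etaFn P s (A a)) := P.η_contMDiff s (sA a)
  have h0 := hD.lieD_ω (A := A 0) hn c (sA 1) (sA 2) (br 1 2)
  have h1 := hD.lieD_ω (A := A 1) hn c (sA 0) (sA 2) (br 0 2)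
  have h2 := hD.lieD_ω (A := A 2) hn c (sA 0) (sA 1) (br 0 1)
  have q01 := lieD_lieD_comm (sA 0) (sA 1) (sη i 2) (br 0 1)
  have q02 := lieD_lieD_comm (sA 0) (sA 2) (sη i 1) (br 0 2)
  have q12 := lieD_lieD_comm (sA 1) (sA 2) (sη i 0) (br 1 2)
  have dj (a b) := hD.lieD_etaFn hn c.rot (sA a) (sA b) (br a b).self_of_nhds
  have dk (a b) := hD.lieD_etaFn hn c.rot.rot (sA a) (sA b) (br a b).self_of_nhds
  have aj (a b) := hD.lieD_alphaFn hn c (sA a) (sA b) (br a b)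
  have ak (a b) := hD.lieD_alphaFn hn c.rot (sA a) (sA b) (br a b)
  have dl (a) : V.dlam D x ![u a] = lieD (A a) (V.lam D) x := by rw [ev]; rfl
  have fη (s a) : P.η₁ s x ![u a] = etaFn P s (A a) x := by rw [ev]; rfl
  have fα (s a) : V.α D s x ![u a] = alphaFn V D s (A a) x := by rw [ev]; rfl
  have fd : formDeriv (V.ω_ i) x u = lieD (A 0) (fun y => V.ω_ i y ![A 1 y, A 2 y]) x -
      lieD (A 1) (fun y => V.ω_ i y ![A 0 y, A 2 y]) x +
      lieD (A 2) (fun y => V.ω_ i y ![A 0 y, A 1 y]) x := formDeriv_two (V.ω_isSmoothForm i) x u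
  rw [fd, wedge_two_one, wedge_two_one, wedge_two_one,
    wedge_two_one, wedge_one_two, wedge_one_one, wedge_one_one, wedge_one_one]
  have l1 (a) : (-(pqSign j • V.α D k x) + (pqSign k * V.lam D x) • P.η₁ k x) ![u a] =
    -(pqSign j * alphaFn V D k (A a) x) + pqSign k * V.lam D x * etaFn P k (A a) x := by
    rw [← fα, ← fη]; rfl
  have l2 (a) : (pqSign i • V.α D j x - (pqSign j * V.lam D x) • P.η₁ j x) ![u a] =
    pqSign i * alphaFn V D j (A a) x - pqSign j * V.lam D x * etaFn P j (A a) x := by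
    rw [← fα, ← fη]; rfl
  simp only [Matrix.cons_val_zero, Matrix.cons_val_one, l1, l2, dl, fη]
  have ew (s : Fin 3) (a b) : V.ω_ s x ![A a x, A b x] = V.ω_ s x ![u a, u b] := by
    rw [← ev, ← ev]
  have er (s : Fin 3) (a b) : V.ρ D s x ![A a x, A b x] = V.ρ D s x ![u a, u b] := by
    rw [← ev, ← ev]
  simp only [ew, er] at dj dk aj ak
  have dj01 := dj 0 1
  have dj02 := dj 0 2
  have dj12 := dj 1 2
  have dk01 := dk 0 1
  have dk02 := dk 0 2
  have dk12 := dk 1 2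
  have aj01 := aj 0 1
  have aj02 := aj 0 2
  have aj12 := aj 1 2
  have ak01 := ak 0 1
  have ak02 := ak 0 2
  have ak12 := ak 1 2
  clear dj dk aj ak ew er l1 l2 fη fα dl fd sη ev br
  generalize etaFn P i = ηi, etaFn P j = ηj, etaFn P k = ηk, alphaFn V D i = αi,
    alphaFn V D j = αj, alphaFn V D k = αk at *
  rcases c.signs with ⟨e1, e2, e3⟩ | ⟨e1, e2, e3⟩ | ⟨e1, e2, e3⟩ <;>
  -- This is `d(dη_i) = 0` written out on three commuting fields. The `h` terms are the derivatives
  -- of `ω_i`, the `q` terms cancel the second derivatives of `η_i`, and the rest substitute the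
  -- equations for `dη_j`, `dη_k`, `dα_j` and `dα_k`.
  linear_combination (norm := (simp only [e1, e2, e3]; ring))
    pqSign i / 2 * (h0 - h1 + h2) - 1 / 2 * (q01 - q02 + q12) +
    1 / 2 * (αk (A 2) x * dj01 - αk (A 1) x * dj02 + αk (A 0) x * dj12 +
      ηj (A 1) x * ak02 - ηj (A 2) x * ak01 - ηj (A 0) x * ak12) +
    pqSign j / 2 * (αj (A 2) x * dk01 - αj (A 1) x * dk02 + αj (A 0) x * dk12 +
      ηk (A 1) x * aj02 - ηk (A 2) x * aj01 - ηk (A 0) x * aj12) +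
    pqSign i * V.lam D x / 2 * (ηk (A 2) x * dj01 - ηk (A 1) x * dj02 + ηk (A 0) x * dj12 +
      ηj (A 1) x * dk02 - ηj (A 2) x * dk01 - ηj (A 0) x * dk12)

/-- The structure equation for `dω_i`. -/
theorem IsCanonical.dω_formula (hD : V.IsCanonical D) (hn : 0 < n) {i j k : Fin 3}
    (c : IsCyclic3 i j k) (x : M) : pqSign i • formDeriv (V.ω_ i) x =
      V.ω_ j x ⋏ (-(pqSign j • V.α D k x) + (pqSign k * V.lam D x) • P.η₁ k x) +
      V.ω_ k x ⋏ (pqSign i • V.α D j x - (pqSign j * V.lam D x) • P.η₁ j x) -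
      pqSign j • (V.ρ D k x ⋏ P.η₁ j x) + pqSign k • (V.ρ D j x ⋏ P.η₁ k x) +
      (pqSign i / 2) • (V.dlam D x ⋏ P.η₁ j x ⋏ P.η₁ k x) :=
  ContinuousAlternatingMap.ext fun u => hD.dω_apply hn c x u

end PqcStructure.Complement

end PqcGeometry

/-! ### Wedge products evaluated on five vectors, and bilinearity. -/

section Wedge

variable {W : Type*} [AddCommGroup W] [Module ℝ W] [TopologicalSpace W]

/-- The wedge product of a 3-form and a 2-form, evaluated on five vectors in terms of the
values of the two forms on increasing sequences of indices. -/
def wedgeThreeTwo (t : Fin 5 → Fin 5 → Fin 5 → ℝ) (f : Fin 5 → Fin 5 → ℝ) : ℝ :=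
  t 0 1 2 * f 3 4 - t 0 1 3 * f 2 4 + t 0 2 3 * f 1 4 - t 1 2 3 * f 0 4 + t 0 1 4 * f 2 3 -
    t 0 2 4 * f 1 3 + t 1 2 4 * f 0 3 + t 0 3 4 * f 1 2 - t 1 3 4 * f 0 2 + t 2 3 4 * f 0 1

/-- A 2-form commutes with every form, so the 1-form can be moved to the front of the product
without a sign. -/
theorem wedge_one_two_two (b : W [⋀^Fin 1]→L[ℝ] ℝ) (a c : W [⋀^Fin 2]→L[ℝ] ℝ) (u : Fin 5 → W) :
    wedgeThreeTwo (fun p q r => (a ⋏ b) ![u p, u q, u r]) (fun p q => c ![u p, u q]) =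
      (b ⋏ (a ⋏ c)) u := by
  rw [wedge_one_four b (a ⋏ c) u]
  simp only [wedgeThreeTwo, wedge_two_one, wedge_two_two, Matrix.cons_val]
  ring

theorem wedge_one_two_one_one (l b b' : W [⋀^Fin 1]→L[ℝ] ℝ) (c : W [⋀^Fin 2]→L[ℝ] ℝ)
    (u : Fin 5 → W) :
    wedgeThreeTwo (fun p q r => (l ⋏ b ⋏ b') ![u p, u q, u r]) (fun p q => c ![u p, u q]) =
      (l ⋏ c ⋏ b ⋏ b') u := by
  rw [wedge_one_four l (c ⋏ b ⋏ b') u]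
  simp only [wedgeThreeTwo, wedge_one_two, wedge_two_two, wedge_one_one, Matrix.cons_val]
  ring

theorem wedge_two_comm (a c : W [⋀^Fin 2]→L[ℝ] ℝ) : a ⋏ c = c ⋏ a := by
  ext v
  rw [wedge_two_two a c v, wedge_two_two c a v]
  ring

theorem wedge_add_left {p q : ℕ} (a a' : W [⋀^Fin p]→L[ℝ] ℝ) (b : W [⋀^Fin q]→L[ℝ] ℝ) :
    (a + a') ⋏ b = a ⋏ b + a' ⋏ b := by
  ext v
  rw [ContinuousAlternatingMap.add_apply, wedge_apply, wedge_apply, wedge_apply, ← mul_add,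
    ← Finset.sum_add_distrib]
  congr 1
  exact Finset.sum_congr rfl fun σ _ => by rw [ContinuousAlternatingMap.add_apply]; ring

theorem wedge_smul_left {p q : ℕ} (r : ℝ) (a : W [⋀^Fin p]→L[ℝ] ℝ) (b : W [⋀^Fin q]→L[ℝ] ℝ) :
    (r • a) ⋏ b = r • (a ⋏ b) := by
  ext v
  simp only [ContinuousAlternatingMap.smul_apply, wedge_apply, smul_eq_mul, Finset.mul_sum]
  exact Finset.sum_congr rfl fun σ _ => by ring

theorem wedge_add_right {p q : ℕ} (a : W [⋀^Fin p]→L[ℝ] ℝ) (b b' : W [⋀^Fin q]→L[ℝ] ℝ) :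
    a ⋏ (b + b') = a ⋏ b + a ⋏ b' := by
  ext v
  rw [ContinuousAlternatingMap.add_apply, wedge_apply, wedge_apply, wedge_apply, ← mul_add,
    ← Finset.sum_add_distrib]
  congr 1
  exact Finset.sum_congr rfl fun σ _ => by rw [ContinuousAlternatingMap.add_apply]; ring

theorem wedge_sub_right {p q : ℕ} (a : W [⋀^Fin p]→L[ℝ] ℝ) (b b' : W [⋀^Fin q]→L[ℝ] ℝ) :
    a ⋏ (b - b') = a ⋏ b - a ⋏ b' := by
  ext v
  rw [ContinuousAlternatingMap.sub_apply, wedge_apply, wedge_apply, wedge_apply, ← mul_sub,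
    ← Finset.sum_sub_distrib]
  congr 1
  exact Finset.sum_congr rfl fun σ _ => by rw [ContinuousAlternatingMap.sub_apply]; ring

theorem wedge_smul_right {p q : ℕ} (r : ℝ) (a : W [⋀^Fin p]→L[ℝ] ℝ) (b : W [⋀^Fin q]→L[ℝ] ℝ) :
    a ⋏ (r • b) = r • (a ⋏ b) := by
  ext v
  simp only [ContinuousAlternatingMap.smul_apply, wedge_apply, smul_eq_mul, Finset.mul_sum]
  exact Finset.sum_congr rfl fun σ _ => by ring

end Wedge

/-! ### The structure equation for the fundamental 4-form. -/

section PqcGeometry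

open VectorField

variable {n : ℕ} {M : Type*} [TopologicalSpace M] [T2Space M] [ChartedSpace (PqcModel n) M]
  [IsManifold 𝓘(ℝ, PqcModel n) ∞ M]

namespace PqcStructure.Complement

variable {P : PqcStructure n M} {V : P.Complement} {D : SmoothConnection (PqcModel n) M}
  {A B C : Π x : M, TangentSpace 𝓘(ℝ, PqcModel n) x}

variable (V) in
/-- The function `ω_s(A, B)`. -/
def omFn (s : Fin 3) (A B : Π x : M, TangentSpace 𝓘(ℝ, PqcModel n) x) : M → ℝ :=
  fun y => V.ω_ s y ![A y, B y]

/-- In the square of a 2-form the six shuffle terms coincide in pairs, whence the factor `2`. -/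
theorem Ω_apply (x : M) (v : Fin 4 → TangentSpace 𝓘(ℝ, PqcModel n) x) :
    V.Ω x v = ∑ s, -2 * pqSign s * (V.ω_ s x ![v 0, v 1] * V.ω_ s x ![v 2, v 3] -
      V.ω_ s x ![v 0, v 2] * V.ω_ s x ![v 1, v 3] + V.ω_ s x ![v 0, v 3] * V.ω_ s x ![v 1, v 2]) := by
  have e (s) := wedge_two_two (V.ω_ s x) (V.ω_ s x) v
  have h : V.Ω x v = -(V.ω_ 0 x ⋏ V.ω_ 0 x) v - (V.ω_ 1 x ⋏ V.ω_ 1 x) v +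
    (V.ω_ 2 x ⋏ V.ω_ 2 x) v := rfl
  rw [h, e, e, e, Fin.sum_univ_three]
  simp only [pqSign, Matrix.cons_val]
  ring

theorem lieD_quad {f g f' g' f'' g'' : M → ℝ} (hf : IsSmoothFn (n := n) f)
    (hg : IsSmoothFn (n := n) g) (hf' : IsSmoothFn (n := n) f') (hg' : IsSmoothFn (n := n) g')
    (hf'' : IsSmoothFn (n := n) f'') (hg'' : IsSmoothFn (n := n) g'') (r : ℝ) (x : M) :
    lieD A (fun y => r * (f y * g y - f' y * g' y + f'' y * g'' y)) x =
      r * (f x * lieD A g x + g x * lieD A f x - (f' x * lieD A g' x + g' x * lieD A f' x) +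
        (f'' x * lieD A g'' x + g'' x * lieD A f'' x)) := by
  have h := smoothFn_sub (smoothFn_mul hf hg) (smoothFn_mul hf' hg')
  rw [lieD_const_mul (smoothFn_add h (smoothFn_mul hf'' hg'')), lieD_add h (smoothFn_mul hf'' hg''),
    lieD_mul_sub_mul hf hg hf' hg', lieD_mul hf'' hg'']

theorem Ω_eq_sum (B : Fin 4 → Π x : M, TangentSpace 𝓘(ℝ, PqcModel n) x) :
    (fun y => V.Ω y (fun a => B a y)) = fun y =>
      -2 * pqSign 0 * (V.omFn 0 (B 0) (B 1) y * V.omFn 0 (B 2) (B 3) y -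
        V.omFn 0 (B 0) (B 2) y * V.omFn 0 (B 1) (B 3) y +
        V.omFn 0 (B 0) (B 3) y * V.omFn 0 (B 1) (B 2) y) +
      -2 * pqSign 1 * (V.omFn 1 (B 0) (B 1) y * V.omFn 1 (B 2) (B 3) y -
        V.omFn 1 (B 0) (B 2) y * V.omFn 1 (B 1) (B 3) y +
        V.omFn 1 (B 0) (B 3) y * V.omFn 1 (B 1) (B 2) y) +
      -2 * pqSign 2 * (V.omFn 2 (B 0) (B 1) y * V.omFn 2 (B 2) (B 3) y -
        V.omFn 2 (B 0) (B 2) y * V.omFn 2 (B 1) (B 3) y +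
        V.omFn 2 (B 0) (B 3) y * V.omFn 2 (B 1) (B 2) y) := by
  funext y
  rw [Ω_apply, Fin.sum_univ_three]
  rfl

theorem omFn_quad_contMDiff {B : Fin 4 → Π x : M, TangentSpace 𝓘(ℝ, PqcModel n) x}
    (hB : ∀ a, IsSmoothField (B a)) (s : Fin 3) : IsSmoothFn (n := n) (fun y => -2 * pqSign s *
      (V.omFn s (B 0) (B 1) y * V.omFn s (B 2) (B 3) y -
        V.omFn s (B 0) (B 2) y * V.omFn s (B 1) (B 3) y +
        V.omFn s (B 0) (B 3) y * V.omFn s (B 1) (B 2) y)) := by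
  have so (a b) : IsSmoothFn (n := n) (V.omFn s (B a) (B b)) := V.ω_contMDiff s (hB a) (hB b)
  exact smoothFn_mul contMDiff_const (smoothFn_add (smoothFn_sub
    (smoothFn_mul (so 0 1) (so 2 3)) (smoothFn_mul (so 0 2) (so 1 3)))
    (smoothFn_mul (so 0 3) (so 1 2)))

theorem Ω_contMDiff {B : Fin 4 → Π x : M, TangentSpace 𝓘(ℝ, PqcModel n) x}
    (hB : ∀ a, IsSmoothField (B a)) : IsSmoothFn (n := n) (fun y => V.Ω y (fun a => B a y)) := by
  have sm := V.omFn_quad_contMDiff hB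
  rw [Ω_eq_sum]
  exact smoothFn_add (smoothFn_add (sm 0) (sm 1)) (sm 2)

/-- The derivative of `Ω(B₀, B₁, B₂, B₃)`. -/
theorem lieD_Ω {B : Fin 4 → Π x : M, TangentSpace 𝓘(ℝ, PqcModel n) x}
    (hB : ∀ a, IsSmoothField (B a)) (x : M) :
    lieD A (fun y => V.Ω y (fun a => B a y)) x = ∑ s, -2 * pqSign s *
      (V.omFn s (B 0) (B 1) x * lieD A (V.omFn s (B 2) (B 3)) x +
        V.omFn s (B 2) (B 3) x * lieD A (V.omFn s (B 0) (B 1)) x -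
      (V.omFn s (B 0) (B 2) x * lieD A (V.omFn s (B 1) (B 3)) x +
        V.omFn s (B 1) (B 3) x * lieD A (V.omFn s (B 0) (B 2)) x) +
      (V.omFn s (B 0) (B 3) x * lieD A (V.omFn s (B 1) (B 2)) x +
        V.omFn s (B 1) (B 2) x * lieD A (V.omFn s (B 0) (B 3)) x)) := by
  have so (s a b) : IsSmoothFn (n := n) (V.omFn s (B a) (B b)) := V.ω_contMDiff s (hB a) (hB b)
  have sm := V.omFn_quad_contMDiff hB
  rw [Ω_eq_sum, lieD_add (smoothFn_add (sm 0) (sm 1)) (sm 2), lieD_add (sm 0) (sm 1),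
    Fin.sum_univ_three]
  simp only [lieD_quad (so _ 0 1) (so _ 2 3) (so _ 0 2) (so _ 1 3) (so _ 0 3) (so _ 1 2)]

theorem Ω_isSmoothForm : IsSmoothForm V.Ω := fun _ hA => V.Ω_contMDiff hA

/-- `dΩ = -2 ∑ ε_s dω_s ∧ ω_s`. -/
theorem dΩ_apply (x : M) (u : Fin 5 → TangentSpace 𝓘(ℝ, PqcModel n) x) :
    formDeriv V.Ω x u = -2 * ∑ s, pqSign s * wedgeThreeTwo
      (fun p q r => formDeriv (V.ω_ s) x ![u p, u q, u r]) (fun p q => V.ω_ s x ![u p, u q]) := by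
  set A : Fin 5 → Π y : M, TangentSpace 𝓘(ℝ, PqcModel n) y :=
    fun a => coordField x (chartVec x (u a))
  have sA (a) : IsSmoothField (A a) := coordField_contMDiff x _
  have ev (a) : u a = A a x := (coordField_self x (u a)).symm
  have t (s p q r) : formDeriv (V.ω_ s) x ![u p, u q, u r] = lieD (A p) (V.omFn s (A q) (A r)) x -
      lieD (A q) (V.omFn s (A p) (A r)) x + lieD (A r) (V.omFn s (A p) (A q)) x :=
    formDeriv_two (V.ω_isSmoothForm s) x ![u p, u q, u r]
  have o (s p q) : V.ω_ s x ![u p, u q] = V.omFn s (A p) (A q) x := by rw [ev, ev]; rfl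
  have f : formDeriv V.Ω x u = ∑ a : Fin 5, (-1) ^ (a : ℕ) *
      lieD (A a) (fun y => V.Ω y (fun b => A (a.succAbove b) y)) x := by
    rw [formDeriv_apply V.Ω_isSmoothForm]
    refine Finset.sum_congr rfl fun a _ => ?_
    rw [lieD, ← ev]
    rfl
  have L (p : Fin 5) (b : Fin 4 → Fin 5) :=
    lieD_Ω (V := V) (A := A p) (B := fun a => A (b a)) (fun a => sA _) x
  rw [f, Fin.sum_univ_five]
  simp only [L]
  rw [show (0 : Fin 5).succAbove = ![1, 2, 3, 4] by decide,
    show (1 : Fin 5).succAbove = ![0, 2, 3, 4] by decide,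
    show (2 : Fin 5).succAbove = ![0, 1, 3, 4] by decide,
    show (3 : Fin 5).succAbove = ![0, 1, 2, 4] by decide,
    show (4 : Fin 5).succAbove = ![0, 1, 2, 3] by decide]
  simp only [wedgeThreeTwo, t, o, Matrix.cons_val, Finset.mul_sum, ← Finset.sum_add_distrib]
  refine Finset.sum_congr rfl fun s _ => ?_
  simp only [show ((0 : Fin 5) : ℕ) = 0 by rfl, show ((1 : Fin 5) : ℕ) = 1 by rfl,
    show ((2 : Fin 5) : ℕ) = 2 by rfl, show ((3 : Fin 5) : ℕ) = 3 by rfl,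
    show ((4 : Fin 5) : ℕ) = 4 by rfl]
  ring

/-- Each `λ`-term of `dω_i` joins a Ricci term: `ρ_k ∧ η_j` comes with `λ ω_k ∧ η_j`, and `ρ_j ∧
η_k` with `λ ω_j ∧ η_k`. These are the combinations `ρ_s + λ ω_s = ρ⁰_s`. -/
theorem IsCanonical.dω_wedge_ω (hD : V.IsCanonical D) (hn : 0 < n) {i j k : Fin 3}
    (c : IsCyclic3 i j k) (x : M) (u : Fin 5 → TangentSpace 𝓘(ℝ, PqcModel n) x) :
    pqSign i * wedgeThreeTwo (fun p q r => formDeriv (V.ω_ i) x ![u p, u q, u r])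
        (fun p q => V.ω_ i x ![u p, u q]) =
      pqSign j * -(V.α D k x ⋏ (V.ω_ j x ⋏ V.ω_ i x)) u +
      pqSign i * (V.α D j x ⋏ (V.ω_ k x ⋏ V.ω_ i x)) u -
      pqSign j * (P.η₁ j x ⋏ (V.ρ₀ D k x ⋏ V.ω_ i x)) u +
      pqSign k * (P.η₁ k x ⋏ (V.ρ₀ D j x ⋏ V.ω_ i x)) u +
      pqSign i / 2 * (V.dlam D x ⋏ V.ω_ i x ⋏ P.η₁ j x ⋏ P.η₁ k x) u := by
  have hr (s) : V.ρ₀ D s x = V.ρ D s x + V.lam D x • V.ω_ s x := hD.ρ₀_eq hn s x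
  simp only [hr, wedge_add_left, wedge_smul_left, wedge_add_right, wedge_smul_right]
  have w (p q r) := hD.dω_apply hn c x ![u p, u q, u r]
  have e1 : -(pqSign j • V.α D k x) + (pqSign k * V.lam D x) • P.η₁ k x =
      (-pqSign j) • V.α D k x + (pqSign k * V.lam D x) • P.η₁ k x := by
    ext v
    change -(pqSign j * V.α D k x v) + _ = -pqSign j * V.α D k x v + _
    ring
  have e2 : pqSign i • V.α D j x - (pqSign j * V.lam D x) • P.η₁ j x =
      pqSign i • V.α D j x + (-(pqSign j * V.lam D x)) • P.η₁ j x := by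
    ext v
    change pqSign i * V.α D j x v - pqSign j * V.lam D x * P.η₁ j x v =
      pqSign i * V.α D j x v + -(pqSign j * V.lam D x) * P.η₁ j x v
    ring
  simp only [e1, e2, wedge_add_right, wedge_smul_right] at w
  simp only [ContinuousAlternatingMap.add_apply, ContinuousAlternatingMap.smul_apply,
    smul_eq_mul] at w ⊢
  rw [← wedge_one_two_one_one]
  simp only [← wedge_one_two_two]
  simp only [wedgeThreeTwo]
  linear_combination V.ω_ i x ![u 3, u 4] * w 0 1 2 - V.ω_ i x ![u 2, u 4] * w 0 1 3 +
    V.ω_ i x ![u 1, u 4] * w 0 2 3 - V.ω_ i x ![u 0, u 4] * w 1 2 3 +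
    V.ω_ i x ![u 2, u 3] * w 0 1 4 - V.ω_ i x ![u 1, u 3] * w 0 2 4 +
    V.ω_ i x ![u 0, u 3] * w 1 2 4 + V.ω_ i x ![u 1, u 2] * w 0 3 4 -
    V.ω_ i x ![u 0, u 2] * w 1 3 4 + V.ω_ i x ![u 0, u 1] * w 2 3 4

/-- The structure equation for `dΩ`. -/
theorem IsCanonical.dΩ_formula (hD : V.IsCanonical D) (hn : 0 < n) (x : M) :
    formDeriv V.Ω x = ∑ i : Fin 3, -(pqSign i • ((2 : ℝ) • (P.η₁ i x ⋏
        (V.ρ₀ D (i + 2) x ⋏ V.ω_ (i + 1) x - V.ρ₀ D (i + 1) x ⋏ V.ω_ (i + 2) x)) +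
      V.dlam D x ⋏ V.ω_ i x ⋏ P.η₁ (i + 1) x ⋏ P.η₁ (i + 2) x)) := by
  ext u
  have k0 := hD.dω_wedge_ω hn (show IsCyclic3 0 1 2 from ⟨by decide, by decide⟩) x u
  have k1 := hD.dω_wedge_ω hn (show IsCyclic3 1 2 0 from ⟨by decide, by decide⟩) x u
  have k2 := hD.dω_wedge_ω hn (show IsCyclic3 2 0 1 from ⟨by decide, by decide⟩) x u
  have hs (i : Fin 3) : (-(pqSign i • ((2 : ℝ) • (P.η₁ i x ⋏
        (V.ρ₀ D (i + 2) x ⋏ V.ω_ (i + 1) x - V.ρ₀ D (i + 1) x ⋏ V.ω_ (i + 2) x)) +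
      V.dlam D x ⋏ V.ω_ i x ⋏ P.η₁ (i + 1) x ⋏ P.η₁ (i + 2) x))) u =
      -(pqSign i * (2 * ((P.η₁ i x ⋏ (V.ρ₀ D (i + 2) x ⋏ V.ω_ (i + 1) x)) u -
        (P.η₁ i x ⋏ (V.ρ₀ D (i + 1) x ⋏ V.ω_ (i + 2) x)) u) +
      (V.dlam D x ⋏ V.ω_ i x ⋏ P.η₁ (i + 1) x ⋏ P.η₁ (i + 2) x) u)) := by
    rw [wedge_sub_right]
    rfl
  rw [dΩ_apply, ContinuousAlternatingMap.sum_apply]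
  simp only [hs, Fin.sum_univ_three]
  -- Once the products `ω_s ∧ ω_t` are put in a common order, each `α_k ∧ ω_i ∧ ω_j` occurs twice
  -- with opposite signs, once from `dω_i ∧ ω_i` and once from `dω_j ∧ ω_j`.
  rw [k0, k1, k2, wedge_two_comm (V.ω_ 1 x) (V.ω_ 0 x), wedge_two_comm (V.ω_ 2 x) (V.ω_ 0 x),
    wedge_two_comm (V.ω_ 2 x) (V.ω_ 1 x)]
  simp only [zero_add, show (1 : Fin 3) + 1 = 2 by decide, show (1 : Fin 3) + 2 = 0 by decide,
    show (2 : Fin 3) + 1 = 0 by decide, show (2 : Fin 3) + 2 = 1 by decide]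
  ring

end PqcStructure.Complement

end PqcGeometry

end

/-- Local structure equations of a paraquaternionic contact manifold. -/
theorem mainTheorem11 {n : ℕ} (hn : 0 < n) {M : Type*} [TopologicalSpace M] [T2Space M]
    [ChartedSpace (PqcModel n) M] [IsManifold 𝓘(ℝ, PqcModel n) ∞ M]
    (P : PqcStructure n M) (V : P.Complement) (D : SmoothConnection (PqcModel n) M)
    (hD : V.IsCanonical D) :
    -- `α_s` are the connection forms: `∇J_i = α_j J_k + ε_k α_k J_j`, `∇ξ_i = α_j ξ_k + ε_k α_k ξ_j`
    (∀ i j k : Fin 3, j = i + 1 → k = i + 2 →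
      (∀ Y, P.IsHorizontalField Y → ∀ x v,
        D.cov (fun y => V.JH i y (Y y)) x v - V.JH i x (D.cov Y x v) =
          V.α D j x ![v] • V.JH k x (Y x) + (pqSign k * V.α D k x ![v]) • V.JH j x (Y x)) ∧
      ∀ x v, D.cov (V.ξ i) x v =
        V.α D j x ![v] • V.ξ k x + (pqSign k * V.α D k x ![v]) • V.ξ j x) ∧
    -- the equations for `dη_i`
    (∀ i j k : Fin 3, j = i + 1 → k = i + 2 → ∀ x,
      P.dη i x = (-2 * pqSign i) • V.ω_ i x + P.η₁ j x ⋏ V.α D k x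
        + pqSign j • (P.η₁ k x ⋏ V.α D j x)
        + (pqSign i * V.lam D x) • (P.η₁ j x ⋏ P.η₁ k x)) ∧
    -- the equations for `dω_i`
    (∀ i j k : Fin 3, j = i + 1 → k = i + 2 → ∀ x,
      pqSign i • formDeriv (V.ω_ i) x =
        V.ω_ j x ⋏ (-(pqSign j • V.α D k x) + (pqSign k * V.lam D x) • P.η₁ k x)
        + V.ω_ k x ⋏ (pqSign i • V.α D j x - (pqSign j * V.lam D x) • P.η₁ j x)
        - pqSign j • (V.ρ D k x ⋏ P.η₁ j x) + pqSign k • (V.ρ D j x ⋏ P.η₁ k x)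
        + (pqSign i / 2) • (V.dlam D x ⋏ P.η₁ j x ⋏ P.η₁ k x)) ∧
    -- the equation for `dΩ`
    (∀ x, formDeriv V.Ω x = ∑ i : Fin 3, -(pqSign i •
      ((2 : ℝ) • (P.η₁ i x ⋏
          (V.ρ₀ D (i + 2) x ⋏ V.ω_ (i + 1) x - V.ρ₀ D (i + 1) x ⋏ V.ω_ (i + 2) x))
        + V.dlam D x ⋏ V.ω_ i x ⋏ P.η₁ (i + 1) x ⋏ P.η₁ (i + 2) x))) ∧
    -- the horizontal part of `ρ⁰_s`
    (∀ s t x (X Y : P.H x), V.ρ₀ D s x ![X, Y] =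
      (V.τ D x X (P.J s x Y) - V.τ D x (P.J s x X) Y) / 2 + 2 * V.μ D t x X (P.J s x Y)) := by
  exact ⟨fun i j k hj hk => hD.connection_forms hn ⟨hj, hk⟩,
    fun i j k hj hk x => hD.dη_formula hn ⟨hj, hk⟩ x,
    fun i j k hj hk x => hD.dω_formula hn ⟨hj, hk⟩ x,
    fun x => hD.dΩ_formula hn x,
    fun s t x X Y => hD.ρ₀_hor hn s t x X Y⟩
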